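/- **Proposition.** A *2-Salem number* is an algebraic integer $\alpha$ with $|\alpha|>1$ which has exactly one conjugate $\beta\neq\alpha$ with $|\beta|>1$, all of whose other conjugates $\omega$ satisfy $|\omega|\le 1$, and at least one of these $\omega$ lies on the unit circle; its minimal polynomial is called a *2-Salem polynomial*. For a group $W$ with finite generating set $S$ let $a_k$ be the number of elements of word length $k$; $f_S(t)=\sum_{k\ge0} a_kt^k$ is its growth series and $\limsup_{k\to\infty}\sqrt[k]{a_k}$ its growth rate. In the Coxeter graph of a Coxeter polytope in $\mathbb H^4$ the nodes are the facets; two nodes are joined by an edge with label $m\ge 3$ if the bounding hyperplanes meet under the dihedral angle $\pi/m$, by a dotted edge if the hyperplanes do not meet, and are not joined if the hyperplanes are orthogonal. Let $\Gamma$ be one of the following two graphs on eight nodes $0,1,\dots,7$. Both have the edges $0\overset{3}{-}1\overset{5}{-}2\overset{3}{-}3\overset{5}{-}4$ and the dotted edges $\{4,5\},\{6,7\},\{0,6\},\{5,6\},\{4,7\}$. The first graph has in addition the edge $3\overset{5}{-}5$ and the dotted edge $\{0,7\}$; the second has in addition the edge $0\overset{5}{-}5$ and the dotted edge $\{3,7\}$.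 (These are the two gluings of two copies of the compact doubly truncated Coxeter simplex $[3,5,3,5]$ in $\mathbb H^4$ along its orthogonal facet $[3,5,3]$.) There is a compact Coxeter polytope $P\subset\mathbb H^4$ with Coxeter graph $\Gamma$. For every such $P$, let $W$ be the (cocompact) group generated by the set $S$ of the eight reflections in the bounding hyperplanes of $P$. Then, in lowest terms, $$f_S(t)=\frac{(t+1)^4(t^2-t+1)(t^2+t+1)(t^4-t^3+t^2-t+1)(t^4+t^3+t^2+t+1)}{D(t)},$$ $$D(t)=t^{16}-4t^{15}+t^{14}+t^{12}+t^{11}+2t^9+2t^7+t^5+t^4+t^2-4t+1 .$$ The number $D(186)=2008067839285267472384758820173242349$ is prime, $D$ is irreducible in $\mathbb Z[t]$, and $D$ is a 2-Salem polynomial. Its sixteen roots are simple: six pairs of non-real complex conjugate numbers on the unit circle and two reciprocal pairs of positive real numbers $\alpha,\alpha^{-1}$ and $\beta,\beta^{-1}$, where $\alpha>\beta>1$, $|\alpha-3.70422|<5\cdot10^{-6}$ and $|\beta-1.24202|<5\cdot10^{-6}$. Both $\alpha$ and $\beta$ are 2-Salem numbers, and the growth rate of $(W,S)$ equals $\alpha$.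 In particular, the growth rate of $(W,S)$ is a 2-Salem number. -/

import Mathlib

namespace CoxeterGrowth

/-! ### Hyperbolic space and Coxeter polytopes -/

/-- The Lorentzian inner product `x₁y₁ + ⋯ + xₙyₙ - xₙ₊₁yₙ₊₁` on `ℝ^{n,1}`. -/
def lorentz (n : ℕ) : LinearMap.BilinForm ℝ (Fin (n + 1) → ℝ) :=
  LinearMap.mk₂ ℝ
    (fun x y => (∑ i : Fin n, x i.castSucc * y i.castSucc) - x (Fin.last n) * y (Fin.last n))
    (by intro x x' y; simp only [Pi.add_apply, add_mul, Finset.sum_add_distrib]; ring)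
    (by intro c x y; simp only [Pi.smul_apply, smul_eq_mul, mul_sub, Finset.mul_sum, mul_assoc])
    (by intro x y y'; simp only [Pi.add_apply, mul_add, Finset.sum_add_distrib]; ring)
    (by
      intro c x y
      simp only [Pi.smul_apply, smul_eq_mul, mul_sub, Finset.mul_sum, mul_left_comm])

theorem lorentz_apply (n : ℕ) (x y : Fin (n + 1) → ℝ) :
    lorentz n x y =
      (∑ i : Fin n, x i.castSucc * y i.castSucc) - x (Fin.last n) * y (Fin.last n) := rfl

/-- Hyperbolic `n`-space: the upper sheet of the hyperboloid `x ∘ x = -1` in `ℝ^{n,1}`.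
The topology of the hyperbolic metric is the one induced from `ℝ^{n+1}`. -/
def hyperbolicSpace (n : ℕ) : Set (Fin (n + 1) → ℝ) :=
  {x | lorentz n x x = -1 ∧ 0 < x (Fin.last n)}

/-- The intersection of the closed half-spaces `H_j⁻ = {x ∈ ℍⁿ | x ∘ e_j ≤ 0}`, `j ∈ J`. -/
def halfSpaceInter {n : ℕ} {ι : Type*} (e : ι → Fin (n + 1) → ℝ) (J : Set ι) :
    Set (Fin (n + 1) → ℝ) :=
  {x | x ∈ hyperbolicSpace n ∧ ∀ j ∈ J, lorentz n x (e j) ≤ 0}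

/-- A convex polytope of dimension `n` in `ℍⁿ`, given by the unit space-like outer normal vectors
of its bounding hyperplanes: a finite intersection of closed half-spaces which contains a nonempty
open subset of `ℍⁿ`, none of the half-spaces being superfluous. -/
structure HyperbolicPolytope (n : ℕ) (ι : Type*) [Fintype ι] where
  /-- the outer unit normal vectors `e_i` -/
  normal : ι → Fin (n + 1) → ℝ
  unit : ∀ i, lorentz n (normal i) (normal i) = 1
  fullDim : ∃ U : Set (Fin (n + 1) → ℝ), IsOpen U ∧ (U ∩ hyperbolicSpace n).Nonempty ∧
    U ∩ hyperbolicSpace n ⊆ halfSpaceInter normal Set.univ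
  irredundant : ∀ J : Set ι, J ≠ Set.univ →
    halfSpaceInter normal Set.univ ⊂ halfSpaceInter normal J

namespace HyperbolicPolytope

variable {n : ℕ} {ι : Type*} [Fintype ι] (P : HyperbolicPolytope n ι)

/-- The polytope as a set of points of `ℍⁿ`. -/
def carrier : Set (Fin (n + 1) → ℝ) := halfSpaceInter P.normal Set.univ

/-- `P` is a Coxeter polytope whose Coxeter graph is the one encoded by `M`: the hyperplanes `H_i`
and `H_j` (`i ≠ j`) meet under the dihedral angle `π / M i j`, that is,
`cos (π / M i j) = - e_i ∘ e_j`, if `M i j ≠ 0`; they do not meet, that is, `e_i ∘ e_j ≤ -1`, if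
`M i j = 0` (dotted edge). Note that `M i j ≠ 1` for `i ≠ j`. -/
def HasCoxeterGraph (M : CoxeterMatrix ι) : Prop :=
  ∀ i j, i ≠ j →
    (M i j ≠ 0 → -lorentz n (P.normal i) (P.normal j) = Real.cos (Real.pi / (M i j : ℝ))) ∧
    (M i j = 0 → lorentz n (P.normal i) (P.normal j) ≤ -1)

theorem two_mul_lorentz_normal (i : ι) :
    ((2 : ℝ) • lorentz n (P.normal i)) (P.normal i) = 2 := by
  simp [P.unit i]

/-- The reflection `x ↦ x - 2 (x ∘ e_i) e_i` in the hyperplane `H_i`. As usual, an isometry of `ℍⁿ`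
is identified with the linear Lorentz transformation of `ℝ^{n,1}` which restricts to it. -/
noncomputable def reflection (i : ι) : (Fin (n + 1) → ℝ) ≃ₗ[ℝ] (Fin (n + 1) → ℝ) :=
  Module.reflection (P.two_mul_lorentz_normal i)

/-- The group generated by the reflections in the bounding hyperplanes of `P`. -/
def reflectionGroup : Subgroup ((Fin (n + 1) → ℝ) ≃ₗ[ℝ] (Fin (n + 1) → ℝ)) :=
  Subgroup.closure (Set.range P.reflection)

/-- The generating set `S = {s_i}` of the reflection group. -/
def generators : Set P.reflectionGroup :=
  {g | ∃ i, (g : (Fin (n + 1) → ℝ) ≃ₗ[ℝ] (Fin (n + 1) → ℝ)) = P.reflection i}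

end HyperbolicPolytope

/-! ### Growth series and growth rate -/

section Growth

variable {G : Type*} [Group G] (S : Set G)

/-- The word length `l_S(g)`: the least `k` such that `g` is a product of `k` elements of `S`. -/
noncomputable def wordLength (g : G) : ℕ :=
  sInf {k | ∃ l : List G, (∀ s ∈ l, s ∈ S) ∧ l.length = k ∧ l.prod = g}

/-- The number `a_k` of elements of word length `k`. -/
noncomputable def growthCoeff (k : ℕ) : ℕ := Nat.card {g : G // wordLength S g = k}

/-- The growth series `∑ a_k t^k`. -/
noncomputable def growthSeries : PowerSeries ℤ := PowerSeries.mk fun k => (growthCoeff S k : ℤ)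

/-- The growth rate `limsup (a_k)^(1/k)`. -/
noncomputable def growthRate : ℝ :=
  Filter.limsup (fun k : ℕ => (growthCoeff S k : ℝ) ^ (1 / (k : ℝ))) Filter.atTop

/-- The growth function is `p / q` in lowest terms: `p` and `q` are relatively prime integer
polynomials, `q` is normalised to have constant term `1`, and the growth series is the expansion of
`p / q`. In particular `q` is *the* denominator of the growth function. -/
def IsGrowthFunction (p q : Polynomial ℤ) : Prop :=
  IsRelPrime p q ∧ q.coeff 0 = 1 ∧ growthSeries S * (q : PowerSeries ℤ) = (p : PowerSeries ℤ)

end Growth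

/-! ### 2-Salem numbers -/

/-- A 2-Salem number: an algebraic integer `α` with `|α| > 1` having exactly one further conjugate
`β` with `|β| > 1`, and such that all other conjugates lie in the closed unit disc, at least one of
them on the unit circle. -/
def IsTwoSalem (α : ℂ) : Prop :=
  IsIntegral ℤ α ∧ 1 < ‖α‖ ∧
    ∃ β : ℂ, IsConjRoot ℚ α β ∧ β ≠ α ∧ 1 < ‖β‖ ∧
      (∀ ω : ℂ, IsConjRoot ℚ α ω → ω ≠ α → ω ≠ β → ‖ω‖ ≤ 1) ∧
      ∃ ω : ℂ, IsConjRoot ℚ α ω ∧ ω ≠ α ∧ ω ≠ β ∧ ‖ω‖ = 1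

/-- A 2-Salem polynomial: the minimal polynomial of a 2-Salem number. -/
def IsTwoSalemPolynomial (p : Polynomial ℤ) : Prop :=
  ∃ α : ℂ, IsTwoSalem α ∧ p = minpoly ℤ α

/-! ### The Coxeter graphs and the growth function of the example -/

/-- The Coxeter graph of the double of the doubly truncated simplex `[3,5,3,5]` along its
orthogonal facet of type `[3,5,3]`, glued by the reflection. Nodes `0,1,2,3` form the chain
`[3,5,3]`; `4,5` are the two mirror images of the last node of `[3,5,3,5]`; `6,7` are the two
remaining orthogonal facets. The entry `0` stands for a dotted edge. -/
def reflectedGraph : CoxeterMatrix (Fin 8) where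
  M := !![1, 3, 2, 2, 2, 2, 0, 0;
          3, 1, 5, 2, 2, 2, 2, 2;
          2, 5, 1, 3, 2, 2, 2, 2;
          2, 2, 3, 1, 5, 5, 2, 2;
          2, 2, 2, 5, 1, 0, 2, 0;
          2, 2, 2, 5, 0, 1, 0, 2;
          0, 2, 2, 2, 2, 0, 1, 0;
          0, 2, 2, 2, 0, 2, 0, 1]
  isSymm := by ext i j; fin_cases i <;> fin_cases j <;> rfl
  diagonal := by intro i; fin_cases i <;> rfl
  off_diagonal := by intro i j; fin_cases i <;> fin_cases j <;> simp

/-- The same two truncated simplices, glued along the facet `[3,5,3]` after the symmetry of this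
facet which reverses the chain `0,1,2,3`. -/
def twistedGraph : CoxeterMatrix (Fin 8) where
  M := !![1, 3, 2, 2, 2, 5, 0, 2;
          3, 1, 5, 2, 2, 2, 2, 2;
          2, 5, 1, 3, 2, 2, 2, 2;
          2, 2, 3, 1, 5, 2, 2, 0;
          2, 2, 2, 5, 1, 0, 2, 0;
          5, 2, 2, 2, 0, 1, 0, 2;
          0, 2, 2, 2, 2, 0, 1, 0;
          2, 2, 2, 0, 0, 2, 0, 1]
  isSymm := by ext i j; fin_cases i <;> fin_cases j <;> rfl
  diagonal := by intro i; fin_cases i <;> rfl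
  off_diagonal := by intro i j; fin_cases i <;> fin_cases j <;> simp

open Polynomial in
/-- The numerator of the growth function. -/
noncomputable def growthNumerator : ℤ[X] :=
  (X + 1) ^ 4 * (X ^ 2 - X + 1) * (X ^ 2 + X + 1) * (X ^ 4 - X ^ 3 + X ^ 2 - X + 1) *
    (X ^ 4 + X ^ 3 + X ^ 2 + X + 1)

open Polynomial in
/-- The denominator `D(t)` of the growth function. -/
noncomputable def growthDenominator : ℤ[X] :=
  X ^ 16 - 4 * X ^ 15 + X ^ 14 + X ^ 12 + X ^ 11 + 2 * X ^ 9 + 2 * X ^ 7 + X ^ 5 + X ^ 4 + X ^ 2 -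
    4 * X + 1

end CoxeterGrowth

open CoxeterGrowth

namespace CoxeterGrowth

/-! ### Word length -/

section WordLength

variable {G : Type*} [Group G] {S : Set G}

/-! The argument has three independent sources: a combinatorial computation of the growth series, an
analysis of the polynomial D, and explicit coordinates for the two polytopes.

Growth series. The unit normals of a polytope behave like the simple roots of a Coxeter group,
although eight of them in a five-dimensional space are linearly dependent. Positivity is therefore
measured by a linear functional, minus the Lorentz product with an interior point, and by the cone
spanned by the normals. The central fact (`map_root_mem_cone`, `mem_cone_or_neg_mem_cone`) is that
w(e_i) lies in this cone or in its negative according as w s_i is longer or shorter than w. It is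
proved inside the linear reflection group itself, from rank two alone, so neither a Coxeter
presentation nor a tessellation of hyperbolic space is needed. Minimal coset representatives,
longest elements and additivity of lengths follow.

Inclusion-exclusion over descent sets (`sum_neg_one_pow_series_withDescents`) then gives Steinberg's
formula, in which 1/f(t) is the sum of (-1)^|U| t^N(U)/W_U(t) over the subsets U generating finite
groups, N(U) being the length of the longest element. Those lengths are found by multiplying simple
reflections in exact arithmetic over ℤ[φ]. All other subsets contain a dotted edge or a chain
[3,5,3] or [5,3,5], and `not_forall_neg_of_form_nonpos` shows that these contribute nothing.
`series_univ_mul` turns everything into a finite check over the subsets of the eight nodes.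

The polynomial D. It is reciprocal. Sign changes of D give α and β, their inverses come for free,
and six sign changes of the trace polynomial give six conjugate pairs on the unit circle. These
sixteen distinct numbers exhaust the degree. All roots have modulus below 5, so they are far from
186, and the primality of D(186), certified by a chain of Lucas tests, forces irreducibility
(`irreducible_of_prime_eval`). Hence the conjugates of α and β are exactly the roots of D. The
numerator is positive on the positive reals, so the fraction is reduced and 1/α is a genuine pole;
as no root exceeds α in modulus, the growth rate is α (`limsup_coeff_eq`).

Existence. The normals are given over ℤ[φ] for a diagonal form of signature (4,1). Angles, interior
and irredundancy are sign and equality tests. Compactness follows because a combination of the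
Lorentz form with products of the facet inequalities dominates the Euclidean norm on each half of
the polytope (`sq_le_of_pivotCheck`). -/

theorem exists_word (hS : ∀ s ∈ S, s⁻¹ ∈ S) {g : G} (hg : g ∈ Subgroup.closure S) :
    ∃ l : List G, (∀ s ∈ l, s ∈ S) ∧ l.length = wordLength S g ∧ l.prod = g := by
  have hne : {k | ∃ l : List G, (∀ s ∈ l, s ∈ S) ∧ l.length = k ∧ l.prod = g}.Nonempty := by
    rw [← Subgroup.mem_toSubmonoid, Subgroup.closure_toSubmonoid] at hg
    obtain ⟨l, hl, rfl⟩ := Submonoid.exists_list_of_mem_closure hg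
    refine ⟨_, l, fun s hs => ?_, rfl, rfl⟩
    rcases hl s hs with h | h
    · exact h
    · simpa using hS _ h
  exact Nat.sInf_mem hne

theorem wordLength_prod_le {l : List G} (hl : ∀ s ∈ l, s ∈ S) :
    wordLength S l.prod ≤ l.length :=
  Nat.sInf_le ⟨l, hl, rfl, rfl⟩

theorem wordLength_one : wordLength S (1 : G) = 0 := by
  simpa using wordLength_prod_le (S := S) (l := []) (by simp)

theorem eq_one_of_wordLength_eq_zero (hS : ∀ s ∈ S, s⁻¹ ∈ S) {g : G}
    (hg : g ∈ Subgroup.closure S) (h : wordLength S g = 0) : g = 1 := by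
  obtain ⟨l, -, hl, rfl⟩ := exists_word hS hg
  rw [h, List.length_eq_zero_iff] at hl
  simp [hl]

theorem wordLength_mul_le (hS : ∀ s ∈ S, s⁻¹ ∈ S) {g h : G} (hg : g ∈ Subgroup.closure S)
    (hh : h ∈ Subgroup.closure S) :
    wordLength S (g * h) ≤ wordLength S g + wordLength S h := by
  obtain ⟨l, hl, hlen, rfl⟩ := exists_word hS hg
  obtain ⟨l', hl', hlen', rfl⟩ := exists_word hS hh
  rw [← hlen, ← hlen', ← List.prod_append, ← List.length_append]
  refine wordLength_prod_le fun s hs => ?_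
  rcases List.mem_append.1 hs with h | h
  exacts [hl s h, hl' s h]

theorem wordLength_le_one {s : G} (hs : s ∈ S) : wordLength S s ≤ 1 := by
  simpa using wordLength_prod_le (S := S) (l := [s]) (by simpa using hs)

theorem wordLength_mul_le_succ (hS : ∀ s ∈ S, s⁻¹ ∈ S) {g s : G} (hg : g ∈ Subgroup.closure S)
    (hs : s ∈ S) : wordLength S (g * s) ≤ wordLength S g + 1 :=
  (wordLength_mul_le hS hg (Subgroup.subset_closure hs)).trans
    (Nat.add_le_add_left (wordLength_le_one hs) _)

theorem exists_wordLength_mul_inv (hS : ∀ s ∈ S, s⁻¹ ∈ S) {g : G}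
    (hg : g ∈ Subgroup.closure S) (h1 : wordLength S g ≠ 0) :
    ∃ s ∈ S, wordLength S (g * s⁻¹) + 1 = wordLength S g := by
  obtain ⟨l, hl, hlen, rfl⟩ := exists_word hS hg
  rcases List.eq_nil_or_concat l with rfl | ⟨l', s, rfl⟩
  · exact absurd wordLength_one h1
  have hs : s ∈ S := hl s (by simp)
  refine ⟨s, hs, le_antisymm ?_ ?_⟩
  · rw [← hlen]
    have := wordLength_prod_le (S := S) (l := l') fun t ht => hl t (by simp [ht])
    simpa using this
  · have := wordLength_mul_le_succ hS (mul_mem hg (inv_mem (Subgroup.subset_closure hs))) hs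
    simpa using this

theorem finite_wordLength_eq (hS : ∀ s ∈ S, s⁻¹ ∈ S) (hfin : S.Finite) (k : ℕ) :
    {g | g ∈ Subgroup.closure S ∧ wordLength S g = k}.Finite := by
  have : Finite S := hfin
  refine ((List.finite_length_eq S k).image fun l => (l.map Subtype.val).prod).subset ?_
  rintro g ⟨hg, rfl⟩
  obtain ⟨l, hl, hlen, rfl⟩ := exists_word hS hg
  refine ⟨l.pmap Subtype.mk hl, by simpa using hlen, ?_⟩
  simp [List.map_pmap]

end WordLength

/-! ### Linear reflection groups -/

/-- The sequence `0, 1, c, c ^ 2 - 1, …`: the coefficients of the roots of a dihedral reflection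
group with respect to its two simple roots. -/
def rootCoeff (c : ℝ) : ℕ → ℝ
  | 0 => 0
  | 1 => 1
  | k + 2 => c * rootCoeff c (k + 1) - rootCoeff c k

/-- `alternatingProd s t k` is the product `s * t * s * ⋯` of `k` factors. -/
def alternatingProd {G : Type*} [Group G] (s t : G) : ℕ → G
  | 0 => 1
  | k + 1 => s * alternatingProd t s k

/-- A family of vectors `root i` with `form (root i) (root i) = 1` lying in an open half-space, such
that the products of two of the reflections in these vectors behave as in a Coxeter group. -/
structure SimpleRoots (ι V : Type*) [AddCommGroup V] [Module ℝ V] where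
  form : LinearMap.BilinForm ℝ V
  root : ι → V
  height : V →ₗ[ℝ] ℝ
  symm : ∀ x y, form x y = form y x
  unit : ∀ i, form (root i) (root i) = 1
  height_pos : ∀ i, 0 < height (root i)
  reflection : ι → V ≃ₗ[ℝ] V
  reflection_apply : ∀ i x, reflection i x = x - (2 * form x (root i)) • root i
  dihedral : ∀ i j, i ≠ j →
    (∀ k, 0 ≤ rootCoeff (-2 * form (root i) (root j)) k) ∨
    ∃ m, (∀ k ≤ m + 1, 0 ≤ rootCoeff (-2 * form (root i) (root j)) k) ∧
      alternatingProd (reflection i) (reflection j) (m + 1) =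
        alternatingProd (reflection j) (reflection i) (m + 1)

namespace SimpleRoots

variable {ι V : Type*} [AddCommGroup V] [Module ℝ V] (R : SimpleRoots ι V)

theorem reflection_root_self (i : ι) : R.reflection i (R.root i) = -R.root i := by
  rw [R.reflection_apply, R.unit, mul_one, two_smul]; abel

theorem reflection_mul_self (i : ι) : R.reflection i * R.reflection i = 1 := by
  ext x
  rw [LinearEquiv.mul_apply, R.reflection_apply i x, map_sub, map_smul, R.reflection_root_self,
    R.reflection_apply, LinearEquiv.coe_one, id]
  module

theorem reflection_inv (i : ι) : (R.reflection i)⁻¹ = R.reflection i :=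
  inv_eq_of_mul_eq_one_left (R.reflection_mul_self i)

theorem mul_reflection_cancel (w : V ≃ₗ[ℝ] V) (i : ι) :
    w * R.reflection i * R.reflection i = w := by
  rw [mul_assoc, R.reflection_mul_self, mul_one]

/-- The reflections in the simple roots indexed by `T`. -/
def gens (T : Set ι) : Set (V ≃ₗ[ℝ] V) := R.reflection '' T

/-- The parabolic subgroup of type `T`. -/
def parabolic (T : Set ι) : Subgroup (V ≃ₗ[ℝ] V) := Subgroup.closure (R.gens T)

/-- The word length in the parabolic subgroup of type `T`. -/
noncomputable def length (T : Set ι) (w : V ≃ₗ[ℝ] V) : ℕ := wordLength (R.gens T) w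

theorem inv_mem_gens (T : Set ι) : ∀ s ∈ R.gens T, s⁻¹ ∈ R.gens T := by
  rintro _ ⟨i, hi, rfl⟩
  rw [R.reflection_inv]
  exact ⟨i, hi, rfl⟩

variable {R} {T U : Set ι} {w v u : V ≃ₗ[ℝ] V} {i j : ι}

theorem reflection_mem (hi : i ∈ T) : R.reflection i ∈ R.parabolic T :=
  Subgroup.subset_closure ⟨i, hi, rfl⟩

theorem mul_reflection_mem (hw : w ∈ R.parabolic T) (hi : i ∈ T) :
    w * R.reflection i ∈ R.parabolic T := mul_mem hw (reflection_mem hi)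

theorem parabolic_mono (h : T ⊆ U) : R.parabolic T ≤ R.parabolic U :=
  Subgroup.closure_mono (Set.image_mono h)

theorem length_mul_le (hw : w ∈ R.parabolic T) (hv : v ∈ R.parabolic T) :
    R.length T (w * v) ≤ R.length T w + R.length T v := wordLength_mul_le (R.inv_mem_gens T) hw hv

theorem length_mul_reflection_le (hw : w ∈ R.parabolic T) (hi : i ∈ T) :
    R.length T (w * R.reflection i) ≤ R.length T w + 1 :=
  wordLength_mul_le_succ (R.inv_mem_gens T) hw ⟨i, hi, rfl⟩

theorem length_le_mul_reflection (hw : w ∈ R.parabolic T) (hi : i ∈ T) :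
    R.length T w ≤ R.length T (w * R.reflection i) + 1 := by
  simpa [R.mul_reflection_cancel] using length_mul_reflection_le (mul_reflection_mem hw hi) hi

theorem exists_descent (hw : w ∈ R.parabolic T) (h1 : R.length T w ≠ 0) :
    ∃ i ∈ T, R.length T (w * R.reflection i) + 1 = R.length T w := by
  obtain ⟨_, ⟨i, hi, rfl⟩, h⟩ := exists_wordLength_mul_inv (R.inv_mem_gens T) hw h1
  rw [R.reflection_inv] at h
  exact ⟨i, hi, h⟩

theorem length_one : R.length T 1 = 0 := wordLength_one

theorem eq_one_of_length_eq_zero (hw : w ∈ R.parabolic T) (h : R.length T w = 0) : w = 1 :=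
  eq_one_of_wordLength_eq_zero (R.inv_mem_gens T) hw h

theorem alternatingProd_mem (hi : i ∈ T) (hj : j ∈ T) (k : ℕ) :
    alternatingProd (R.reflection i) (R.reflection j) k ∈ R.parabolic T := by
  induction k generalizing i j with
  | zero => exact one_mem _
  | succ k ih => exact mul_mem (reflection_mem hi) (ih hj hi)

theorem length_alternatingProd_le (hi : i ∈ T) (hj : j ∈ T) (k : ℕ) :
    R.length T (alternatingProd (R.reflection i) (R.reflection j) k) ≤ k := by
  induction k generalizing i j with
  | zero => exact length_one.le
  | succ k ih =>
    refine (length_mul_le (reflection_mem hi) (alternatingProd_mem hj hi k)).trans ?_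
    have : R.length T (R.reflection i) ≤ 1 := wordLength_le_one ⟨i, hi, rfl⟩
    have := ih hj hi
    omega

/-- The letter which does not occur at the end of the alternating word `i, j, i, …` with `k`
letters. -/
def offLetter (i j : ι) : ℕ → ι
  | 0 => i
  | k + 1 => offLetter j i k

/-- In the plane of two simple roots a further reflection on the left turns the coefficients (r_k,
r_{k+1}) into (r_{k+1}, r_{k+2}); this is the recursion of `rootCoeff`, a Chebyshev recursion with
r_k = sin(kθ)/sin θ when c = 2 cos θ. -/
theorem alternatingProd_apply (i j : ι) (k : ℕ) :
    alternatingProd (R.reflection i) (R.reflection j) k (R.root (offLetter i j k)) =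
      rootCoeff (-2 * R.form (R.root i) (R.root j)) (k + 1) • R.root i +
        rootCoeff (-2 * R.form (R.root i) (R.root j)) k • R.root j := by
  induction k generalizing i j with
  | zero => simp [alternatingProd, offLetter, rootCoeff]
  | succ k ih =>
    rw [alternatingProd, offLetter, LinearEquiv.mul_apply, ih j i, R.symm (R.root j) (R.root i),
      map_add, map_smul, map_smul, R.reflection_root_self, R.reflection_apply,
      R.symm (R.root j) (R.root i)]
    rw [show k + 1 + 1 = k + 2 from rfl, rootCoeff]
    module

/-- Alternating words are built from the left; this peels off their last letter. The letter missing
at the end of i, j, i, … is the one at the end of j, i, j, … of the same length. -/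
theorem alternatingProd_succ (i j : ι) (k : ℕ) :
    alternatingProd (R.reflection j) (R.reflection i) (k + 1) =
      alternatingProd (R.reflection j) (R.reflection i) k *
        R.reflection (offLetter i j (k + 1)) := by
  induction k generalizing i j with
  | zero => simp [alternatingProd, offLetter]
  | succ k ih =>
    rw [alternatingProd, ih j i, ← mul_assoc, offLetter]
    rfl

/-! #### The cone of positive combinations of simple roots -/

variable (R T) in
/-- The cone of nonnegative combinations of the simple roots indexed by `T`. -/
noncomputable def cone : Submodule NNReal V := Submodule.span NNReal (R.root '' T)

theorem root_mem_cone (hi : i ∈ T) : R.root i ∈ R.cone T := Submodule.subset_span ⟨i, hi, rfl⟩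

theorem smul_mem_cone {c : ℝ} (hc : 0 ≤ c) {x : V} (hx : x ∈ R.cone T) : c • x ∈ R.cone T :=
  (R.cone T).smul_mem ⟨c, hc⟩ hx

theorem height_pos_of_mem_cone {x : V} (hx : x ∈ R.cone T) : x = 0 ∨ 0 < R.height x := by
  induction hx using Submodule.span_induction with
  | mem x hx => obtain ⟨i, -, rfl⟩ := hx; exact Or.inr (R.height_pos i)
  | zero => exact Or.inl rfl
  | add x y _ _ hx hy =>
    rcases hx with rfl | hx
    · simpa using hy
    · rcases hy with rfl | hy
      · simpa using Or.inr hx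
      · right; rw [map_add]; exact add_pos hx hy
  | smul a x _ hx =>
    rcases hx with rfl | hx
    · simp
    · rcases eq_or_ne a 0 with rfl | ha
      · simp
      · right
        rw [NNReal.smul_def, map_smul, smul_eq_mul]
        exact mul_pos (by positivity) hx

theorem map_mem_cone {x : V} (hw : ∀ i ∈ U, w (R.root i) ∈ R.cone T) (hx : x ∈ R.cone U) :
    w x ∈ R.cone T := by
  induction hx using Submodule.span_induction with
  | mem x hx => obtain ⟨i, hi, rfl⟩ := hx; exact hw i hi
  | zero => simp
  | add x y _ _ hx hy => rw [map_add]; exact add_mem hx hy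
  | smul a x _ hx => rw [NNReal.smul_def, map_smul]; exact smul_mem_cone a.2 hx

theorem neg_map_mem_cone {x : V} (hw : ∀ i ∈ U, -w (R.root i) ∈ R.cone T) (hx : x ∈ R.cone U) :
    -w x ∈ R.cone T := by
  induction hx using Submodule.span_induction with
  | mem x hx => obtain ⟨i, hi, rfl⟩ := hx; exact hw i hi
  | zero => simp
  | add x y _ _ hx hy => rw [map_add, neg_add]; exact add_mem hx hy
  | smul a x _ hx => rw [NNReal.smul_def, map_smul, ← smul_neg]; exact smul_mem_cone a.2 hx

theorem root_ne_zero (i : ι) : R.root i ≠ 0 := fun h => by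
  have := R.height_pos i; simp [h] at this

theorem map_root_ne_zero (w : V ≃ₗ[ℝ] V) (i : ι) : w (R.root i) ≠ 0 := by
  simpa using root_ne_zero i

/-- If `w s_i` is not shorter than `w`, then `w` maps the simple root `i` to a nonnegative
combination of simple roots. -/
theorem map_root_mem_cone (hw : w ∈ R.parabolic T) (hi : i ∈ T)
    (hlen : R.length T w ≤ R.length T (w * R.reflection i)) : w (R.root i) ∈ R.cone T := by
  induction hn : R.length T w using Nat.strong_induction_on generalizing w i with
  | _ n ih =>
  subst hn
  by_cases h0 : R.length T w = 0
  · rw [eq_one_of_length_eq_zero hw h0]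
    exact root_mem_cone hi
  obtain ⟨j, hj, hjlen⟩ := exists_descent hw h0
  have hij : i ≠ j := by rintro rfl; omega
  -- representations of `w` ending in an alternating word in `i, j` whose last letter is not `i`
  let p : ℕ → Prop := fun k => ∃ v ∈ R.parabolic T, ∃ x y, (x = i ∧ y = j ∨ x = j ∧ y = i) ∧
    offLetter x y k = i ∧ w = v * alternatingProd (R.reflection x) (R.reflection y) k ∧
    R.length T w = R.length T v + k
  have hp1 : p 1 := ⟨w * R.reflection j, mul_reflection_mem hw hj, j, i, Or.inr ⟨rfl, rfl⟩, rfl,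
    by simp [alternatingProd, R.mul_reflection_cancel], by omega⟩
  have hple : ∀ k, p k → k ≤ R.length T w := by
    rintro k ⟨v, -, x, y, -, -, -, h⟩; omega
  -- such a representation can be prolonged unless the root is mapped into the cone
  have hstep : ∀ k, p k → 0 < k → p (k + 1) ∨
      ((∀ c, c = -2 * R.form (R.root i) (R.root j) → 0 ≤ rootCoeff c k ∧ 0 ≤ rootCoeff c (k + 1)) →
        w (R.root i) ∈ R.cone T) := by
    rintro k ⟨v, hv, x, y, hxy, hoff, hwv, hl⟩ hk
    have hx : x ∈ T := by rcases hxy with ⟨rfl, rfl⟩ | ⟨rfl, rfl⟩ <;> assumption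
    have hy : y ∈ T := by rcases hxy with ⟨rfl, rfl⟩ | ⟨rfl, rfl⟩ <;> assumption
    -- If x shortened v, then absorbing the first letter of the alternating word into v would
    -- express w with at most ℓ(v) - 1 + (k - 1) letters, fewer than ℓ(w).
    have hvx : R.length T v ≤ R.length T (v * R.reflection x) := by
      by_contra! hlt
      obtain ⟨k, rfl⟩ : ∃ k', k = k' + 1 := ⟨k - 1, by omega⟩
      have h1 : w = v * R.reflection x * alternatingProd (R.reflection y) (R.reflection x) k := by
        rw [hwv, alternatingProd, mul_assoc]
      have h2 := length_mul_le (mul_reflection_mem hv hx) (alternatingProd_mem (R := R) hy hx k)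
      have h3 := length_alternatingProd_le (R := R) hy hx k
      rw [← h1] at h2
      omega
    by_cases hvy : R.length T v ≤ R.length T (v * R.reflection y)
    · right
      intro hc
      have e1 := ih (R.length T v) (by omega) hv hx hvx rfl
      have e2 := ih (R.length T v) (by omega) hv hy hvy rfl
      have hc' : 0 ≤ rootCoeff (-2 * R.form (R.root x) (R.root y)) k ∧
          0 ≤ rootCoeff (-2 * R.form (R.root x) (R.root y)) (k + 1) := by
        apply hc
        rcases hxy with ⟨rfl, rfl⟩ | ⟨rfl, rfl⟩
        · rfl
        · rw [R.symm]
      have := alternatingProd_apply (R := R) x y k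
      rw [hoff] at this
      rw [hwv, LinearEquiv.mul_apply, this, map_add, map_smul, map_smul]
      exact add_mem (smul_mem_cone hc'.2 e1) (smul_mem_cone hc'.1 e2)
    · left
      have h1 : w = v * R.reflection y *
          alternatingProd (R.reflection y) (R.reflection x) (k + 1) := by
        rw [alternatingProd, ← mul_assoc, R.mul_reflection_cancel, hwv]
      have h2 := length_mul_le (mul_reflection_mem hv hy) (alternatingProd_mem (R := R) hy hx (k + 1))
      have h3 := length_alternatingProd_le (R := R) hy hx (k + 1)
      rw [← h1] at h2
      exact ⟨v * R.reflection y, mul_reflection_mem hv hy, y, x, by tauto, hoff, h1, by omega⟩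
  -- A longest alternating suffix cannot be prolonged, so neither letter shortens the remaining
  -- factor v. By induction v maps both simple roots into the cone, and w(e_i) is a combination of
  -- these two images with coefficients r_k and r_{k+1}. For an infinite dihedral group k is bounded
  -- by ℓ(w), and for a finite one by m.
  rcases R.dihedral i j hij with hpos | ⟨m, hpos, hbraid⟩
  · classical
    have hk := Nat.findGreatest_spec (P := p) (show 1 ≤ R.length T w by omega) hp1
    have hk1 := Nat.le_findGreatest (P := p) (show 1 ≤ R.length T w by omega) hp1
    rcases hstep _ hk hk1 with h | h
    · have := Nat.le_findGreatest (hple _ h) h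
      omega
    · exact h fun c hc => hc ▸ ⟨hpos _, hpos _⟩
  -- At length m + 1, the order of the dihedral relation, the word can be flipped so that it ends in
  -- i. Then i cancels in w s_i, which becomes shorter than w, contrary to hypothesis.
  · have hnot : ¬ p (m + 1) := by
      rintro ⟨v, hv, x, y, hxy, hoff, hwv, hl⟩
      have hx : x ∈ T := by rcases hxy with ⟨rfl, rfl⟩ | ⟨rfl, rfl⟩ <;> assumption
      have hy : y ∈ T := by rcases hxy with ⟨rfl, rfl⟩ | ⟨rfl, rfl⟩ <;> assumption
      have hb : alternatingProd (R.reflection x) (R.reflection y) (m + 1) =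
          alternatingProd (R.reflection y) (R.reflection x) (m + 1) := by
        rcases hxy with ⟨rfl, rfl⟩ | ⟨rfl, rfl⟩
        exacts [hbraid, hbraid.symm]
      have h1 : w * R.reflection i = v * alternatingProd (R.reflection y) (R.reflection x) m := by
        rw [hwv, hb, alternatingProd_succ, hoff, ← mul_assoc, R.mul_reflection_cancel]
      have h2 := length_mul_le hv (alternatingProd_mem (R := R) hy hx m)
      have h3 := length_alternatingProd_le (R := R) hy hx m
      rw [← h1] at h2
      omega
    classical
    have hm : 1 ≤ m := by
      by_contra! h
      obtain rfl : m = 0 := by omega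
      exact hnot hp1
    have hk := Nat.findGreatest_spec (P := p) hm hp1
    have hk1 := Nat.le_findGreatest (P := p) hm hp1
    have hkm := Nat.findGreatest_le (P := p) m
    rcases hstep _ hk hk1 with h | h
    · rcases hkm.lt_or_eq with hlt | heq
      · have := Nat.le_findGreatest (P := p) (show Nat.findGreatest p m + 1 ≤ m by omega) h
        omega
      · rw [heq] at h
        exact absurd h hnot
    · exact h fun c hc => hc ▸ ⟨hpos _ (by omega), hpos _ (by omega)⟩

end SimpleRoots
end CoxeterGrowth

/-! ### Signs of roots, descents and lengths -/

namespace CoxeterGrowth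
namespace SimpleRoots

variable {ι V : Type*} [AddCommGroup V] [Module ℝ V] {R : SimpleRoots ι V}
variable {T U : Set ι} {w v u : V ≃ₗ[ℝ] V} {i j : ι}

theorem not_mem_cone_and_neg_mem_cone (h : w (R.root i) ∈ R.cone T)
    (h' : -w (R.root i) ∈ R.cone U) : False := by
  have h1 := height_pos_of_mem_cone h
  have h2 := height_pos_of_mem_cone h'
  simp only [map_root_ne_zero, neg_eq_zero, false_or, map_neg] at h1 h2
  linarith

/-- Equal lengths of w and w s_i are impossible: applied to both elements, `map_root_mem_cone` would
put w(e_i) and its negative into the cone, on whose nonzero vectors the height is positive. No sign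
character is required. -/
theorem mem_cone_or_neg_mem_cone (hw : w ∈ R.parabolic T) (hi : i ∈ T) :
    (w (R.root i) ∈ R.cone T ∧ R.length T (w * R.reflection i) = R.length T w + 1) ∨
      (-w (R.root i) ∈ R.cone T ∧ R.length T (w * R.reflection i) + 1 = R.length T w) := by
  have hneg : R.length T (w * R.reflection i) ≤ R.length T w → -w (R.root i) ∈ R.cone T := by
    intro h
    have := map_root_mem_cone (mul_reflection_mem hw hi) hi (by rwa [R.mul_reflection_cancel])
    rwa [LinearEquiv.mul_apply, R.reflection_root_self, map_neg] at this
  have h1 := length_mul_reflection_le hw hi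
  have h2 := length_le_mul_reflection hw hi
  rcases lt_trichotomy (R.length T w) (R.length T (w * R.reflection i)) with h | h | h
  · exact Or.inl ⟨map_root_mem_cone hw hi h.le, by omega⟩
  · exact (not_mem_cone_and_neg_mem_cone (map_root_mem_cone hw hi h.le) (hneg h.ge)).elim
  · exact Or.inr ⟨hneg h.le, by omega⟩

theorem height_pos_iff_mem_cone (hw : w ∈ R.parabolic T) (hi : i ∈ T) :
    0 < R.height (w (R.root i)) ↔ w (R.root i) ∈ R.cone T := by
  refine ⟨fun h => ?_, fun h => (height_pos_of_mem_cone h).resolve_left (map_root_ne_zero w i)⟩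
  refine ((mem_cone_or_neg_mem_cone hw hi).resolve_right fun h' => ?_).1
  have := (height_pos_of_mem_cone h'.1).resolve_left (by simpa using root_ne_zero i)
  rw [map_neg] at this
  linarith

theorem height_neg_iff_neg_mem_cone (hw : w ∈ R.parabolic T) (hi : i ∈ T) :
    R.height (w (R.root i)) < 0 ↔ -w (R.root i) ∈ R.cone T := by
  have := height_pos_iff_mem_cone (mul_reflection_mem hw hi) hi
  rwa [LinearEquiv.mul_apply, R.reflection_root_self, map_neg, map_neg, neg_pos] at this

theorem height_map_root_ne_zero (hw : w ∈ R.parabolic T) (hi : i ∈ T) :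
    R.height (w (R.root i)) ≠ 0 := by
  rcases mem_cone_or_neg_mem_cone hw hi with h | h
  · exact ((height_pos_iff_mem_cone hw hi).2 h.1).ne'
  · exact ((height_neg_iff_neg_mem_cone hw hi).2 h.1).ne

theorem length_mul_reflection_of_pos (hw : w ∈ R.parabolic T) (hi : i ∈ T)
    (h : 0 < R.height (w (R.root i))) : R.length T (w * R.reflection i) = R.length T w + 1 := by
  rcases mem_cone_or_neg_mem_cone hw hi with h' | h'
  · exact h'.2
  · exact absurd ((height_neg_iff_neg_mem_cone hw hi).2 h'.1) h.le.not_gt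

theorem length_mul_reflection_of_neg (hw : w ∈ R.parabolic T) (hi : i ∈ T)
    (h : R.height (w (R.root i)) < 0) : R.length T (w * R.reflection i) + 1 = R.length T w := by
  rcases mem_cone_or_neg_mem_cone hw hi with h' | h'
  · exact absurd ((height_pos_iff_mem_cone hw hi).2 h'.1) h.le.not_gt
  · exact h'.2

theorem exists_height_neg (hw : w ∈ R.parabolic T) (h : w ≠ 1) :
    ∃ i ∈ T, R.height (w (R.root i)) < 0 := by
  obtain ⟨i, hi, hlen⟩ := exists_descent hw fun h' => h (eq_one_of_length_eq_zero hw h')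
  refine ⟨i, hi, lt_of_not_ge fun h' => ?_⟩
  have := length_mul_reflection_of_pos hw hi (h'.lt_of_ne' (height_map_root_ne_zero hw hi))
  omega

theorem height_reflection_pos_of_neg (h : R.height (w (R.root i)) < 0) :
    0 < R.height ((w * R.reflection i) (R.root i)) := by
  rw [LinearEquiv.mul_apply, R.reflection_root_self, map_neg, map_neg]
  linarith

/-- Every element of a parabolic subgroup is reached from `1` through length-increasing right
multiplications by simple reflections. -/
theorem parabolic_induction {p : (V ≃ₗ[ℝ] V) → Prop} (one : p 1)
    (mul : ∀ w ∈ R.parabolic T, ∀ i ∈ T, 0 < R.height (w (R.root i)) → p w →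
      p (w * R.reflection i)) (hw : w ∈ R.parabolic T) : p w := by
  induction hn : R.length T w using Nat.strong_induction_on generalizing w with
  | _ n ih =>
  subst hn
  by_cases h1 : w = 1
  · rwa [h1]
  obtain ⟨i, hi, hneg⟩ := exists_height_neg hw h1
  have hlen := length_mul_reflection_of_neg hw hi hneg
  have := mul _ (mul_reflection_mem hw hi) i hi (height_reflection_pos_of_neg hneg)
    (ih _ (by omega) (mul_reflection_mem hw hi) rfl)
  rwa [R.mul_reflection_cancel] at this

/-- Whether a simple reflection lengthens w is read off from the sign of the same height in both
groups, so the two lengths increase together. -/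
theorem length_eq_of_subset (h : T ⊆ U) (hw : w ∈ R.parabolic T) :
    R.length U w = R.length T w := by
  refine parabolic_induction (p := fun w => R.length U w = R.length T w) ?_ ?_ hw
  · rw [length_one, length_one]
  · intro w hw i hi hpos hp
    rw [length_mul_reflection_of_pos hw hi hpos,
      length_mul_reflection_of_pos (parabolic_mono h hw) (h hi) hpos, hp]

/-! #### Minimal coset representatives and longest elements -/

/-- The hypothesis says that v maps the cone of U into the cone of T. Each step that lengthens u
therefore also lengthens v u. -/
theorem length_mul_of_forall_pos (hUT : U ⊆ T) (hv : v ∈ R.parabolic T)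
    (hpos : ∀ i ∈ U, 0 < R.height (v (R.root i))) (hu : u ∈ R.parabolic U) :
    R.length T (v * u) = R.length T v + R.length T u := by
  refine parabolic_induction (p := fun u => R.length T (v * u) = R.length T v + R.length T u)
    ?_ ?_ hu
  · simp [length_one]
  · intro u hu i hi hui ih
    have huT := parabolic_mono hUT hu
    have h1 : (v * u) (R.root i) ∈ R.cone T := by
      rw [LinearEquiv.mul_apply]
      exact map_mem_cone (fun j hj => (height_pos_iff_mem_cone hv (hUT hj)).1 (hpos j hj))
        ((height_pos_iff_mem_cone hu hi).1 hui)
    rw [← mul_assoc, length_mul_reflection_of_pos (mul_mem hv huT) (hUT hi)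
      ((height_pos_iff_mem_cone (mul_mem hv huT) (hUT hi)).2 h1),
      length_mul_reflection_of_pos huT (hUT hi) hui, ih, add_assoc]

/-- Stripping descents in U from the right shortens w, so the process stops, and it stops at a
minimal coset representative. -/
theorem exists_min_mul (hUT : U ⊆ T) (hw : w ∈ R.parabolic T) :
    ∃ v ∈ R.parabolic T, (∀ i ∈ U, 0 < R.height (v (R.root i))) ∧
      ∃ u ∈ R.parabolic U, w = v * u := by
  induction hn : R.length T w using Nat.strong_induction_on generalizing w with
  | _ n ih =>
  subst hn
  by_cases h : ∀ i ∈ U, 0 < R.height (w (R.root i))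
  · exact ⟨w, hw, h, 1, one_mem _, by simp⟩
  push Not at h
  obtain ⟨i, hi, hle⟩ := h
  have hneg := hle.lt_of_ne (height_map_root_ne_zero hw (hUT hi))
  have hlen := length_mul_reflection_of_neg hw (hUT hi) hneg
  obtain ⟨v, hv, hpos, u, hu, h⟩ := ih _ (by omega) (mul_reflection_mem hw (hUT hi)) rfl
  exact ⟨v, hv, hpos, u * R.reflection i, mul_reflection_mem hu hi, by
    rw [← mul_assoc, ← h, R.mul_reflection_cancel]⟩

/-- With z = u' u⁻¹, additivity gives both ℓ(v) = ℓ(v') + ℓ(z) and ℓ(v') = ℓ(v) + ℓ(z⁻¹), which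
leaves no room for z ≠ 1. -/
theorem min_mul_injective (hUT : U ⊆ T) {v' u' : V ≃ₗ[ℝ] V} (hv : v ∈ R.parabolic T)
    (hpos : ∀ i ∈ U, 0 < R.height (v (R.root i))) (hu : u ∈ R.parabolic U)
    (hv' : v' ∈ R.parabolic T) (hpos' : ∀ i ∈ U, 0 < R.height (v' (R.root i)))
    (hu' : u' ∈ R.parabolic U) (h : v * u = v' * u') : v = v' ∧ u = u' := by
  have hz : u' * u⁻¹ ∈ R.parabolic U := mul_mem hu' (inv_mem hu)
  have e1 : v = v' * (u' * u⁻¹) := by rw [← mul_assoc, ← h]; simp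
  have e2 : v' = v * (u' * u⁻¹)⁻¹ := by rw [e1]; group
  have h1 := length_mul_of_forall_pos hUT hv' hpos' hz
  have h2 := length_mul_of_forall_pos hUT hv hpos (inv_mem hz)
  rw [← e1] at h1
  rw [← e2] at h2
  have h3 := eq_one_of_length_eq_zero (parabolic_mono hUT hz) (by omega)
  have : u = u' := by rw [mul_inv_eq_one] at h3; exact h3.symm
  subst this
  exact ⟨mul_right_cancel h, rfl⟩

/-- Here u maps the cone of U into its negative, so each step lengthening z shortens u z. Such a u
is the longest element, and the same identity makes it unique. -/
theorem length_mul_of_forall_neg (hu : u ∈ R.parabolic U)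
    (hneg : ∀ i ∈ U, R.height (u (R.root i)) < 0) {z : V ≃ₗ[ℝ] V} (hz : z ∈ R.parabolic U) :
    R.length U (u * z) + R.length U z = R.length U u := by
  refine parabolic_induction (p := fun z => R.length U (u * z) + R.length U z = R.length U u)
    ?_ ?_ hz
  · simp [length_one]
  · intro z hz i hi hzi ih
    have h1 : -(u * z) (R.root i) ∈ R.cone U := by
      rw [LinearEquiv.mul_apply]
      exact neg_map_mem_cone (fun j hj => (height_neg_iff_neg_mem_cone hu hj).1 (hneg j hj))
        ((height_pos_iff_mem_cone hz hi).1 hzi)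
    have h2 := length_mul_reflection_of_neg (mul_mem hu hz) hi
      ((height_neg_iff_neg_mem_cone (mul_mem hu hz) hi).2 h1)
    rw [← mul_assoc, length_mul_reflection_of_pos hz hi hzi]
    omega

theorem eq_of_forall_neg (hu : u ∈ R.parabolic U)
    (hneg : ∀ i ∈ U, R.height (u (R.root i)) < 0) {u' : V ≃ₗ[ℝ] V} (hu' : u' ∈ R.parabolic U)
    (hneg' : ∀ i ∈ U, R.height (u' (R.root i)) < 0) : u' = u := by
  have hz : u⁻¹ * u' ∈ R.parabolic U := mul_mem (inv_mem hu) hu'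
  have h1 := length_mul_of_forall_neg hu hneg hz
  have h2 := length_mul_of_forall_neg hu' hneg' (inv_mem hz)
  rw [mul_inv_cancel_left] at h1
  rw [mul_inv_rev, inv_inv, mul_inv_cancel_left] at h2
  have h3 := eq_one_of_length_eq_zero hz (by omega)
  rw [inv_mul_eq_one] at h3
  exact h3.symm

/-- If a positive combination `x` of simple roots in `U` satisfies `form x (root i) ≤ 0` for all
`i ∈ U`, then no element has all of `U` as descents. -/
theorem not_forall_neg_of_form_nonpos (hUT : U ⊆ T) {x : V} (hx : x ∈ R.cone U) (hx0 : x ≠ 0)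
    (hform : ∀ i ∈ U, R.form x (R.root i) ≤ 0) (hw : w ∈ R.parabolic T) :
    ¬ ∀ i ∈ U, R.height (w (R.root i)) < 0 := by
  intro hneg
  obtain ⟨v, hv, hpos, u, hu, rfl⟩ := exists_min_mul hUT hw
  have huneg : ∀ i ∈ U, -u (R.root i) ∈ R.cone U := by
    intro i hi
    refine ((mem_cone_or_neg_mem_cone hu hi).resolve_left fun h => ?_).1
    have h1 := map_mem_cone (T := T) (R := R)
      (fun j hj => (height_pos_iff_mem_cone hv (hUT hj)).1 (hpos j hj)) h.1
    have h2 := height_pos_of_mem_cone h1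
    have h3 := hneg i hi
    rw [LinearEquiv.mul_apply] at h3
    rcases h2 with h2 | h2
    · rw [h2, map_zero] at h3; exact h3.false
    · linarith
  -- Passing from z to z s_i adds to z x the multiple -2 form(x, e_i) ≥ 0 of the positive vector
  -- z(e_i). So u moves x up, whereas `huneg` forces u x into the negative cone; adding the two
  -- memberships puts -x into the cone.
  have h1 : u x - x ∈ R.cone U := by
    refine parabolic_induction (p := fun z => z x - x ∈ R.cone U) (by simp) ?_ hu
    intro z hz i hi hzi ih
    have : (z * R.reflection i) x - x = (z x - x) +
        (-(2 * R.form x (R.root i))) • z (R.root i) := by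
      rw [LinearEquiv.mul_apply, R.reflection_apply, map_sub, map_smul]
      module
    rw [this]
    exact add_mem ih (smul_mem_cone (by linarith [hform i hi])
      ((height_pos_iff_mem_cone hz hi).1 hzi))
  have h3 := add_mem h1 (neg_map_mem_cone huneg hx)
  rw [sub_add_eq_add_sub, add_neg_cancel, zero_sub] at h3
  have h4 := (height_pos_of_mem_cone h3).resolve_left (by simpa using hx0)
  have h5 := (height_pos_of_mem_cone hx).resolve_left hx0
  rw [map_neg] at h4
  linarith

/-! #### Growth series of subsets -/

section Series

open PowerSeries

variable (R) in
/-- The generating series of the elements of `A` by their length. -/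
noncomputable def series (A : Set (V ≃ₗ[ℝ] V)) : PowerSeries ℤ :=
  .mk fun k => (Set.ncard {w | w ∈ A ∧ R.length Set.univ w = k} : ℤ)

theorem finite_length_eq [Finite ι] {A : Set (V ≃ₗ[ℝ] V)}
    (hA : A ⊆ R.parabolic Set.univ) (k : ℕ) :
    {w | w ∈ A ∧ R.length Set.univ w = k}.Finite :=
  (finite_wordLength_eq (R.inv_mem_gens Set.univ) ((Set.toFinite _).image _) k).subset
    fun _ hw => ⟨hA hw.1, hw.2⟩

/-- The coefficients of the product count pairs by total length; a unique factorization with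
additive lengths is a bijection from these pairs onto C. -/
theorem series_mul [Finite ι] {A B C : Set (V ≃ₗ[ℝ] V)} (hA : A ⊆ R.parabolic Set.univ)
    (hB : B ⊆ R.parabolic Set.univ) (hC : C ⊆ R.parabolic Set.univ)
    (hmul : ∀ a ∈ A, ∀ b ∈ B, a * b ∈ C ∧
      R.length Set.univ (a * b) = R.length Set.univ a + R.length Set.univ b)
    (hinj : ∀ a ∈ A, ∀ b ∈ B, ∀ a' ∈ A, ∀ b' ∈ B, a * b = a' * b' → a = a' ∧ b = b')
    (hsurj : ∀ c ∈ C, ∃ a ∈ A, ∃ b ∈ B, c = a * b) :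
    R.series A * R.series B = R.series C := by
  ext k
  rw [PowerSeries.coeff_mul]
  simp only [series, PowerSeries.coeff_mk]
  have e : ∀ {D : Set (V ≃ₗ[ℝ] V)} (hD : D ⊆ R.parabolic Set.univ) (k : ℕ),
      Set.ncard {w | w ∈ D ∧ R.length Set.univ w = k} =
        (finite_length_eq hD k).toFinset.card := fun hD k => Set.ncard_eq_toFinset_card _ _
  simp only [e hA, e hB, e hC]
  norm_cast
  simp only [← Finset.card_product]
  rw [← Finset.card_sigma]
  have hmem : ∀ x : (_ : ℕ × ℕ) × (V ≃ₗ[ℝ] V) × (V ≃ₗ[ℝ] V),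
      x ∈ ((Finset.HasAntidiagonal.antidiagonal k).sigma fun p =>
        (finite_length_eq hA p.1).toFinset ×ˢ (finite_length_eq hB p.2).toFinset) ↔
      x.1.1 + x.1.2 = k ∧ (x.2.1 ∈ A ∧ R.length Set.univ x.2.1 = x.1.1) ∧
        x.2.2 ∈ B ∧ R.length Set.univ x.2.2 = x.1.2 := by
    intro x
    simp [Finset.mem_sigma, Finset.HasAntidiagonal.mem_antidiagonal]
  refine Finset.card_nbij (fun x => x.2.1 * x.2.2) ?_ ?_ ?_
  · intro x hx
    obtain ⟨h, ⟨ha, ha'⟩, hb, hb'⟩ := (hmem x).1 hx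
    rw [Finset.mem_coe, Set.Finite.mem_toFinset]
    exact ⟨(hmul _ ha _ hb).1, by rw [(hmul _ ha _ hb).2, ha', hb', h]⟩
  · rintro ⟨⟨m, n⟩, a, b⟩ hx ⟨⟨m', n'⟩, a', b'⟩ hx' hab
    have h := (hmem _).1 hx
    have h' := (hmem _).1 hx'
    dsimp only at h h' hab
    obtain ⟨h, ⟨ha, rfl⟩, hb, rfl⟩ := h
    obtain ⟨h', ⟨ha', rfl⟩, hb', rfl⟩ := h'
    obtain ⟨rfl, rfl⟩ := hinj a ha b hb a' ha' b' hb' hab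
    rfl
  · intro c hc
    rw [Finset.mem_coe, Set.Finite.mem_toFinset] at hc
    obtain ⟨hc, rfl⟩ := hc
    obtain ⟨a, ha, b, hb, rfl⟩ := hsurj c hc
    exact ⟨⟨(R.length Set.univ a, R.length Set.univ b), a, b⟩,
      (hmem _).2 ⟨(hmul a ha b hb).2.symm, ⟨ha, rfl⟩, hb, rfl⟩, rfl⟩

theorem series_singleton (w : V ≃ₗ[ℝ] V) :
    R.series {w} = (X : PowerSeries ℤ) ^ R.length Set.univ w := by
  ext k
  rw [series, PowerSeries.coeff_mk, PowerSeries.coeff_X_pow]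
  split_ifs with h
  · rw [show {v | v ∈ ({w} : Set (V ≃ₗ[ℝ] V)) ∧ R.length Set.univ v = k} = {w} by
      ext v; simp only [Set.mem_singleton_iff, Set.mem_ofPred_eq]; constructor
      · exact fun h => h.1
      · rintro rfl; exact ⟨rfl, h.symm⟩]
    simp
  · rw [show {v | v ∈ ({w} : Set (V ≃ₗ[ℝ] V)) ∧ R.length Set.univ v = k} = ∅ by
      ext v; simp only [Set.mem_singleton_iff, Set.mem_ofPred_eq, Set.mem_empty_iff_false, iff_false]
      rintro ⟨rfl, h'⟩; exact h h'.symm]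
    simp

variable (R) in
/-- The elements of the parabolic subgroup of type `T` with all of `U` as descents. -/
def withDescents (T U : Set ι) : Set (V ≃ₗ[ℝ] V) :=
  {w | w ∈ R.parabolic T ∧ ∀ i ∈ U, R.height (w (R.root i)) < 0}

variable (R) in
/-- The elements of the parabolic subgroup of type `T` without descents in `U`: the minimal coset
representatives. -/
def minReps (T U : Set ι) : Set (V ≃ₗ[ℝ] V) :=
  {w | w ∈ R.parabolic T ∧ ∀ i ∈ U, 0 < R.height (w (R.root i))}

theorem parabolic_le_univ : R.parabolic T ≤ R.parabolic Set.univ :=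
  parabolic_mono (Set.subset_univ T)

theorem length_univ (hw : w ∈ R.parabolic T) : R.length Set.univ w = R.length T w :=
  length_eq_of_subset (Set.subset_univ T) hw

theorem series_minReps_mul [Finite ι] (hUT : U ⊆ T) :
    R.series (R.minReps T U) * R.series (R.parabolic U) = R.series (R.parabolic T) := by
  refine series_mul (fun w hw => parabolic_le_univ hw.1) parabolic_le_univ parabolic_le_univ
    ?_ ?_ ?_
  · intro v hv u hu
    have huT := parabolic_mono hUT hu
    refine ⟨mul_mem hv.1 huT, ?_⟩
    rw [length_univ hv.1, length_univ huT, length_univ (mul_mem hv.1 huT),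
      length_mul_of_forall_pos hUT hv.1 hv.2 hu]
  · intro v hv u hu v' hv' u' hu' h
    exact min_mul_injective hUT hv.1 hv.2 hu hv'.1 hv'.2 hu' h
  · intro w hw
    obtain ⟨v, hv, hpos, u, hu, h⟩ := exists_min_mul hUT hw
    exact ⟨v, ⟨hv, hpos⟩, u, hu, h⟩

/-- Write such an element as v u' with v minimal. All of U being descents forces u' to send every
simple root of U to a negative one, so u' is the longest element u, and only v varies. -/
theorem series_withDescents [Finite ι] (hUT : U ⊆ T) (hu : u ∈ R.parabolic U)
    (hneg : ∀ i ∈ U, R.height (u (R.root i)) < 0) :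
    R.series (R.minReps T U) * X ^ R.length Set.univ u = R.series (R.withDescents T U) := by
  rw [← series_singleton]
  refine series_mul (fun w hw => parabolic_le_univ hw.1) ?_
    (fun w hw => parabolic_le_univ hw.1) ?_ ?_ ?_
  · rintro _ rfl; exact parabolic_le_univ hu
  · rintro v hv _ rfl
    have huT := parabolic_mono hUT hu
    refine ⟨⟨mul_mem hv.1 huT, fun i hi => ?_⟩, ?_⟩
    · rw [height_neg_iff_neg_mem_cone (mul_mem hv.1 huT) (hUT hi), LinearEquiv.mul_apply,
        ← map_neg]
      exact map_mem_cone (fun j hj => (height_pos_iff_mem_cone hv.1 (hUT hj)).1 (hv.2 j hj))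
        ((height_neg_iff_neg_mem_cone hu hi).1 (hneg i hi))
    · rw [length_univ hv.1, length_univ huT, length_univ (mul_mem hv.1 huT),
        length_mul_of_forall_pos hUT hv.1 hv.2 hu]
  · rintro v hv _ rfl v' hv' _ rfl h
    exact ⟨mul_right_cancel h, rfl⟩
  · intro w hw
    obtain ⟨v, hv, hpos, u', hu', rfl⟩ := exists_min_mul hUT hw.1
    refine ⟨v, ⟨hv, hpos⟩, u', ?_, rfl⟩
    refine eq_of_forall_neg hu hneg hu' fun i hi => ?_
    rw [height_neg_iff_neg_mem_cone hu' hi]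
    refine ((mem_cone_or_neg_mem_cone hu' hi).resolve_left fun h => ?_).1
    have h1 := map_mem_cone (T := T) (R := R)
      (fun j hj => (height_pos_iff_mem_cone hv (hUT hj)).1 (hpos j hj)) h.1
    have h2 := (height_neg_iff_neg_mem_cone hw.1 (hUT hi)).1 (hw.2 i hi)
    exact not_mem_cone_and_neg_mem_cone (w := v * u') h1 h2

/-- After exchanging the sums, each w contributes the alternating sum over all subsets of its
descent set in T. This vanishes unless that set is empty, and only the identity has no descents. -/
theorem sum_neg_one_pow_series_withDescents [Finite ι] (T : Finset ι) :
    ∑ U ∈ T.powerset, (-1 : PowerSeries ℤ) ^ U.card * R.series (R.withDescents T U) = 1 := by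
  classical
  ext k
  have hk := finite_length_eq (R := R) (A := R.parabolic T) parabolic_le_univ k
  -- The innermost branch concerns only sets U not contained in T. It never occurs in the sum and is
  -- there so that the identity holds for every U.
  have e : ∀ U : Finset ι, PowerSeries.coeff k
      ((-1 : PowerSeries ℤ) ^ U.card * R.series (R.withDescents T U)) =
      ∑ w ∈ hk.toFinset, if U ⊆ T.filter fun i => R.height (w (R.root i)) < 0 then
        (-1 : ℤ) ^ U.card else if U ⊆ T then 0 else
          if ∀ i ∈ U, R.height (w (R.root i)) < 0 then (-1 : ℤ) ^ U.card else 0 := by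
    intro U
    have h1 : ((-1 : PowerSeries ℤ) ^ U.card) = PowerSeries.C ((-1 : ℤ) ^ U.card) := by simp
    rw [h1, PowerSeries.coeff_C_mul, series, PowerSeries.coeff_mk]
    have h2 : {w | w ∈ R.withDescents T U ∧ R.length Set.univ w = k} =
        ↑(hk.toFinset.filter fun w => ∀ i ∈ U, R.height (w (R.root i)) < 0) := by
      ext w
      simp only [withDescents, Set.mem_ofPred_eq, Finset.coe_filter, Set.Finite.mem_toFinset,
        SetLike.mem_coe]
      tauto
    rw [h2, Set.ncard_coe_finset, Finset.card_filter]
    push_cast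
    rw [Finset.mul_sum]
    refine Finset.sum_congr rfl fun w _ => ?_
    have h3 : (U ⊆ T.filter fun i => R.height (w (R.root i)) < 0) ↔
        U ⊆ T ∧ ∀ i ∈ U, R.height (w (R.root i)) < 0 := by
      simp only [Finset.subset_iff, Finset.mem_filter]
      exact ⟨fun h => ⟨fun i hi => (h hi).1, fun i hi => (h hi).2⟩,
        fun h i hi => ⟨h.1 hi, h.2 i hi⟩⟩
    by_cases hUT : U ⊆ T <;> by_cases hn : ∀ i ∈ U, R.height (w (R.root i)) < 0 <;>
      simp [h3, hUT, hn]
  rw [map_sum, Finset.sum_congr rfl fun U _ => e U, Finset.sum_comm]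
  have e2 : ∀ w : V ≃ₗ[ℝ] V, (∑ U ∈ T.powerset,
      if U ⊆ T.filter fun i => R.height (w (R.root i)) < 0 then
        (-1 : ℤ) ^ U.card else if U ⊆ T then 0 else
          if ∀ i ∈ U, R.height (w (R.root i)) < 0 then (-1 : ℤ) ^ U.card else 0) =
      if (T.filter fun i => R.height (w (R.root i)) < 0) = ∅ then 1 else 0 := by
    intro w
    rw [← Finset.sum_powerset_neg_one_pow_card, ← Finset.sum_subset
      (Finset.powerset_mono.2 (Finset.filter_subset (fun i => R.height (w (R.root i)) < 0) T))]
    · refine Finset.sum_congr rfl fun U hU => ?_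
      rw [if_pos (Finset.mem_powerset.1 hU)]
    · intro U hU hU'
      rw [if_neg (by simpa using hU'), if_pos (by simpa using hU)]
  rw [Finset.sum_congr rfl fun w _ => e2 w, PowerSeries.coeff_one]
  have e3 : ∀ w ∈ hk.toFinset, (T.filter fun i => R.height (w (R.root i)) < 0) = ∅ ↔ w = 1 := by
    intro w hw
    simp only [Set.Finite.mem_toFinset, Set.mem_ofPred_eq] at hw
    constructor
    · intro h
      by_contra h1
      obtain ⟨i, hi, hneg⟩ := exists_height_neg hw.1 h1
      have : i ∈ T.filter fun i => R.height (w (R.root i)) < 0 :=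
        Finset.mem_filter.2 ⟨hi, hneg⟩
      simp [h] at this
    · rintro rfl
      rw [Finset.filter_eq_empty_iff]
      intro i _
      simpa using (R.height_pos i).le
  rw [Finset.sum_congr rfl fun w hw => by rw [if_congr (e3 w hw) rfl rfl],
    Finset.sum_ite_eq' hk.toFinset 1]
  refine if_congr ?_ rfl rfl
  simp only [Set.Finite.mem_toFinset, Set.mem_ofPred_eq, length_one, SetLike.mem_coe, one_mem,
    true_and]
  exact eq_comm

theorem constantCoeff_series_parabolic :
    PowerSeries.constantCoeff (R.series (R.parabolic T)) = 1 := by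
  rw [← PowerSeries.coeff_zero_eq_constantCoeff_apply, series, PowerSeries.coeff_mk]
  rw [show {w | w ∈ (R.parabolic T : Set (V ≃ₗ[ℝ] V)) ∧ R.length Set.univ w = 0} = {1} by
    ext w
    simp only [SetLike.mem_coe, Set.mem_ofPred_eq, Set.mem_singleton_iff]
    refine ⟨fun h => eq_one_of_length_eq_zero (parabolic_le_univ h.1) h.2, ?_⟩
    rintro rfl
    exact ⟨one_mem _, length_one⟩]
  simp

theorem series_parabolic_ne_zero : R.series (R.parabolic T) ≠ 0 := fun h => by
  have := constantCoeff_series_parabolic (R := R) (T := T)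
  simp [h] at this

/-- Determination of the growth series from the lengths `N U` of the longest elements of the finite
parabolic subgroups, by Steinberg's formula. The finite parabolic subgroups are those whose type
satisfies `fin`, and `C U` is a common numerator divided by the growth series of type `U`. -/
theorem series_univ_mul [Fintype ι] [DecidableEq ι] {fin : Finset ι → Prop} [DecidablePred fin]
    {N : Finset ι → ℕ} {C : Finset ι → PowerSeries ℤ} {D : PowerSeries ℤ}
    (hlong : ∀ U, fin U → ∃ u ∈ R.parabolic U, R.length U u = N U ∧
      ∀ i ∈ U, R.height (u (R.root i)) < 0)
    (hinf : ∀ U, ¬ fin U → ∀ w ∈ R.parabolic Set.univ, ¬ ∀ i ∈ U, R.height (w (R.root i)) < 0)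
    (hC : ∀ T, fin T → T.Nonempty → ∑ U ∈ T.powerset,
      (if fin U then (-1) ^ U.card * X ^ N U * C U else 0) = C T)
    (hD : ∑ U, (if fin U then (-1) ^ U.card * X ^ N U * C U else 0) = D) :
    R.series (R.parabolic Set.univ) * D = C ∅ := by
  -- Denominator-free form of the fact that the elements of W_T with all of U as descents have
  -- series t^N(U) W_T(t)/W_U(t).
  have key : ∀ T U : Finset ι, U ⊆ T → fin U → R.series (R.parabolic U) * C U = C ∅ →
      C ∅ * R.series (R.withDescents T U) = R.series (R.parabolic T) * (X ^ N U * C U) := by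
    intro T U hUT hU hCU
    obtain ⟨u, hu, hlen, hneg⟩ := hlong U hU
    have h1 := series_withDescents (T := (T : Set ι)) (Finset.coe_subset.2 hUT) hu hneg
    rw [length_univ hu, hlen] at h1
    rw [← h1, ← hCU, ← series_minReps_mul (R := R) (Finset.coe_subset.2 hUT)]
    ring
  have hempty : ∀ T U : Finset ι, ¬ fin U → R.series (R.withDescents T U) = 0 := by
    intro T U hU
    have : R.withDescents T U = ∅ := by
      ext w
      simp only [withDescents, Set.mem_ofPred_eq, Set.mem_empty_iff_false, iff_false]
      exact fun h => hinf U hU w (parabolic_le_univ h.1) h.2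
    rw [this]
    ext k
    simp [series]
  have hfin : ∀ T : Finset ι, fin T → R.series (R.parabolic T) * C T = C ∅ := by
    intro T
    induction T using Finset.strongInduction with
    | _ T ih =>
    intro hT
    rcases T.eq_empty_or_nonempty with rfl | hne
    · have : R.series (R.parabolic ((∅ : Finset ι) : Set ι)) = 1 := by
        have := sum_neg_one_pow_series_withDescents (R := R) ∅
        simp only [Finset.powerset_empty, Finset.sum_singleton, Finset.card_empty, pow_zero,
          one_mul] at this
        rw [← this]
        congr 1
        ext w
        simp [withDescents]
      rw [this, one_mul]
    obtain ⟨u, hu, hlen, hneg⟩ := hlong T hT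
    have hN : N T ≠ 0 := by
      intro h0
      rw [h0] at hlen
      obtain rfl := eq_one_of_length_eq_zero hu hlen
      obtain ⟨i, hi⟩ := hne
      exact (hneg i hi).not_gt (by simpa using R.height_pos i)
    have htop : R.series (R.withDescents T T) = X ^ N T := by
      have h1 := series_withDescents (T := (T : Set ι)) le_rfl hu hneg
      have h2 := series_minReps_mul (R := R) (le_refl (T : Set ι))
      have h3 : R.series (R.minReps T T) = 1 :=
        mul_right_cancel₀ (series_parabolic_ne_zero (R := R) (T := T)) (by rw [h2, one_mul])
      rw [← h1, h3, one_mul, length_univ hu, hlen]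
    have hsum := congrArg (C ∅ * ·) (sum_neg_one_pow_series_withDescents (R := R) T)
    simp only [Finset.mul_sum, mul_one] at hsum
    have hCT := congrArg (R.series (R.parabolic T) * ·) (hC T hT hne)
    simp only [Finset.mul_sum] at hCT
    rw [← Finset.sum_erase_add _ _ (Finset.mem_powerset_self T)] at hsum hCT
    have hrest : ∑ U ∈ T.powerset.erase T, C ∅ * ((-1) ^ U.card * R.series (R.withDescents T U)) =
        ∑ U ∈ T.powerset.erase T, R.series (R.parabolic T) *
          (if fin U then (-1) ^ U.card * X ^ N U * C U else 0) := by
      refine Finset.sum_congr rfl fun U hU => ?_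
      rw [Finset.mem_erase, Finset.mem_powerset] at hU
      split_ifs with hf
      · have := key T U hU.2 hf (ih U (hU.2.ssubset_of_ne hU.1) hf)
        linear_combination (-1) ^ U.card * this
      · rw [hempty T U hf]; ring
    rw [hrest, htop] at hsum
    rw [if_pos hT] at hCT
    -- By induction the terms for proper subsets agree in the true and in the checked formula, so
    -- only the terms of T itself remain. The second factor has constant coefficient 1 because N T ≠
    -- 0, hence it can be cancelled.
    have hz : (R.series (R.parabolic T) * C T - C ∅) * (1 - (-1) ^ T.card * X ^ N T) = 0 := by
      linear_combination hsum - hCT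
    rcases mul_eq_zero.1 hz with h | h
    · exact sub_eq_zero.1 h
    · have := congrArg PowerSeries.constantCoeff h
      simp [hN] at this
  have hsum := congrArg (C ∅ * ·) (sum_neg_one_pow_series_withDescents (R := R) Finset.univ)
  simp only [Finset.mul_sum, mul_one, Finset.powerset_univ] at hsum
  rw [← hsum, ← hD, Finset.mul_sum]
  refine Finset.sum_congr rfl fun U _ => ?_
  split_ifs with hf
  · have := key Finset.univ U (Finset.subset_univ _) hf (hfin U hf)
    rw [Finset.coe_univ] at this
    rw [Finset.coe_univ]
    linear_combination -(-1) ^ U.card * this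
  · rw [hempty _ U hf]; ring

end Series
end SimpleRoots
end CoxeterGrowth

namespace CoxeterGrowth

/-! ### Computation of longest elements -/

/-- Pairs `(a, b)` of integers represent the elements `a + b φ` of `ℤ[φ]`. -/
noncomputable def goldenVal (a : ℤ × ℤ) : ℝ := a.1 + a.2 * Real.goldenRatio

/-- Sum of two coordinate vectors. -/
def addVec : List (ℤ × ℤ) → List (ℤ × ℤ) → List (ℤ × ℤ)
  | [], w => w
  | v, [] => v
  | a :: v, b :: w => (a.1 + b.1, a.2 + b.2) :: addVec v w

/-- Minus a coordinate vector. -/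
def negVec (v : List (ℤ × ℤ)) : List (ℤ × ℤ) := v.map fun a => (-a.1, -a.2)

/-- The multiple of a coordinate vector by `2 cos (π / m)` for `m = 2, 3, 5`. -/
def mulVec : ℕ → List (ℤ × ℤ) → List (ℤ × ℤ)
  | 3, v => v
  | 5, v => v.map fun a => (a.2, a.1 + a.2)
  | _, _ => []

/-- Sufficient criterion for all coordinates to be nonnegative. -/
def nonnegVec (v : List (ℤ × ℤ)) : Bool := v.all fun a => decide (0 ≤ a.1) && decide (0 ≤ a.2)

section Game

variable {ι : Type*} [DecidableEq ι] (m : ι → ι → ℕ)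

/-- The simple roots in `T` with their coordinates. -/
def initialRoots : List ι → List (ι × List (ℤ × ℤ))
  | [] => []
  | i :: T => (i, [(1, 0)]) :: (initialRoots T).map fun x => (x.1, (0, 0) :: x.2)

/-- Given the coordinates of the vectors `w e_i`, multiply `w` on the right by length-increasing
simple reflections until there are none; the result is the number of multiplications, added to
`n`. -/
def longestLength : ℕ → ℕ → List (ι × List (ℤ × ℤ)) → Option ℕ
  | 0, _, _ => none
  | fuel + 1, n, st =>
    match st.find? fun x => nonnegVec x.2 with
    | none => if st.all fun x => nonnegVec (negVec x.2) then some n else none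
    | some x => longestLength fuel (n + 1) (st.map fun y =>
        if y.1 = x.1 then (y.1, negVec y.2) else (y.1, addVec y.2 (mulVec (m y.1 x.1) x.2)))

/-- The length of the longest element of the parabolic subgroup with simple reflections `T`, provided
that it is at most `16`; `none` for infinite groups. -/
def parabolicRank (T : List ι) : Option ℕ :=
  -- Of the 17 units of fuel, one pays for the final test and 16 for multiplications; 16 is the
  -- length of the longest element of H₃ × A₁, the largest that occurs.
  if T.all fun i => T.all fun j => m i j != 0 then longestLength m 17 0 (initialRoots T) else none

/-- The sublists of a list. -/
def subs {α : Type*} : List α → List (List α)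
  | [] => [[]]
  | a :: l => subs l ++ (subs l).map (a :: ·)

/-- `T` contains a dotted edge or a linear graph `[3,5,3]` or `[5,3,5]`. -/
def hasInfinite (T : List ι) : Bool :=
  T.any fun a => T.any fun b => a != b && (m a b == 0 || T.any fun c => T.any fun d =>
    (m b c, m c d, m a c, m b d, m a d) ==
      (if m a b = 3 then 5 else 3, m a b, 2, 2, 2) && (m a b == 3 || m a b == 5))

end Game

/-- Sum of two polynomials given by their coefficient lists. -/
def addCoeffs : List ℤ → List ℤ → List ℤ
  | [], w => w
  | v, [] => v
  | a :: v, b :: w => (a + b) :: addCoeffs v w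

/-- The coefficients of the numerator divided by the growth polynomial of a finite parabolic subgroup
of rank `r` with longest element of length `n`. -/
def cofactor : ℕ → ℕ → List ℤ
  -- Rank and length separate the finite types that occur: A₁ (1,1), A₂ (2,3), A₁² (2,2), I₂(5)
  -- (2,5), H₃ (3,15), A₂ × A₁ (3,4), A₁³ (3,3), I₂(5) × A₁ (3,6), H₃ × A₁ (4,16), I₂(5) × A₂ (4,8),
  -- I₂(5) × A₁² (4,7). The numerator is the growth polynomial of H₃ × A₁, which all the others
  -- divide. The table need not be trusted, as `steinbergCheck` verifies the recursion that
  -- determines its entries.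
  | 0, 0 => [1, 4, 8, 12, 16, 20, 23, 24, 24, 24, 23, 20, 16, 12, 8, 4, 1]
  | 1, 1 => [1, 3, 5, 7, 9, 11, 12, 12, 12, 12, 11, 9, 7, 5, 3, 1]
  | 2, 3 => [1, 2, 2, 3, 4, 4, 4, 4, 4, 4, 3, 2, 2, 1]
  | 2, 2 => [1, 2, 3, 4, 5, 6, 6, 6, 6, 6, 5, 4, 3, 2, 1]
  | 2, 5 => [1, 2, 2, 2, 2, 3, 3, 2, 2, 2, 2, 1]
  | 3, 15 => [1, 1]
  | 3, 4 => [1, 1, 1, 2, 2, 2, 2, 2, 2, 2, 1, 1, 1]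
  | 3, 3 => [1, 1, 2, 2, 3, 3, 3, 3, 3, 3, 2, 2, 1, 1]
  | 3, 6 => [1, 1, 1, 1, 1, 2, 1, 1, 1, 1, 1]
  | 4, 16 => [1]
  | 4, 8 => [1, 0, 0, 1, 0, 1, 0, 0, 1]
  | 4, 7 => [1, 0, 1, 0, 1, 1, 0, 1, 0, 1]
  | _, _ => []

section Sum

variable {ι : Type*} [DecidableEq ι] (m : ι → ι → ℕ)

/-- The contribution of `T` to Steinberg's formula. -/
def steinbergTerm (T : List ι) : List ℤ :=
  match parabolicRank m T with
  | none => []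
  | some n => List.replicate n 0 ++ (cofactor T.length n).map ((-1) ^ T.length * ·)

/-- The sum over the sublists of `T` in Steinberg's formula. -/
def steinbergSum (T : List ι) : List ℤ :=
  (subs T).foldr (fun U acc => addCoeffs (steinbergTerm m U) acc) []

/-- Check of all conditions on the sublists of `L`. -/
def steinbergCheck (L : List ι) (D : List ℤ) : Bool :=
  ((subs L).all fun T =>
    match parabolicRank m T with
    | none => hasInfinite m T
    | some n => T.isEmpty ||
      (addCoeffs (steinbergSum m T) ((cofactor T.length n).map (- ·))).all (· == 0)) &&
  steinbergSum m L == D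
end Sum

def denominatorCoeffs : List ℤ := [1, -4, 1, 0, 1, 1, 0, 2, 0, 2, 0, 1, 1, 0, 1, -4, 1]

set_option maxRecDepth 100000 in
theorem steinbergCheck_reflectedGraph :
    steinbergCheck reflectedGraph (List.finRange 8) denominatorCoeffs = true := by
  decide +kernel

set_option maxRecDepth 100000 in
theorem steinbergCheck_twistedGraph :
    steinbergCheck twistedGraph (List.finRange 8) denominatorCoeffs = true := by
  decide +kernel

end CoxeterGrowth

/-! ### Soundness of the computation with sublists and coordinates over ℤ[φ] -/

namespace CoxeterGrowth

theorem goldenVal_add (a b : ℤ × ℤ) :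
    goldenVal (a.1 + b.1, a.2 + b.2) = goldenVal a + goldenVal b := by
  simp only [goldenVal]; push_cast; ring

theorem mem_subs {α : Type*} {l l' : List α} : l' ∈ subs l ↔ l'.Sublist l := by
  induction l generalizing l' with
  | nil => simp [subs]
  | cons a l ih =>
    simp only [subs, List.mem_append, List.mem_map, ih, List.sublist_cons_iff]
    constructor
    · rintro (h | ⟨r, h, rfl⟩)
      exacts [Or.inl h, Or.inr ⟨r, rfl, h⟩]
    · rintro (h | ⟨r, rfl, h⟩)
      exacts [Or.inl h, Or.inr ⟨r, h, rfl⟩]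

theorem sum_powerset_toFinset {α M : Type*} [DecidableEq α] [AddCommMonoid M] {l : List α}
    (hl : l.Nodup) (f : Finset α → M) :
    ∑ U ∈ l.toFinset.powerset, f U = ((subs l).map fun r => f r.toFinset).sum := by
  induction l generalizing f with
  | nil => simp [subs]
  | cons a l ih =>
    rw [List.nodup_cons] at hl
    rw [List.toFinset_cons, Finset.sum_powerset_insert (by simpa using hl.1), ih hl.2,
      ih hl.2 fun U => f (insert a U), subs, List.map_append, List.sum_append, List.map_map]
    simp [Function.comp_def]

/-! #### Coefficient lists -/

/-- The power series with given coefficients. -/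
noncomputable def ofCoeffs : List ℤ → PowerSeries ℤ
  | [] => 0
  | a :: l => PowerSeries.C a + PowerSeries.X * ofCoeffs l

theorem ofCoeffs_addCoeffs (l l' : List ℤ) :
    ofCoeffs (addCoeffs l l') = ofCoeffs l + ofCoeffs l' := by
  induction l generalizing l' with
  | nil => simp [addCoeffs, ofCoeffs]
  | cons a l ih =>
    cases l' with
    | nil => simp [addCoeffs, ofCoeffs]
    | cons b l' => simp only [addCoeffs, ofCoeffs, ih, map_add]; ring

theorem ofCoeffs_map_mul (c : ℤ) (l : List ℤ) :
    ofCoeffs (l.map (c * ·)) = PowerSeries.C c * ofCoeffs l := by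
  induction l with
  | nil => simp [ofCoeffs]
  | cons a l ih => simp only [List.map_cons, ofCoeffs, ih, map_mul]; ring

theorem ofCoeffs_replicate (n : ℕ) (l : List ℤ) :
    ofCoeffs (List.replicate n 0 ++ l) = PowerSeries.X ^ n * ofCoeffs l := by
  induction n with
  | zero => simp
  | succ n ih => simp only [List.replicate_succ, List.cons_append, ofCoeffs, ih, map_zero]; ring

theorem ofCoeffs_eq_zero {l : List ℤ} (h : l.all (· == 0) = true) : ofCoeffs l = 0 := by
  induction l with
  | nil => rfl
  | cons a l ih =>
    simp only [List.all_cons, Bool.and_eq_true, beq_iff_eq] at h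
    simp [ofCoeffs, h.1, ih h.2]

theorem ofCoeffs_steinbergSum {ι : Type*} [DecidableEq ι] (m : ι → ι → ℕ) (T : List ι) :
    ofCoeffs (steinbergSum m T) = ((subs T).map fun U => ofCoeffs (steinbergTerm m U)).sum := by
  rw [steinbergSum]
  induction subs T with
  | nil => rfl
  | cons U l ih => simp [ofCoeffs_addCoeffs, ih]

namespace SimpleRoots

variable {ι V : Type*} [AddCommGroup V] [Module ℝ V] (R : SimpleRoots ι V)

/-- The bilinear form is given by the Coxeter graph `m`, all of whose labels are `2`, `3`, `5`, or
`0` for dotted edges. -/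
def HasGraph (m : ι → ι → ℕ) : Prop :=
  ∀ i j, i ≠ j →
    m i j = 0 ∧ R.form (R.root i) (R.root j) ≤ -1 ∨
    m i j = 2 ∧ R.form (R.root i) (R.root j) = 0 ∨
    m i j = 3 ∧ R.form (R.root i) (R.root j) = -1 / 2 ∨
    m i j = 5 ∧ R.form (R.root i) (R.root j) = -Real.goldenRatio / 2

/-- The vector with given coordinates with respect to the simple roots in `T`. -/
noncomputable def ofVec : List ι → List (ℤ × ℤ) → V
  | i :: T, a :: v => goldenVal a • R.root i + ofVec T v
  | _, _ => 0

variable {R}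

theorem ofVec_nil (T : List ι) : R.ofVec T [] = 0 := by cases T <;> rfl

theorem ofVec_addVec (T : List ι) (v w : List (ℤ × ℤ)) :
    R.ofVec T (addVec v w) = R.ofVec T v + R.ofVec T w := by
  induction T generalizing v w with
  | nil => simp [ofVec]
  | cons i T ih =>
    cases v with
    | nil => simp [addVec, ofVec]
    | cons a v =>
      cases w with
      | nil => simp [addVec, ofVec]
      | cons b w => simp only [addVec, ofVec, ih, goldenVal_add]; module

theorem ofVec_map (T : List ι) (v : List (ℤ × ℤ)) {f : ℤ × ℤ → ℤ × ℤ} {c : ℝ}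
    (hf : ∀ a, goldenVal (f a) = c * goldenVal a) : R.ofVec T (v.map f) = c • R.ofVec T v := by
  induction T generalizing v with
  | nil => simp [ofVec]
  | cons i T ih =>
    cases v with
    | nil => simp [ofVec]
    | cons a v => simp only [List.map_cons, ofVec, ih, hf]; module

theorem ofVec_negVec (T : List ι) (v : List (ℤ × ℤ)) : R.ofVec T (negVec v) = -R.ofVec T v := by
  rw [negVec, ofVec_map (c := -1) T v fun a => by simp only [goldenVal]; push_cast; ring]
  simp

theorem ofVec_mulVec {m : ι → ι → ℕ} (hR : R.HasGraph m) {i j : ι} (hij : i ≠ j)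
    (h0 : m i j ≠ 0) (T : List ι) (v : List (ℤ × ℤ)) :
    R.ofVec T (mulVec (m i j) v) = (-2 * R.form (R.root i) (R.root j)) • R.ofVec T v := by
  rcases hR i j hij with h | h | h | h
  · exact absurd h.1 h0
  · simp [h.1, h.2, mulVec, ofVec_nil]
  · rw [h.1, h.2, mulVec]; module
  · rw [h.1, h.2, mulVec, ofVec_map (c := Real.goldenRatio)]
    · congr 1; ring
    · intro a
      simp only [goldenVal]
      push_cast
      linear_combination (-(a.2 : ℝ)) * Real.goldenRatio_sq

theorem ofVec_mem_cone {T : List ι} {v : List (ℤ × ℤ)} (hv : nonnegVec v = true) {U : Set ι}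
    (hT : ∀ i ∈ T, i ∈ U) : R.ofVec T v ∈ R.cone U := by
  induction T generalizing v with
  | nil => simp [ofVec]
  | cons i T ih =>
    cases v with
    | nil => simp [ofVec]
    | cons a v =>
      simp only [nonnegVec, List.all_cons, Bool.and_eq_true, decide_eq_true_eq] at hv
      have ha : 0 ≤ goldenVal a := by
        have h1 : (0 : ℝ) ≤ a.1 := by exact_mod_cast hv.1.1
        have h2 : (0 : ℝ) ≤ a.2 := by exact_mod_cast hv.1.2
        have := Real.goldenRatio_pos
        rw [goldenVal]
        positivity
      exact add_mem (smul_mem_cone ha (root_mem_cone (hT i (by simp))))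
        (ih hv.2 fun j hj => hT j (by simp [hj]))

theorem initialRoots_spec (T : List ι) :
    (initialRoots T).map Prod.fst = T ∧ ∀ x ∈ initialRoots T, R.ofVec T x.2 = R.root x.1 := by
  induction T with
  | nil => simp [initialRoots]
  | cons i T ih =>
    constructor
    · simp only [initialRoots, List.map_cons, List.map_map, List.cons.injEq, true_and]
      exact ih.1
    · intro x hx
      simp only [initialRoots, List.mem_cons, List.mem_map] at hx
      rcases hx with rfl | ⟨y, hy, rfl⟩
      · simp [ofVec, goldenVal, ofVec_nil]
      · simp [ofVec, goldenVal, ih.2 y hy]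

variable [DecidableEq ι]

/-- The list stores coordinates of the vectors w(e_i). Coordinates are not unique, but nonnegative
ones certify membership in the cone: for a chosen vector this makes the next multiplication
length-increasing, and for the negatives of all vectors it makes the final element the longest one.
-/
theorem longestLength_spec {m : ι → ι → ℕ} (hR : R.HasGraph m) {T : List ι}
    (hT : ∀ i ∈ T, ∀ j ∈ T, m i j ≠ 0) {fuel n N : ℕ} {st : List (ι × List (ℤ × ℤ))}
    {w : V ≃ₗ[ℝ] V} (hw : w ∈ R.parabolic {i | i ∈ T}) (hlen : R.length {i | i ∈ T} w = n)
    (hst : st.map Prod.fst = T) (hval : ∀ x ∈ st, w (R.root x.1) = R.ofVec T x.2)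
    (h : longestLength m fuel n st = some N) :
    ∃ u ∈ R.parabolic {i | i ∈ T}, R.length {i | i ∈ T} u = N ∧
      ∀ i ∈ T, R.height (u (R.root i)) < 0 := by
  induction fuel generalizing n st w with
  | zero => simp [longestLength] at h
  | succ fuel ih =>
    have hmem : ∀ x ∈ st, x.1 ∈ T := fun x hx => hst ▸ List.mem_map_of_mem hx
    rw [longestLength] at h
    split at h
    · split_ifs at h with hneg
      simp only [Option.some.injEq] at h
      refine ⟨w, hw, hlen.trans h, fun i hi => ?_⟩
      rw [← hst, List.mem_map] at hi
      obtain ⟨x, hx, rfl⟩ := hi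
      rw [height_neg_iff_neg_mem_cone hw (hmem x hx), hval x hx, ← ofVec_negVec]
      exact ofVec_mem_cone (List.all_eq_true.1 hneg x hx) fun j hj => hj
    · rename_i x hfind
      have hx := List.mem_of_find?_eq_some hfind
      have hxpos := List.find?_some hfind
      have hpos : 0 < R.height (w (R.root x.1)) := by
        rw [height_pos_iff_mem_cone hw (hmem x hx), hval x hx]
        exact ofVec_mem_cone hxpos fun j hj => hj
      refine ih (mul_reflection_mem hw (hmem x hx))
        (by rw [length_mul_reflection_of_pos hw (hmem x hx) hpos, hlen]) ?_ ?_ h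
      · rw [List.map_map, ← hst]
        refine List.map_congr_left fun y _ => ?_
        simp only [Function.comp_apply]
        split_ifs <;> rfl
      · intro z hz
        rw [List.mem_map] at hz
        obtain ⟨y, hy, rfl⟩ := hz
        split_ifs with hyx
        · rw [LinearEquiv.mul_apply, hyx, R.reflection_root_self, map_neg, ofVec_negVec, ← hyx,
            hval y hy]
        · rw [LinearEquiv.mul_apply, R.reflection_apply, map_sub, map_smul, ofVec_addVec,
            ofVec_mulVec hR hyx (hT _ (hmem y hy) _ (hmem x hx)), hval x hx, hval y hy]
          module

theorem exists_longest {m : ι → ι → ℕ} (hR : R.HasGraph m) {T : List ι} {N : ℕ}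
    (h : parabolicRank m T = some N) :
    ∃ u ∈ R.parabolic {i | i ∈ T}, R.length {i | i ∈ T} u = N ∧
      ∀ i ∈ T, R.height (u (R.root i)) < 0 := by
  rw [parabolicRank] at h
  split_ifs at h with h0
  simp only [List.all_eq_true, bne_iff_ne] at h0
  exact longestLength_spec hR h0 (one_mem _) length_one (initialRoots_spec (R := R) T).1
    (fun x hx => ((initialRoots_spec T).2 x hx).symm) h

/-- Each of the infinite patterns carries a positive combination of its simple roots with
nonpositive product with each of them: the sum of the two roots for a dotted edge, and a symmetric
combination for the chains. -/
theorem not_forall_neg_of_hasInfinite {m : ι → ι → ℕ}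
    (hm1 : ∀ i, m i i = 1)     (hR : R.HasGraph m) {T : List ι}
    (h : hasInfinite m T = true) {w : V ≃ₗ[ℝ] V} (hw : w ∈ R.parabolic Set.univ) :
    ¬ ∀ i ∈ T, R.height (w (R.root i)) < 0 := by
  intro hneg
  have hφ : 1.6 < Real.goldenRatio := by
    nlinarith [Real.goldenRatio_sq, Real.one_lt_goldenRatio]
  have f0 : ∀ {i j}, i ≠ j → m i j = 0 → R.form (R.root i) (R.root j) ≤ -1 := by
    intro i j hij h
    rcases hR i j hij with h' | h' | h' | h' <;> first | exact h'.2 | omega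
  have f2 : ∀ {i j}, m i j = 2 → R.form (R.root i) (R.root j) = 0 := by
    intro i j h
    rcases hR i j (by rintro rfl; simp [hm1] at h) with h' | h' | h' | h' <;>
      first | exact h'.2 | omega
  have f3 : ∀ {i j}, m i j = 3 → R.form (R.root i) (R.root j) = -1 / 2 := by
    intro i j h
    rcases hR i j (by rintro rfl; simp [hm1] at h) with h' | h' | h' | h' <;>
      first | exact h'.2 | omega
  have f5 : ∀ {i j}, m i j = 5 → R.form (R.root i) (R.root j) = -Real.goldenRatio / 2 := by
    intro i j h
    rcases hR i j (by rintro rfl; simp [hm1] at h) with h' | h' | h' | h' <;>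
      first | exact h'.2 | omega
  simp only [hasInfinite, List.any_eq_true, Bool.and_eq_true, Bool.or_eq_true, bne_iff_ne,
    beq_iff_eq, Prod.mk.injEq] at h
  obtain ⟨a, ha, b, hb, hab, h | ⟨c, hc, d, hd, ⟨hbc, hcd, hac, hbd, had⟩, h⟩⟩ := h
  · have hx : R.root a + R.root b ∈ R.cone ({a, b} : Set ι) :=
      add_mem (root_mem_cone (by simp)) (root_mem_cone (by simp))
    have hx0 : R.root a + R.root b ≠ 0 := fun h0 => by
      have := congrArg R.height h0
      rw [map_add, map_zero] at this
      linarith [R.height_pos a, R.height_pos b]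
    refine not_forall_neg_of_form_nonpos (Set.subset_univ _) hx hx0 ?_ hw ?_
    · have := f0 hab h
      rintro i (rfl | rfl)
      · rw [map_add, LinearMap.add_apply, R.unit, R.symm (R.root b)]; linarith
      · rw [map_add, LinearMap.add_apply, R.unit]; linarith
    · rintro i (rfl | rfl)
      exacts [hneg _ ha, hneg _ hb]
  -- Both chains are symmetric, so with weights p, q, q, p the four inequalities reduce to two.
  · have key : ∀ p q : ℝ, 0 < p → 0 < q → p + q * R.form (R.root a) (R.root b) ≤ 0 →
        p * R.form (R.root a) (R.root b) + q + q * R.form (R.root b) (R.root c) ≤ 0 →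
        R.form (R.root c) (R.root d) = R.form (R.root a) (R.root b) → False := by
      intro p q hp hq h1 h2 hsym
      have hx : p • R.root a + q • R.root b + q • R.root c + p • R.root d ∈
          R.cone ({a, b, c, d} : Set ι) :=
        add_mem (add_mem (add_mem (smul_mem_cone hp.le (root_mem_cone (by simp)))
          (smul_mem_cone hq.le (root_mem_cone (by simp))))
          (smul_mem_cone hq.le (root_mem_cone (by simp))))
          (smul_mem_cone hp.le (root_mem_cone (by simp)))
      have hx0 : p • R.root a + q • R.root b + q • R.root c + p • R.root d ≠ 0 := fun h0 => by
        have := congrArg R.height h0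
        simp only [map_add, map_smul, map_zero, smul_eq_mul] at this
        have := mul_pos hp (R.height_pos a)
        have := mul_pos hq (R.height_pos b)
        have := mul_pos hq (R.height_pos c)
        have := mul_pos hp (R.height_pos d)
        linarith
      have e1 := f2 hac
      have e2 := f2 hbd
      have e3 := f2 had
      refine not_forall_neg_of_form_nonpos (Set.subset_univ _) hx hx0 ?_ hw ?_
      · rintro i (rfl | rfl | rfl | rfl) <;>
          simp only [map_add, map_smul, LinearMap.add_apply, LinearMap.smul_apply, smul_eq_mul,
            R.unit]
        · rw [R.symm (R.root b), R.symm (R.root c), R.symm (R.root d), e1, e3]; linarith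
        · rw [R.symm (R.root c), R.symm (R.root d), e2]; linarith
        · rw [R.symm (R.root d), e1, hsym]; linarith
        · rw [e2, e3, hsym]; linarith
      · rintro i (rfl | rfl | rfl | rfl)
        exacts [hneg _ ha, hneg _ hb, hneg _ hc, hneg _ hd]
    rcases h with h | h
    · rw [if_pos h] at hbc
      rw [h] at hcd
      have h1 := f3 h
      have h2 := f5 hbc
      have h3 := f3 hcd
      -- For [3,5,3] the inequalities read 2 ≤ 5/2 and 8/5 ≤ φ.
      refine key 2 5 (by norm_num) (by norm_num) ?_ ?_ (h3.trans h1.symm)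
      · rw [h1]; norm_num
      · rw [h1, h2]; linarith
    · rw [if_neg (by omega)] at hbc
      rw [h] at hcd
      have h1 := f5 h
      have h2 := f3 hbc
      have h3 := f5 hcd
      -- For [5,3,5] they read 7/5 ≤ φ and 10/7 ≤ φ.
      refine key 7 10 (by norm_num) (by norm_num) ?_ ?_ (h3.trans h1.symm)
      · rw [h1]; linarith
      · rw [h1, h2]; linarith

theorem series_mul_of_steinbergCheck [Fintype ι] {m : ι → ι → ℕ}
    (hm1 : ∀ i, m i i = 1) (hR : R.HasGraph m) {L : List ι} (hL : L.Nodup) (hL' : ∀ i, i ∈ L)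
    {D : List ℤ} (hcheck : steinbergCheck m L D = true) :
    R.series (R.parabolic Set.univ) * ofCoeffs D = ofCoeffs (cofactor 0 0) := by
  -- finite sets of simple roots correspond to sublists of `L`
  let toL : Finset ι → List ι := fun U => L.filter (· ∈ U)
  have hsub : ∀ U, (toL U).Sublist L := fun U => List.filter_sublist
  have hmem : ∀ {U i}, i ∈ toL U ↔ i ∈ U := fun {U i} => by simp [toL, hL']
  have htoFin : ∀ U, (toL U).toFinset = U := fun U => by ext i; simp [hmem]
  have hnodup : ∀ U, (toL U).Nodup := fun U => hL.filter _
  have hcard : ∀ U, (toL U).length = U.card := fun U => by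
    rw [← List.toFinset_card_of_nodup (hnodup U), htoFin]
  have htoL : ∀ l, l.Sublist L → toL l.toFinset = l := by
    intro l hl
    have h1 : l.Sublist (toL l.toFinset) := by
      have := hl.filter (· ∈ l.toFinset)
      rwa [List.filter_eq_self.2 (by simp)] at this
    refine (h1.eq_of_length ?_).symm
    rw [hcard, List.toFinset_card_of_nodup (hL.sublist hl)]
  simp only [steinbergCheck, Bool.and_eq_true, List.all_eq_true, mem_subs, beq_iff_eq] at hcheck
  obtain ⟨hall, hD⟩ := hcheck
  have hsum : ∀ T : Finset ι, ofCoeffs (steinbergSum m (toL T)) = ∑ U ∈ T.powerset,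
      (if (parabolicRank m (toL U)).isSome then (-1) ^ U.card *
        PowerSeries.X ^ ((parabolicRank m (toL U)).getD 0) *
          ofCoeffs (cofactor U.card ((parabolicRank m (toL U)).getD 0)) else 0) := by
    intro T
    rw [ofCoeffs_steinbergSum, ← htoFin T, sum_powerset_toFinset (hnodup T), htoFin]
    congr 1
    refine List.map_congr_left fun l hl => ?_
    have hl' := (mem_subs.1 hl).trans (hsub T)
    rw [htoL l hl', List.toFinset_card_of_nodup (hL.sublist hl'), steinbergTerm]
    cases parabolicRank m l with
    | none => rfl
    | some n =>
      simp only [Option.isSome_some, Option.getD_some, if_true, ofCoeffs_replicate,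
        ofCoeffs_map_mul, map_pow, map_neg, map_one]
      ring
  have hempty : toL ∅ = [] := by simp [toL]
  have := series_univ_mul (R := R) (fin := fun U => (parabolicRank m (toL U)).isSome)
    (N := fun U => (parabolicRank m (toL U)).getD 0)
    (C := fun U => ofCoeffs (cofactor U.card ((parabolicRank m (toL U)).getD 0)))
    (D := ofCoeffs D) ?_ ?_ ?_ ?_
  · rw [this, hempty]
    rfl
  · intro U hU
    obtain ⟨N, hN⟩ := Option.isSome_iff_exists.1 hU
    have h := exists_longest hR hN
    simp only [hmem] at h
    simp only [hN, Option.getD_some]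
    exact h
  · intro U hU w hw
    have h := hall (toL U) (hsub U)
    rw [Option.not_isSome_iff_eq_none] at hU
    rw [hU] at h
    have := not_forall_neg_of_hasInfinite hm1 hR h hw
    simpa only [hmem] using this
  · intro T hT hne
    rw [← hsum T]
    have h := hall (toL T) (hsub T)
    obtain ⟨N, hN⟩ := Option.isSome_iff_exists.1 hT
    rw [hN] at h
    simp only [hN, Option.getD_some]
    have hne' : (toL T).isEmpty = false := by
      rw [← Bool.not_eq_true, List.isEmpty_iff]
      intro h0
      rw [← htoFin T, h0] at hne
      simp at hne
    rw [hne', hcard] at h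
    simp only [Bool.false_or] at h
    have := ofCoeffs_eq_zero h
    rw [ofCoeffs_addCoeffs] at this
    have h2 := ofCoeffs_map_mul (-1) (cofactor T.card N)
    simp only [neg_mul, one_mul] at h2
    rw [h2, map_neg, map_one] at this
    linear_combination this
  · rw [← hD, ← Finset.powerset_univ, ← hsum Finset.univ]
    congr 2
    simp [toL]

end SimpleRoots
end CoxeterGrowth

namespace CoxeterGrowth

/-! ### Coxeter polytopes -/

/-- For c ≥ 2 the differences r_{k+1} - r_k do not decrease; this covers hyperplanes that do not
meet. -/
theorem rootCoeff_nonneg_of_two_le {c : ℝ} (hc : 2 ≤ c) (k : ℕ) :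
    0 ≤ rootCoeff c k ∧ rootCoeff c k ≤ rootCoeff c (k + 1) := by
  induction k with
  | zero => simp [rootCoeff]
  | succ k ih =>
    refine ⟨ih.1.trans ih.2, ?_⟩
    rw [show k + 1 + 1 = k + 2 from rfl, rootCoeff]
    nlinarith

namespace HyperbolicPolytope

variable {n : ℕ} {ι : Type*} [Fintype ι] (P : HyperbolicPolytope n ι)

theorem lorentz_comm (x y : Fin (n + 1) → ℝ) : lorentz n x y = lorentz n y x := by
  simp only [lorentz_apply, mul_comm]

theorem reflection_apply (i : ι) (x : Fin (n + 1) → ℝ) :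
    P.reflection i x = x - (2 * lorentz n x (P.normal i)) • P.normal i := by
  rw [reflection, Module.reflection_apply, LinearMap.smul_apply, lorentz_comm, smul_eq_mul]

theorem continuous_lorentz : Continuous fun p : (Fin (n + 1) → ℝ) × (Fin (n + 1) → ℝ) =>
    lorentz n p.1 p.2 := by
  simp only [lorentz_apply]
  fun_prop

/-- A polytope contains a point off all its bounding hyperplanes. -/
theorem exists_interior : ∃ x : Fin (n + 1) → ℝ, ∀ i, lorentz n x (P.normal i) < 0 := by
  obtain ⟨U, hU, ⟨x, hxU, hx⟩, hsub⟩ := P.fullDim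
  refine ⟨x, fun i => ?_⟩
  have hle := (hsub ⟨hxU, hx⟩).2 i (Set.mem_univ i)
  refine hle.lt_of_ne fun h0 => ?_
  -- move `x` towards the outer normal vector
  let y : ℝ → Fin (n + 1) → ℝ := fun t => (Real.sqrt (1 - t ^ 2))⁻¹ • (x + t • P.normal i)
  have hy0 : y 0 = x := by simp [y]
  have hycont : ContinuousAt y 0 := by
    have h1 : ContinuousAt (fun t : ℝ => (Real.sqrt (1 - t ^ 2))⁻¹) 0 :=
      ContinuousAt.inv₀ (by fun_prop) (by simp)
    exact h1.smul (by fun_prop)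
  have e1 : ∀ᶠ t in nhds (0 : ℝ), y t ∈ U :=
    hycont.eventually_mem (hU.mem_nhds (by rwa [hy0]))
  have e2 : ∀ᶠ t in nhds (0 : ℝ), 0 < y t (Fin.last n) := by
    have : ContinuousAt (fun t => y t (Fin.last n)) 0 :=
      (continuous_apply (Fin.last n)).continuousAt.comp hycont
    exact continuousAt_const.eventually_lt this (by rw [hy0]; exact hx.2)
  have e3 : ∀ᶠ t in nhds (0 : ℝ), t < 1 := eventually_lt_nhds one_pos
  obtain ⟨t, ⟨h1, h2, h3⟩, ht⟩ := (((e1.and (e2.and e3)).filter_mono nhdsWithin_le_nhds).and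
    (self_mem_nhdsWithin : Set.Ioi (0 : ℝ) ∈ nhdsWithin 0 (Set.Ioi 0))).exists
  have hpos : 0 < 1 - t ^ 2 := by nlinarith
  have hs := Real.sqrt_pos.2 hpos
  have hyH : y t ∈ hyperbolicSpace n := by
    refine ⟨?_, h2⟩
    simp only [y, map_smul, map_add, LinearMap.add_apply, LinearMap.smul_apply, smul_eq_mul,
      hx.1, P.unit, h0, lorentz_comm (P.normal i) x]
    field_simp
    rw [Real.sq_sqrt hpos.le]
    ring
  have := (hsub ⟨h1, hyH⟩).2 i (Set.mem_univ i)
  simp only [y, map_smul, map_add, LinearMap.add_apply, LinearMap.smul_apply, smul_eq_mul, P.unit,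
    h0] at this
  have : 0 < (Real.sqrt (1 - t ^ 2))⁻¹ * (0 + t * 1) := by positivity
  linarith

/-- The simple roots of a Coxeter polytope whose graph has only labels `3`, `5` and dotted edges. -/
noncomputable def simpleRoots (h : ∀ i j, i ≠ j →
    lorentz n (P.normal i) (P.normal j) ≤ -1 ∨ lorentz n (P.normal i) (P.normal j) = 0 ∨
    lorentz n (P.normal i) (P.normal j) = -1 / 2 ∨
    lorentz n (P.normal i) (P.normal j) = -Real.goldenRatio / 2) :
    SimpleRoots ι (Fin (n + 1) → ℝ) where
  form := lorentz n
  root := P.normal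
  height := -lorentz n P.exists_interior.choose
  symm := lorentz_comm
  unit := P.unit
  height_pos i := by simpa using P.exists_interior.choose_spec i
  reflection := P.reflection
  reflection_apply := P.reflection_apply
  dihedral i j hij := by
    have hφ := Real.goldenRatio_pos
    have hsq := Real.goldenRatio_sq
    rcases h i j hij with h | h | h | h
    · exact Or.inl fun k => (rootCoeff_nonneg_of_two_le (by linarith) k).1
    -- The witness is one less than the order of the product of the two reflections: 1, 2, 4 for the
    -- angles π/2, π/3, π/5.
    · refine Or.inr ⟨1, fun k hk => ?_, ?_⟩
      · rw [h]
        interval_cases k <;> simp [rootCoeff]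
      · ext1 x
        simp only [alternatingProd, LinearEquiv.mul_apply, LinearEquiv.coe_one, id,
          P.reflection_apply, map_sub, map_smul, LinearMap.sub_apply, LinearMap.smul_apply,
          lorentz_comm (P.normal j) (P.normal i), h, smul_eq_mul]
        module
    · refine Or.inr ⟨2, fun k hk => ?_, ?_⟩
      · rw [h]
        interval_cases k <;> norm_num [rootCoeff]
      · ext1 x
        simp only [alternatingProd, LinearEquiv.mul_apply, LinearEquiv.coe_one, id,
          P.reflection_apply, map_sub, map_smul, LinearMap.sub_apply, LinearMap.smul_apply,
          P.unit, lorentz_comm (P.normal j) (P.normal i), h, smul_eq_mul]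
        module
    · refine Or.inr ⟨4, fun k hk => ?_, ?_⟩
      · rw [h, show -2 * (-Real.goldenRatio / 2) = Real.goldenRatio by ring]
        have r2 : rootCoeff Real.goldenRatio 2 = Real.goldenRatio := by simp [rootCoeff]
        have r3 : rootCoeff Real.goldenRatio 3 = Real.goldenRatio := by
          rw [rootCoeff, r2, rootCoeff]; linarith
        have r4 : rootCoeff Real.goldenRatio 4 = 1 := by
          rw [rootCoeff, r2, r3]; linarith
        have r5 : rootCoeff Real.goldenRatio 5 = 0 := by
          rw [rootCoeff, r3, r4]; ring
        interval_cases k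
        · simp [rootCoeff]
        · simp [rootCoeff]
        · rw [r2]; exact hφ.le
        · rw [r3]; exact hφ.le
        · rw [r4]; exact zero_le_one
        · rw [r5]
      · ext1 x
        generalize hp : lorentz n x (P.normal i) = p
        generalize hq : lorentz n x (P.normal j) = q
        generalize hg : Real.goldenRatio = g at *
        -- Both reflections preserve the affine plane through x spanned by the two normals. In its
        -- coordinates the braid relation of length five becomes two polynomial identities modulo g²
        -- = g + 1.
        have e1 : ∀ a b : ℝ, P.reflection i (x + a • P.normal i + b • P.normal j) =
            x + (-2 * p - a + g * b) • P.normal i + b • P.normal j := by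
          intro a b
          simp only [P.reflection_apply, map_add, map_smul, LinearMap.add_apply,
            LinearMap.smul_apply, P.unit, lorentz_comm (P.normal j) (P.normal i), h, smul_eq_mul,
            hp]
          module
        have e2 : ∀ a b : ℝ, P.reflection j (x + a • P.normal i + b • P.normal j) =
            x + a • P.normal i + (-2 * q - b + g * a) • P.normal j := by
          intro a b
          simp only [P.reflection_apply, map_add, map_smul, LinearMap.add_apply,
            LinearMap.smul_apply, P.unit, h, smul_eq_mul, hq]
          module
        have e0 : x = x + (0 : ℝ) • P.normal i + (0 : ℝ) • P.normal j := by simp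
        simp only [alternatingProd, LinearEquiv.mul_apply, LinearEquiv.coe_one, id]
        rw [e0]
        simp only [e1, e2]
        congr 2
        · congr 1
          have h3 : g ^ 3 = 2 * g + 1 := by linear_combination (g + 1) * hsq
          have h4 : g ^ 4 = 3 * g + 2 := by linear_combination (g ^ 2 + g + 2) * hsq
          ring_nf
          rw [h4, h3, hsq]
          ring
        · have h3 : g ^ 3 = 2 * g + 1 := by linear_combination (g + 1) * hsq
          have h4 : g ^ 4 = 3 * g + 2 := by linear_combination (g ^ 2 + g + 2) * hsq
          ring_nf
          rw [h4, h3, hsq]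
          ring

/-- This transfers lengths from the reflection group, regarded as a group of its own, to the ambient
linear group in which the root argument takes place. -/
theorem wordLength_generators (g : P.reflectionGroup) :
    wordLength P.generators g =
      wordLength (Set.range P.reflection) (g : (Fin (n + 1) → ℝ) ≃ₗ[ℝ] (Fin (n + 1) → ℝ)) := by
  rw [wordLength, wordLength]
  congr 1
  ext k
  constructor
  · rintro ⟨l, hl, rfl, rfl⟩
    refine ⟨l.map Subtype.val, ?_, by simp, by simp⟩
    intro s hs
    obtain ⟨t, ht, rfl⟩ := List.mem_map.1 hs
    obtain ⟨i, hi⟩ := hl t ht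
    exact ⟨i, hi.symm⟩
  · rintro ⟨l, hl, rfl, hg⟩
    have hl' : ∀ s ∈ l, s ∈ P.reflectionGroup := fun s hs => Subgroup.subset_closure (hl s hs)
    refine ⟨l.pmap Subtype.mk hl', ?_, by simp, ?_⟩
    · intro s hs
      obtain ⟨t, ht, rfl⟩ := List.mem_pmap.1 hs
      obtain ⟨i, hi⟩ := hl t ht
      exact ⟨i, hi.symm⟩
    · ext1
      rw [← hg]
      simp [List.map_pmap]

theorem growthSeries_generators {R : SimpleRoots ι (Fin (n + 1) → ℝ)}
    (hR : R.reflection = P.reflection) :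
    growthSeries P.generators = R.series (R.parabolic Set.univ) := by
  have h1 : R.gens Set.univ = Set.range P.reflection := by
    rw [SimpleRoots.gens, Set.image_univ, hR]
  ext k
  simp only [growthSeries, SimpleRoots.series, PowerSeries.coeff_mk, growthCoeff,
    SimpleRoots.length, SimpleRoots.parabolic, h1]
  congr 1
  rw [← Nat.card_coe_set_eq]
  refine Nat.card_congr ?_
  refine ⟨fun g => ⟨g.1.1, g.1.2, ?_⟩, fun g => ⟨⟨g.1, g.2.1⟩, ?_⟩, fun _ => rfl, fun _ => rfl⟩
  · rw [← wordLength_generators]; exact g.2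
  · rw [wordLength_generators]; exact g.2.2

theorem growthSeries_mul_of_steinbergCheck [DecidableEq ι] {M : CoxeterMatrix ι}
    (hP : P.HasCoxeterGraph M) {L : List ι} (hL : L.Nodup) (hL' : ∀ i, i ∈ L)
    (hM : (L.all fun i => L.all fun j => i == j || [0, 2, 3, 5].contains (M i j)) = true)
    {D : List ℤ}
    (hcheck : steinbergCheck M L D = true) :
    growthSeries P.generators * ofCoeffs D = ofCoeffs (cofactor 0 0) := by
  have hgraph : ∀ i j, i ≠ j →
      M i j = 0 ∧ lorentz n (P.normal i) (P.normal j) ≤ -1 ∨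
      M i j = 2 ∧ lorentz n (P.normal i) (P.normal j) = 0 ∨
      M i j = 3 ∧ lorentz n (P.normal i) (P.normal j) = -1 / 2 ∨
      M i j = 5 ∧ lorentz n (P.normal i) (P.normal j) = -Real.goldenRatio / 2 := by
    intro i j hij
    have h := hP i j hij
    simp only [List.all_eq_true, Bool.or_eq_true, beq_iff_eq, List.contains_iff_mem] at hM
    have h0 := (hM i (hL' i) j (hL' j)).resolve_left hij
    simp only [List.mem_cons, List.not_mem_nil, or_false] at h0
    rcases h0 with h0 | h0 | h0 | h0
    · exact Or.inl ⟨h0, h.2 h0⟩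
    · refine Or.inr (Or.inl ⟨h0, ?_⟩)
      have := h.1 (by omega)
      rw [h0] at this
      push_cast at this
      rw [Real.cos_pi_div_two] at this
      linarith
    · refine Or.inr (Or.inr (Or.inl ⟨h0, ?_⟩))
      have := h.1 (by omega)
      rw [h0] at this
      push_cast at this
      rw [Real.cos_pi_div_three] at this
      linarith
    · refine Or.inr (Or.inr (Or.inr ⟨h0, ?_⟩))
      have := h.1 (by omega)
      rw [h0] at this
      push_cast at this
      rw [Real.cos_pi_div_five] at this
      rw [Real.goldenRatio]
      linarith
  let R := P.simpleRoots fun i j hij => by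
    rcases hgraph i j hij with h | h | h | h <;> simp [h.2]
  rw [P.growthSeries_generators (R := R) rfl]
  exact SimpleRoots.series_mul_of_steinbergCheck (R := R) (m := M) (fun i => M.diagonal i) hgraph
    hL hL' hcheck

end HyperbolicPolytope

theorem ofCoeffs_cofactor : ofCoeffs (cofactor 0 0) = (growthNumerator : PowerSeries ℤ) := by
  simp only [cofactor, ofCoeffs, growthNumerator]
  push_cast
  simp only [map_ofNat, map_one]
  ring

theorem ofCoeffs_denominatorCoeffs :
    ofCoeffs denominatorCoeffs = (growthDenominator : PowerSeries ℤ) := by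
  simp only [denominatorCoeffs, ofCoeffs, growthDenominator]
  have h2 : ((2 : Polynomial ℤ) : PowerSeries ℤ) = 2 :=
    map_ofNat Polynomial.coeToPowerSeries.ringHom 2
  have h4 : ((4 : Polynomial ℤ) : PowerSeries ℤ) = 4 :=
    map_ofNat Polynomial.coeToPowerSeries.ringHom 4
  push_cast
  simp only [map_ofNat, map_one, map_neg, map_zero, h2, h4]
  ring

theorem growthSeries_mul_growthDenominator {M : CoxeterMatrix (Fin 8)}
    (hM : M = reflectedGraph ∨ M = twistedGraph) (P : HyperbolicPolytope 4 (Fin 8))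
    (hP : P.HasCoxeterGraph M) :
    growthSeries P.generators * (growthDenominator : PowerSeries ℤ) = growthNumerator := by
  rw [← ofCoeffs_cofactor, ← ofCoeffs_denominatorCoeffs]
  rcases hM with rfl | rfl
  · exact P.growthSeries_mul_of_steinbergCheck hP (List.nodup_finRange 8) List.mem_finRange
      (by decide +kernel) steinbergCheck_reflectedGraph
  · exact P.growthSeries_mul_of_steinbergCheck hP (List.nodup_finRange 8) List.mem_finRange
      (by decide +kernel) steinbergCheck_twistedGraph

end CoxeterGrowth

namespace CoxeterGrowth

open Polynomial

/-! ### Primality certificates -/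

/-- Lucas's test. The list is a full prime factorization of p - 1 with multiplicities, so every
prime divisor of p - 1 appears in it and a has order p - 1. -/
theorem Nat.Prime.of_primitiveRoot {p : ℕ} (a : ℕ) (l : List ℕ) (hl : ∀ q ∈ l, q.Prime)
    (hprod : l.prod + 1 = p) (ha : a ^ (p - 1) ≡ 1 [MOD p])
    (hq : ∀ q ∈ l, ¬ a ^ ((p - 1) / q) ≡ 1 [MOD p]) : p.Prime := by
  have cast : ∀ k, ((a : ZMod p)) ^ k = 1 ↔ a ^ k ≡ 1 [MOD p] := by
    intro k
    rw [← ZMod.natCast_eq_natCast_iff]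
    simp
  refine lucas_primality p a ((cast _).2 ha) fun q hqp hqd h => ?_
  have hdvd : q ∣ l.prod := by rwa [← hprod, Nat.add_sub_cancel] at hqd
  obtain ⟨r, hr, hqr⟩ := (Nat.Prime.prime hqp).dvd_prod_iff.1 hdvd
  rw [(Nat.prime_dvd_prime_iff_eq hqp (hl r hr)).1 hqr] at h
  exact hq r hr ((cast _).1 h)

/-- Modular exponentiation by repeated squaring: `powMod p k a n acc` is `acc * a ^ n % p` if
`n < 2 ^ k`. -/
def powMod (p : ℕ) : ℕ → ℕ → ℕ → ℕ → ℕ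
  | 0, _, _, acc => acc % p
  | k + 1, a, n, acc => powMod p k (a * a % p) (n / 2) (if n % 2 = 1 then acc * a % p else acc)

theorem powMod_modEq (p k a n acc : ℕ) (hn : n < 2 ^ k) :
    powMod p k a n acc ≡ acc * a ^ n [MOD p] := by
  induction k generalizing a n acc with
  | zero =>
    obtain rfl : n = 0 := by simpa using hn
    simpa [powMod] using Nat.mod_modEq acc p
  | succ k ih =>
    rw [powMod]
    refine (ih _ _ _ (by rw [pow_succ] at hn; omega)).trans ?_
    have h1 : (a * a % p) ^ (n / 2) ≡ (a * a) ^ (n / 2) [MOD p] := (Nat.mod_modEq _ _).pow _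
    have h2 := Nat.div_add_mod n 2
    split_ifs with h
    · have h3 : a ^ n = a * (a * a) ^ (n / 2) := by
        conv_lhs => rw [← h2, h, pow_succ, pow_mul, pow_two]
        ring
      rw [h3, ← mul_assoc]
      exact (Nat.mod_modEq _ _).mul h1
    · have h3 : a ^ n = (a * a) ^ (n / 2) := by
        conv_lhs => rw [← h2, show n % 2 = 0 by omega, add_zero, pow_mul, pow_two]
      rw [h3]
      exact h1.mul_left _

/-- Check of the conditions on powers in the primality test. -/
def lucasCheck (p a : ℕ) (l : List ℕ) : Bool :=
  l.prod + 1 == p && powMod p 128 a (p - 1) 1 == 1 &&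
    l.all fun q => powMod p 128 a ((p - 1) / q) 1 != 1

theorem prime_of_lucasCheck {p : ℕ} (a : ℕ) (l : List ℕ) (h1 : 1 < p) (hp : p < 2 ^ 128)
    (hl : ∀ q ∈ l, q.Prime) (h : lucasCheck p a l = true) : p.Prime := by
  simp only [lucasCheck, Bool.and_eq_true, beq_iff_eq, List.all_eq_true, bne_iff_ne] at h
  have hlt : ∀ k a n acc, powMod p k a n acc < p := by
    intro k
    induction k with
    | zero => intro a n acc; exact Nat.mod_lt _ (by omega)
    | succ k ih => intro a n acc; exact ih _ _ _
  refine Nat.Prime.of_primitiveRoot a l hl h.1.1 ?_ fun q hq hmod => h.2 q hq ?_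
  · have := powMod_modEq p 128 a (p - 1) 1 (by omega)
    rw [h.1.2, one_mul] at this
    exact this.symm
  · have := powMod_modEq p 128 a ((p - 1) / q) 1
      (lt_of_le_of_lt (Nat.div_le_self _ _) (by omega))
    rw [one_mul] at this
    have h3 := this.trans hmod
    rw [Nat.ModEq, Nat.mod_eq_of_lt (hlt _ _ _ _), Nat.mod_eq_of_lt h1] at h3
    exact h3

theorem prime_2008067839285267472384758820173242349 :
    Nat.Prime 2008067839285267472384758820173242349 := by
  have h1 : Nat.Prime 1306415329 :=
    prime_of_lucasCheck 11 [2, 2, 2, 2, 2, 3, 317, 42929] (by norm_num) (by norm_num)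
      (by simp only [List.forall_mem_cons]; norm_num) (by decide +kernel)
  have h2 : Nat.Prime 35419002967 :=
    prime_of_lucasCheck 5 [2, 3, 3, 619, 3178873] (by norm_num) (by norm_num)
      (by simp only [List.forall_mem_cons]; norm_num) (by decide +kernel)
  have h3 : Nat.Prime 2233268352972585609085753 :=
    prime_of_lucasCheck 5 [2, 2, 2, 3, 2011, 1306415329, 35419002967] (by norm_num) (by norm_num)
      (by
        simp only [List.forall_mem_cons]
        exact ⟨by norm_num, by norm_num, by norm_num, by norm_num, by norm_num, h1, h2, by simp⟩)
      (by decide +kernel)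
  exact prime_of_lucasCheck 10 [2, 2, 3, 7, 13, 31, 47, 53, 10663, 2233268352972585609085753]
    (by norm_num) (by norm_num)
    (by
      simp only [List.forall_mem_cons]
      exact ⟨by norm_num, by norm_num, by norm_num, by norm_num, by norm_num, by norm_num,
        by norm_num, by norm_num, by norm_num, h3, by simp⟩)
    (by decide +kernel)

/-! ### An irreducibility criterion -/

/-- A monic integer polynomial with a prime value at `N` whose complex roots have distance greater
than `1` from `N` is irreducible. -/
theorem irreducible_of_prime_eval {p : ℤ[X]} (hp : p.Monic) {N : ℤ} (hN : Prime (p.eval N))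
    (hroots : ∀ z : ℂ, (p.map (Int.castRingHom ℂ)).IsRoot z → 1 < ‖(N : ℂ) - z‖) :
    Irreducible p := by
  -- A factor f taking a unit value at N has leading coefficient ±1, so the product of |N - z| over
  -- its roots is 1. Every factor exceeds 1; hence there are no roots and f is a constant unit.
  have key : ∀ f g : ℤ[X], p = f * g → IsUnit (f.eval N) → IsUnit f := by
    intro f g hfg hu
    have hlc : f.leadingCoeff * g.leadingCoeff = 1 := by rw [← leadingCoeff_mul, ← hfg, hp]
    have hf0 : f.leadingCoeff ≠ 0 := left_ne_zero_of_mul_eq_one hlc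
    set F := f.map (Int.castRingHom ℂ) with hF
    have hinj : Function.Injective (Int.castRingHom ℂ) := Int.cast_injective
    have hsplit := (IsAlgClosed.splits F).eq_prod_roots
    have heval : F.eval (N : ℂ) = ((f.eval N : ℤ) : ℂ) := by
      exact eval_map_apply (f := Int.castRingHom ℂ) (p := f) N
    have hnorm : ‖F.eval (N : ℂ)‖ = 1 := by
      rw [heval, Complex.norm_intCast]
      rcases Int.isUnit_iff.1 hu with h | h <;> simp [h]
    have hlcn : ‖F.leadingCoeff‖ = 1 := by
      rw [hF, leadingCoeff_map_of_injective hinj]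
      rcases Int.isUnit_iff.1 (IsUnit.of_mul_eq_one _ hlc) with h | h <;> simp [h]
    have hroots0 : F.roots = 0 := by
      by_contra hne
      have hgt : ∀ s : Multiset ℂ, (∀ z ∈ s, 1 < ‖(N : ℂ) - z‖) →
          1 ≤ ‖(s.map fun z => (N : ℂ) - z).prod‖ ∧
            (s ≠ 0 → 1 < ‖(s.map fun z => (N : ℂ) - z).prod‖) := by
        intro s
        induction s using Multiset.induction with
        | empty => simp
        | cons a s ih =>
          intro h
          have h1 := (ih fun z hz => h z (Multiset.mem_cons_of_mem hz)).1
          have h2 := h a (Multiset.mem_cons_self a s)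
          rw [Multiset.map_cons, Multiset.prod_cons, norm_mul]
          exact ⟨by nlinarith, fun _ => by nlinarith⟩
      have hlt := (hgt F.roots fun z hz => hroots z ?_).2 hne
      · rw [hsplit, eval_mul, eval_C, eval_multiset_prod, norm_mul, hlcn, one_mul,
          Multiset.map_map] at hnorm
        simp only [Function.comp_def, eval_sub, eval_X, eval_C] at hnorm
        exact hlt.ne' hnorm
      · rw [hfg, Polynomial.map_mul, IsRoot, eval_mul, (mem_roots'.1 hz).2, zero_mul]
    have hdeg : f.natDegree = 0 := by
      rw [← natDegree_map_eq_of_injective hinj, ← hF, (IsAlgClosed.splits F).natDegree_eq_card_roots,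
        hroots0, Multiset.card_zero]
    rw [eq_C_of_natDegree_eq_zero hdeg, isUnit_C]
    rw [leadingCoeff, hdeg] at hlc
    exact IsUnit.of_mul_eq_one _ hlc
  refine ⟨fun h => hN.not_isUnit ?_, fun f g hfg => ?_⟩
  · exact h.map (evalRingHom N)
  · have h := hN.irreducible.isUnit_or_isUnit (show p.eval N = f.eval N * g.eval N by
      rw [hfg, eval_mul])
    rcases h with h | h
    · exact Or.inl (key f g hfg h)
    · exact Or.inr (key g f (by rw [hfg, mul_comm]) h)

/-! ### The roots of the denominator -/

theorem growthDenominator_natDegree : growthDenominator.natDegree = 16 := by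
  rw [growthDenominator]; compute_degree!

theorem growthDenominator_monic : growthDenominator.Monic := by
  rw [growthDenominator]; monicity!

theorem eval_growthDenominator_complex (z : ℂ) :
    (growthDenominator.map (Int.castRingHom ℂ)).eval z = z ^ 16 - 4 * z ^ 15 + z ^ 14 + z ^ 12 +
      z ^ 11 + 2 * z ^ 9 + 2 * z ^ 7 + z ^ 5 + z ^ 4 + z ^ 2 - 4 * z + 1 := by
  simp [growthDenominator]

theorem growthDenominator_map_ne_zero : growthDenominator.map (Int.castRingHom ℂ) ≠ 0 :=
  (growthDenominator_monic.map _).ne_zero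

/-- The denominator as a real function. -/
def denominatorFun (x : ℝ) : ℝ := x ^ 16 - 4 * x ^ 15 + x ^ 14 + x ^ 12 +
      x ^ 11 + 2 * x ^ 9 + 2 * x ^ 7 + x ^ 5 + x ^ 4 + x ^ 2 - 4 * x + 1

theorem isRoot_ofReal {x : ℝ} (hx : denominatorFun x = 0) :
    (growthDenominator.map (Int.castRingHom ℂ)).IsRoot (x : ℂ) := by
  rw [IsRoot, eval_growthDenominator_complex, ← Complex.ofReal_zero, ← hx, denominatorFun]
  push_cast
  ring

theorem isRoot_inv {z : ℂ} (h : (growthDenominator.map (Int.castRingHom ℂ)).IsRoot z) :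
    (growthDenominator.map (Int.castRingHom ℂ)).IsRoot z⁻¹ := by
  rw [IsRoot, eval_growthDenominator_complex] at h ⊢
  rcases eq_or_ne z 0 with rfl | hz
  · norm_num at h
  · field_simp
    linear_combination h

theorem isRoot_conj {z : ℂ} (h : (growthDenominator.map (Int.castRingHom ℂ)).IsRoot z) :
    (growthDenominator.map (Int.castRingHom ℂ)).IsRoot (starRingEnd ℂ z) := by
  rw [IsRoot, eval_growthDenominator_complex] at h ⊢
  have := congrArg (starRingEnd ℂ) h
  simpa only [map_add, map_sub, map_mul, map_pow, map_ofNat, map_one, map_zero] using this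

/-- The trace polynomial: `D(z) = z ^ 8 * q(z + z⁻¹)`. -/
def traceFun (x : ℝ) : ℝ :=
  x ^ 8 - 4 * x ^ 7 - 7 * x ^ 6 + 28 * x ^ 5 + 15 * x ^ 4 - 55 * x ^ 3 - 11 * x ^ 2 + 27 * x + 2

/-- The point of the unit circle in the upper half-plane with `z + z⁻¹ = x`, where `|x| < 2`. -/
noncomputable def circlePoint (x : ℝ) : ℂ := ⟨x / 2, Real.sqrt (1 - (x / 2) ^ 2)⟩

theorem circlePoint_spec {x : ℝ} (hx : x ∈ Set.Ioo (-2 : ℝ) 2) :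
    ‖circlePoint x‖ = 1 ∧ 0 < (circlePoint x).im ∧ circlePoint x ^ 2 = x * circlePoint x - 1 := by
  have hpos : 0 < 1 - (x / 2) ^ 2 := by nlinarith [hx.1, hx.2]
  have hsq := Real.sq_sqrt hpos.le
  refine ⟨?_, Real.sqrt_pos.2 hpos, ?_⟩
  · rw [Complex.norm_def, Complex.normSq_apply, circlePoint]
    rw [show x / 2 * (x / 2) + Real.sqrt (1 - (x / 2) ^ 2) * Real.sqrt (1 - (x / 2) ^ 2) = 1 by
      linarith]
    exact Real.sqrt_one
  · apply Complex.ext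
    · simp only [circlePoint, pow_two, Complex.mul_re, Complex.sub_re, Complex.ofReal_re,
        Complex.ofReal_im, Complex.one_re]
      have := Real.mul_self_sqrt (show 0 ≤ 1 - x / 2 * (x / 2) by linarith)
      linarith
    · simp only [circlePoint, pow_two, Complex.mul_im, Complex.sub_im, Complex.ofReal_re,
        Complex.ofReal_im, Complex.one_im]
      ring

theorem isRoot_circlePoint {x : ℝ} (hx : x ∈ Set.Ioo (-2 : ℝ) 2) (h : traceFun x = 0) :
    (growthDenominator.map (Int.castRingHom ℂ)).IsRoot (circlePoint x) := by
  obtain ⟨h1, -, h2⟩ := circlePoint_spec hx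
  set z := circlePoint x
  have hz : z ≠ 0 := fun h0 => by simp [h0] at h1
  have hxz : (x : ℂ) = z + z⁻¹ := by field_simp; linear_combination -h2
  have h3 : ((traceFun x : ℝ) : ℂ) = 0 := by rw [h, Complex.ofReal_zero]
  rw [traceFun] at h3
  push_cast at h3
  rw [hxz] at h3
  rw [IsRoot, eval_growthDenominator_complex]
  have h4 : z ^ 16 - 4 * z ^ 15 + z ^ 14 + z ^ 12 +
      z ^ 11 + 2 * z ^ 9 + 2 * z ^ 7 + z ^ 5 + z ^ 4 + z ^ 2 - 4 * z + 1 =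
      z ^ 8 * ((z + z⁻¹) ^ 8 - 4 * (z + z⁻¹) ^ 7 - 7 * (z + z⁻¹) ^ 6 + 28 * (z + z⁻¹) ^ 5 +
        15 * (z + z⁻¹) ^ 4 - 55 * (z + z⁻¹) ^ 3 - 11 * (z + z⁻¹) ^ 2 + 27 * (z + z⁻¹) + 2) := by
    field_simp
    ring
  rw [h4, h3, mul_zero]

theorem exists_root_of_neg {f : ℝ → ℝ} (hf : Continuous f) {a b : ℝ} (hab : a < b)
    (h : f a * f b < 0) : ∃ x ∈ Set.Ioo a b, f x = 0 := by
  rcases mul_neg_iff.1 h with ⟨ha, hb⟩ | ⟨ha, hb⟩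
  · exact intermediate_value_Ioo' hab.le hf.continuousOn ⟨hb, ha⟩
  · exact intermediate_value_Ioo hab.le hf.continuousOn ⟨ha, hb⟩

/-- Six disjoint intervals containing roots of the trace polynomial. -/
noncomputable def traceInterval : Fin 6 → ℝ × ℝ :=
  ![(-2, -1.75), (-1.5, -1.25), (-1, -0.75), (-0.25, 0), (0.75, 1), (1.5, 1.75)]

theorem exists_traceFun_roots : ∃ x : Fin 6 → ℝ, Function.Injective x ∧
    ∀ i, x i ∈ Set.Ioo (-2 : ℝ) 2 ∧ traceFun (x i) = 0 := by
  have hcont : Continuous traceFun := by unfold traceFun; fun_prop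
  have h1 : ∀ i, ∃ x ∈ Set.Ioo (traceInterval i).1 (traceInterval i).2, traceFun x = 0 := by
    intro i
    refine exists_root_of_neg hcont ?_ ?_ <;> fin_cases i <;>
      norm_num [traceInterval, traceFun]
  choose x hx hx0 using h1
  have hlt : StrictMono x := by
    refine Fin.strictMono_iff_lt_succ.2 fun i => ?_
    have h1 := (hx i.castSucc).2
    have h2 := (hx i.succ).1
    refine h1.trans (lt_of_le_of_lt ?_ h2)
    fin_cases i
    · change (-1.75 : ℝ) ≤ -1.5; norm_num
    · change (-1.25 : ℝ) ≤ -1; norm_num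
    · change (-0.75 : ℝ) ≤ -0.25; norm_num
    · change (0 : ℝ) ≤ 0.75; norm_num
    · change (1 : ℝ) ≤ 1.5; norm_num
  refine ⟨x, hlt.injective, fun i => ⟨?_, hx0 i⟩⟩
  have h1 := (hx i).1
  have h2 := (hx i).2
  constructor
  · refine lt_of_le_of_lt ?_ h1
    fin_cases i <;> norm_num [traceInterval]
  · refine lt_of_lt_of_le h2 ?_
    fin_cases i <;> norm_num [traceInterval]

/-- The description of the roots of the denominator. -/
theorem exists_roots_growthDenominator : ∃ α β : ℝ, 1 < β ∧ β < α ∧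
    |α - 3.70422| < 0.000005 ∧ |β - 1.24202| < 0.000005 ∧
    ∃ Z : Finset ℂ, Z.card = 6 ∧ (∀ z ∈ Z, ‖z‖ = 1 ∧ 0 < z.im) ∧
      (growthDenominator.map (Int.castRingHom ℂ)).roots =
        {(α : ℂ), (α : ℂ)⁻¹, (β : ℂ), (β : ℂ)⁻¹} + Z.val + Z.val.map (starRingEnd ℂ) := by
  have hcont : Continuous denominatorFun := by unfold denominatorFun; fun_prop
  obtain ⟨α, hα, hα0⟩ := exists_root_of_neg hcont (a := 3.704215) (b := 3.704225) (by norm_num)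
    (by norm_num [denominatorFun])
  obtain ⟨β, hβ, hβ0⟩ := exists_root_of_neg hcont (a := 1.242015) (b := 1.242025) (by norm_num)
    (by norm_num [denominatorFun])
  obtain ⟨x, hxinj, hx⟩ := exists_traceFun_roots
  have hβ1 : 1 < β := by have := hβ.1; norm_num at this; linarith
  have hβα : β < α := by
    have h1 := hβ.2; have h2 := hα.1; norm_num at h1 h2; linarith
  refine ⟨α, β, hβ1, hβα, ?_, ?_, ?_⟩
  · rw [abs_lt]; constructor <;> norm_num [Set.mem_Ioo] at hα ⊢ <;> linarith
  · rw [abs_lt]; constructor <;> norm_num [Set.mem_Ioo] at hβ ⊢ <;> linarith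
  have hinj : Function.Injective fun i => circlePoint (x i) := by
    intro i j hij
    have := congrArg Complex.re hij
    simp only [circlePoint] at this
    exact hxinj (by linarith)
  let Z : Finset ℂ := Finset.univ.map ⟨_, hinj⟩
  have hZ : ∀ z ∈ Z, ‖z‖ = 1 ∧ 0 < z.im ∧ (growthDenominator.map (Int.castRingHom ℂ)).IsRoot z := by
    intro z hz
    obtain ⟨i, -, rfl⟩ := Finset.mem_map.1 hz
    have := circlePoint_spec (hx i).1
    exact ⟨this.1, this.2.1, isRoot_circlePoint (hx i).1 (hx i).2⟩
  refine ⟨Z, by simp [Z], fun z hz => ⟨(hZ z hz).1, (hZ z hz).2.1⟩, ?_⟩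
  have hαpos : 0 < α := by linarith
  have hβpos : 0 < β := by linarith
  have h1 : α⁻¹ < β⁻¹ := inv_strictAnti₀ hβpos hβα
  have h2 : β⁻¹ < 1 := inv_lt_one_of_one_lt₀ hβ1
  symm
  -- Sixteen distinct roots have been found and the degree is 16, so there are no others and all are
  -- simple.
  refine Multiset.eq_of_le_of_card_le ((Multiset.le_iff_subset ?_).2 ?_) ?_
  · have hreal : ∀ z ∈ ({(α : ℂ), (α : ℂ)⁻¹, (β : ℂ), (β : ℂ)⁻¹} : Multiset ℂ), z.im = 0 := by
      intro z hz
      simp only [Multiset.insert_eq_cons, Multiset.mem_cons, Multiset.mem_singleton,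
        ← Complex.ofReal_inv] at hz
      rcases hz with rfl | rfl | rfl | rfl <;> exact Complex.ofReal_im _
    rw [Multiset.nodup_add, Multiset.nodup_add]
    refine ⟨⟨?_, Z.nodup, ?_⟩, Z.nodup.map (starRingEnd ℂ).injective, ?_⟩
    · simp only [← Complex.ofReal_inv, Multiset.insert_eq_cons, Multiset.nodup_cons,
        Multiset.mem_cons, Multiset.mem_singleton, Multiset.nodup_singleton, Complex.ofReal_inj,
        not_or, and_true]
      refine ⟨⟨?_, ?_, ?_⟩, ⟨?_, ?_⟩, ?_⟩ <;> intro h <;> linarith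
    · rw [Multiset.disjoint_left]
      intro z hz hz'
      exact (hZ z hz').2.1.ne' (hreal z hz)
    · rw [Multiset.disjoint_left]
      intro z hz hz'
      obtain ⟨w, hw, rfl⟩ := Multiset.mem_map.1 hz'
      have hw' := (hZ w hw).2.1
      rcases Multiset.mem_add.1 hz with h | h
      · have := hreal _ h
        rw [Complex.conj_im] at this
        linarith
      · have := (hZ _ h).2.1
        rw [Complex.conj_im] at this
        linarith
  · intro z hz
    rw [mem_roots growthDenominator_map_ne_zero]
    simp only [Multiset.mem_add, Multiset.insert_eq_cons, Multiset.mem_cons,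
      Multiset.mem_singleton, Multiset.mem_map, Finset.mem_val] at hz
    rcases hz with ((rfl | rfl | rfl | rfl) | hz) | ⟨w, hw, rfl⟩
    · exact isRoot_ofReal hα0
    · exact isRoot_inv (isRoot_ofReal hα0)
    · exact isRoot_ofReal hβ0
    · exact isRoot_inv (isRoot_ofReal hβ0)
    · exact (hZ z hz).2.2
    · exact isRoot_conj (hZ w hw).2.2
  · refine (card_roots' _).trans ?_
    rw [natDegree_map_eq_of_injective Int.cast_injective, growthDenominator_natDegree]
    simp [Z]

end CoxeterGrowth

/-! ### Irreducibility, conjugates and the 2-Salem property -/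

namespace CoxeterGrowth

open Polynomial

theorem eval_growthDenominator_186 :
    growthDenominator.eval 186 = 2008067839285267472384758820173242349 := by
  simp [growthDenominator]

theorem irreducible_growthDenominator
    (hroots : ∀ z : ℂ, (growthDenominator.map (Int.castRingHom ℂ)).IsRoot z → ‖z‖ < 5) :
    Irreducible growthDenominator := by
  refine irreducible_of_prime_eval growthDenominator_monic (N := 186) ?_ fun z hz => ?_
  · rw [eval_growthDenominator_186]
    exact Nat.prime_iff_prime_int.1 prime_2008067839285267472384758820173242349
  · have h1 := norm_sub_norm_le ((186 : ℤ) : ℂ) z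
    have h2 := hroots z hz
    norm_num at h1 ⊢
    linarith

/-- By Gauss's lemma a monic polynomial irreducible over ℤ stays irreducible over ℚ. This identifies
the conjugates of a root with the roots of p. -/
theorem minpoly_rat_eq {p : ℤ[X]} (hp : p.Monic) (hirr : Irreducible p) {z : ℂ}
    (hz : (p.map (Int.castRingHom ℂ)).IsRoot z) : minpoly ℚ z = p.map (Int.castRingHom ℚ) := by
  symm
  refine minpoly.eq_of_irreducible_of_monic ?_ ?_ (hp.map _)
  · exact (hp.irreducible_iff_irreducible_map_fraction_map (K := ℚ)).1 hirr
  · rw [aeval_def, eval₂_map, ← eval_map]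
    rw [RingHom.ext_int ((algebraMap ℚ ℂ).comp (Int.castRingHom ℚ)) (Int.castRingHom ℂ)]
    exact hz

theorem isConjRoot_iff_isRoot {p : ℤ[X]} (hp : p.Monic) (hirr : Irreducible p) {z w : ℂ}
    (hz : (p.map (Int.castRingHom ℂ)).IsRoot z) :
    IsConjRoot ℚ z w ↔ (p.map (Int.castRingHom ℂ)).IsRoot w := by
  constructor
  · intro h
    have := h.aeval_eq_zero
    rw [minpoly_rat_eq hp hirr hz, aeval_def, eval₂_map, ← eval_map,
      RingHom.ext_int ((algebraMap ℚ ℂ).comp (Int.castRingHom ℚ)) (Int.castRingHom ℂ)] at this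
    exact this
  · intro h
    rw [IsConjRoot, minpoly_rat_eq hp hirr hz, minpoly_rat_eq hp hirr h]

theorem isIntegral_of_isRoot {p : ℤ[X]} (hp : p.Monic) {z : ℂ}
    (hz : (p.map (Int.castRingHom ℂ)).IsRoot z) : IsIntegral ℤ z := by
  refine ⟨p, hp, ?_⟩
  rw [← eval_map]
  exact hz

theorem minpoly_int_eq {p : ℤ[X]} (hp : p.Monic) (hirr : Irreducible p) {z : ℂ}
    (hz : (p.map (Int.castRingHom ℂ)).IsRoot z) : p = minpoly ℤ z := by
  have h := minpoly.isIntegrallyClosed_eq_field_fractions' ℚ (isIntegral_of_isRoot hp hz)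
  rw [minpoly_rat_eq hp hirr hz] at h
  exact map_injective _ Int.cast_injective h

/-- Criterion for a root of an irreducible polynomial to be a 2-Salem number. -/
theorem isTwoSalem_of_isRoot {p : ℤ[X]} (hp : p.Monic) (hirr : Irreducible p) {α β z : ℂ}
    (hα : (p.map (Int.castRingHom ℂ)).IsRoot α) (hβ : (p.map (Int.castRingHom ℂ)).IsRoot β)
    (hz : (p.map (Int.castRingHom ℂ)).IsRoot z) (hα1 : 1 < ‖α‖) (hβ1 : 1 < ‖β‖) (hne : β ≠ α)
    (hz1 : ‖z‖ = 1)
    (h : ∀ w : ℂ, (p.map (Int.castRingHom ℂ)).IsRoot w → w ≠ α → w ≠ β → ‖w‖ ≤ 1) :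
    IsTwoSalem α := by
  refine ⟨isIntegral_of_isRoot hp hα, hα1, β, (isConjRoot_iff_isRoot hp hirr hα).2 hβ, hne, hβ1,
    fun w hw => h w ((isConjRoot_iff_isRoot hp hirr hα).1 hw), z,
    (isConjRoot_iff_isRoot hp hirr hα).2 hz, ?_, ?_, hz1⟩
  · rintro rfl; exact hα1.ne' hz1
  · rintro rfl; exact hβ1.ne' hz1

/-! ### Growth rates -/

/-- If `u` grows at most like `r ^ k`, so does the convolution of `u` with a geometric series of
smaller ratio. -/
theorem exists_bound_of_geometric {u v : ℕ → ℂ} {ρ : ℂ} {r : ℝ} (hρ : ‖ρ‖ < r)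
    (hu : ∃ C, ∀ k, ‖u k‖ ≤ C * r ^ k) (h0 : v 0 = u 0)
    (hv : ∀ k, v (k + 1) = u (k + 1) + ρ * v k) : ∃ C, ∀ k, ‖v k‖ ≤ C * r ^ k := by
  obtain ⟨C, hC⟩ := hu
  have hr : 0 < r := (norm_nonneg ρ).trans_lt hρ
  have hC0 : 0 ≤ C := by simpa using (norm_nonneg _).trans (hC 0)
  have hd : 0 < r - ‖ρ‖ := by linarith
  -- The constant C' = C r/(r - |ρ|) is the solution of C r + |ρ| C' = C' r, which is what the
  -- induction step reproduces.
  have key : C * r + ‖ρ‖ * (C * r / (r - ‖ρ‖)) = C * r / (r - ‖ρ‖) * r := by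
    field_simp
    ring
  refine ⟨C * r / (r - ‖ρ‖), fun k => ?_⟩
  induction k with
  | zero =>
    rw [h0, pow_zero, mul_one]
    have := hC 0
    rw [pow_zero, mul_one] at this
    refine this.trans ?_
    rw [le_div_iff₀ hd]
    nlinarith [norm_nonneg ρ]
  | succ k ih =>
    rw [hv]
    calc ‖u (k + 1) + ρ * v k‖ ≤ ‖u (k + 1)‖ + ‖ρ‖ * ‖v k‖ := by
          rw [← norm_mul]; exact norm_add_le _ _
      _ ≤ C * r ^ (k + 1) + ‖ρ‖ * (C * r / (r - ‖ρ‖) * r ^ k) := by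
          gcongr
          exact hC (k + 1)
      _ = (C * r + ‖ρ‖ * (C * r / (r - ‖ρ‖))) * r ^ k := by ring
      _ = C * r / (r - ‖ρ‖) * r ^ (k + 1) := by rw [key]; ring

/-- Dividing by one factor 1 - ρX is convolution with a geometric series, so the bound is preserved
factor by factor. -/
theorem exists_bound_of_mul_prod {f g : PowerSeries ℂ} {s : Multiset ℂ} {r : ℝ}
    (hs : ∀ ρ ∈ s, ‖ρ‖ < r) (hg : ∃ C, ∀ k, ‖PowerSeries.coeff k g‖ ≤ C * r ^ k)
    (h : f * (s.map fun ρ => 1 - PowerSeries.C ρ * PowerSeries.X).prod = g) :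
    ∃ C, ∀ k, ‖PowerSeries.coeff k f‖ ≤ C * r ^ k := by
  induction s using Multiset.induction generalizing f with
  | empty =>
    rw [Multiset.map_zero, Multiset.prod_zero, mul_one] at h
    rwa [h]
  | cons ρ s ih =>
    rw [Multiset.map_cons, Multiset.prod_cons, ← mul_assoc] at h
    refine exists_bound_of_geometric (hs ρ (Multiset.mem_cons_self _ _))
      (ih (fun ρ' h' => hs ρ' (Multiset.mem_cons_of_mem h')) h) ?_ fun k => ?_
    · simp [mul_sub]
    · rw [mul_sub, mul_one, map_sub, mul_left_comm, PowerSeries.coeff_C_mul,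
        PowerSeries.coeff_succ_mul_X]
      ring

theorem exists_bound_coe_polynomial (p : ℂ[X]) {r : ℝ} (hr : 1 ≤ r) :
    ∃ C, ∀ k, ‖PowerSeries.coeff k (p : PowerSeries ℂ)‖ ≤ C * r ^ k := by
  refine ⟨∑ i ∈ p.support, ‖p.coeff i‖, fun k => ?_⟩
  rw [Polynomial.coeff_coe]
  have h0 : 0 ≤ ∑ i ∈ p.support, ‖p.coeff i‖ := Finset.sum_nonneg fun _ _ => norm_nonneg _
  refine le_trans ?_ (le_mul_of_one_le_right h0 (one_le_pow₀ hr))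
  by_cases hk : k ∈ p.support
  · exact Finset.single_le_sum (f := fun i => ‖p.coeff i‖) (fun _ _ => norm_nonneg _) hk
  · rw [notMem_support_iff.1 hk, norm_zero]
    exact h0

/-- If the coefficients of `f` grow slower than `r ^ k`, then `f * q = p` holds for the values at
`r⁻¹`. -/
theorem eval_eq_zero_of_summable {f : PowerSeries ℂ} {p q : ℂ[X]} {x : ℂ}
    (hf : Summable fun k => ‖PowerSeries.coeff k f * x ^ k‖) (h : f * (q : PowerSeries ℂ) = p)
    (hq : q.eval x = 0) : p.eval x = 0 := by
  have hpoly : ∀ p : ℂ[X], HasSum (fun k => PowerSeries.coeff k (p : PowerSeries ℂ) * x ^ k)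
      (p.eval x) := by
    intro p
    rw [eval_eq_sum, Polynomial.sum]
    simp only [Polynomial.coeff_coe]
    refine hasSum_sum_of_ne_finset_zero fun k hk => ?_
    rw [notMem_support_iff.1 hk, zero_mul]
  have hqs : Summable fun k => ‖PowerSeries.coeff k (q : PowerSeries ℂ) * x ^ k‖ := by
    refine summable_of_ne_finset_zero (s := q.support) fun k hk => ?_
    rw [Polynomial.coeff_coe, notMem_support_iff.1 hk, zero_mul, norm_zero]
  have hprod := tsum_mul_tsum_eq_tsum_sum_antidiagonal_of_summable_norm hf hqs
  rw [(hpoly q).tsum_eq, hq, mul_zero] at hprod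
  rw [← (hpoly p).tsum_eq, hprod]
  refine tsum_congr fun k => ?_
  rw [← h, PowerSeries.coeff_mul, Finset.sum_mul]
  refine Finset.sum_congr rfl fun x hx => ?_
  rw [← Finset.HasAntidiagonal.mem_antidiagonal.1 hx, pow_add]
  ring

/-- The exponential growth rate of the coefficients of a rational power series. -/
theorem limsup_coeff_eq {a : ℕ → ℝ} (ha : ∀ k, 0 ≤ a k) {p q : ℂ[X]} {α : ℝ} (hα : 1 < α)
    {s : Multiset ℂ} (hs : ∀ ρ ∈ s, ‖ρ‖ ≤ α)
    (hq : (q : PowerSeries ℂ) = (s.map fun ρ => 1 - PowerSeries.C ρ * PowerSeries.X).prod)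
    (h : (PowerSeries.mk fun k => (a k : ℂ)) * (q : PowerSeries ℂ) = p)
    (hq0 : q.eval ((α : ℂ)⁻¹) = 0) (hp0 : p.eval ((α : ℂ)⁻¹) ≠ 0) :
    Filter.limsup (fun k : ℕ => a k ^ (1 / (k : ℝ))) Filter.atTop = α := by
  have hα0 : 0 < α := by linarith
  -- upper bounds
  have hupper : ∀ r : ℝ, α < r → ∀ᶠ k : ℕ in Filter.atTop, a k ^ (1 / (k : ℝ)) ≤ r := by
    intro r hr
    -- The coefficients are bounded by C t^k; the gap between t and r absorbs the constant C for
    -- large k.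
    obtain ⟨t, hαt, htr⟩ := exists_between hr
    have ht0 : 0 < t := by linarith
    have hr0 : 0 < r := by linarith
    obtain ⟨C, hC⟩ := exists_bound_of_mul_prod (f := PowerSeries.mk fun k => (a k : ℂ))
      (fun ρ hρ => (hs ρ hρ).trans_lt hαt)
      (exists_bound_coe_polynomial p (by linarith)) (by rw [← hq, h])
    have hlim : Filter.Tendsto (fun k : ℕ => C * (t / r) ^ k) Filter.atTop (nhds (C * 0)) :=
      (tendsto_pow_atTop_nhds_zero_of_lt_one (by positivity)
        ((div_lt_one hr0).2 htr)).const_mul C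
    rw [mul_zero] at hlim
    filter_upwards [hlim.eventually_lt_const one_pos, Filter.eventually_gt_atTop 0] with k hk hk0
    have h1 : a k ≤ r ^ k := by
      have h2 := hC k
      rw [PowerSeries.coeff_mk, Complex.norm_real, Real.norm_of_nonneg (ha k)] at h2
      refine h2.trans ?_
      rw [div_pow, ← mul_div_assoc, div_lt_one (by positivity)] at hk
      exact hk.le
    calc a k ^ (1 / (k : ℝ)) ≤ (r ^ k) ^ (1 / (k : ℝ)) :=
          Real.rpow_le_rpow (ha k) h1 (by positivity)
      _ = r := by rw [one_div, Real.pow_rpow_inv_natCast (by linarith) hk0.ne']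
  have hbdd : Filter.IsBoundedUnder (· ≤ ·) Filter.atTop fun k : ℕ => a k ^ (1 / (k : ℝ)) :=
    ⟨α + 1, by simpa using hupper (α + 1) (by linarith)⟩
  have hcobdd : Filter.IsCoboundedUnder (· ≤ ·) Filter.atTop fun k : ℕ => a k ^ (1 / (k : ℝ)) :=
    Filter.isCoboundedUnder_le_of_le Filter.atTop (x := 0) fun k => Real.rpow_nonneg (ha k) _
  refine le_antisymm ?_ ?_
  · refine le_of_forall_gt_imp_ge_of_dense fun r hr => ?_
    exact Filter.limsup_le_of_le hcobdd (hupper r hr)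
  -- If the limsup were below α, the series would converge absolutely at 1/α. There the product with
  -- q vanishes, so the numerator would vanish too.
  · by_contra! hlt
    obtain ⟨t, htl, htα⟩ := exists_between hlt
    have hev := Filter.eventually_lt_of_limsup_lt htl hbdd
    refine hp0 (eval_eq_zero_of_summable (f := PowerSeries.mk fun k => (a k : ℂ)) ?_ h hq0)
    have ht0 : 0 ≤ t := by
      obtain ⟨k, hk⟩ := hev.exists
      exact (Real.rpow_nonneg (ha k) _).trans hk.le
    refine Summable.of_norm_bounded_eventually_nat (g := fun k => (t / α) ^ k)
      (summable_geometric_of_lt_one (by positivity) ((div_lt_one hα0).2 htα)) ?_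
    filter_upwards [hev, Filter.eventually_gt_atTop 0] with k hk hk0
    have h1 : a k ≤ t ^ k := by
      have h2 := pow_le_pow_left₀ (Real.rpow_nonneg (ha k) _) hk.le k
      rwa [one_div, Real.rpow_inv_natCast_pow (ha k) hk0.ne'] at h2
    rw [PowerSeries.coeff_mk, norm_norm, norm_mul, norm_pow, norm_inv, Complex.norm_real,
      Complex.norm_real, Real.norm_of_nonneg (ha k), Real.norm_of_nonneg hα0.le, div_pow, inv_pow,
      ← div_eq_mul_inv]
    gcongr

/-! ### The growth function of the example -/

theorem isRoot_growthDenominator_iff {α β : ℝ} {Z : Finset ℂ}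
    (hroots : (growthDenominator.map (Int.castRingHom ℂ)).roots =
      {(α : ℂ), (α : ℂ)⁻¹, (β : ℂ), (β : ℂ)⁻¹} + Z.val + Z.val.map (starRingEnd ℂ)) {w : ℂ} :
    (growthDenominator.map (Int.castRingHom ℂ)).IsRoot w ↔
      w = α ∨ w = (α : ℂ)⁻¹ ∨ w = β ∨ w = (β : ℂ)⁻¹ ∨ w ∈ Z ∨ ∃ z ∈ Z, starRingEnd ℂ z = w := by
  rw [← mem_roots growthDenominator_map_ne_zero, hroots]
  simp only [Multiset.mem_add, Multiset.insert_eq_cons, Multiset.mem_cons,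
    Multiset.mem_singleton, Multiset.mem_map, Finset.mem_val, or_assoc]

end CoxeterGrowth

namespace CoxeterGrowth

/-! ### Existence of the polytopes -/

/-- The ring `ℤ[φ]`, where `φ` is the golden ratio. -/
abbrev GoldenInt := QuadraticAlgebra ℤ 1 1

namespace GoldenInt

/-- A decidable form of positivity in `ℤ[φ] ⊆ ℝ`. -/
def isPos (x : GoldenInt) : Bool :=
  let u := 2 * x.re + x.im
  let v := x.im
  (decide (0 < u) && decide (0 ≤ v)) || (decide (0 ≤ u) && decide (0 < v)) ||
    (decide (0 < u) && decide (5 * v ^ 2 < u ^ 2)) || (decide (0 < v) && decide (u ^ 2 < 5 * v ^ 2))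

end GoldenInt

/-- The bilinear form with diagonal matrix `d`. -/
def diagForm {R : Type*} [CommRing R] (d x y : Fin 5 → R) : R :=
  d 0 * x 0 * y 0 + d 1 * x 1 * y 1 + d 2 * x 2 * y 2 + d 3 * x 3 * y 3 + d 4 * x 4 * y 4

/-- Positive semidefiniteness of a symmetric matrix by symmetric elimination with positive
pivots. -/
def pivotCheck : (n : ℕ) → (Fin n → Fin n → GoldenInt) → Bool
  | 0, _ => true
  | n + 1, M => (M 0 0).isPos &&
      (List.finRange n).all (fun i => decide (M i.succ 0 = M 0 i.succ)) &&
      pivotCheck n fun i j => M 0 0 * M i.succ j.succ - M 0 i.succ * M 0 j.succ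

/-- The condition on the Gram matrix of two normal vectors imposed by an edge with label `m`. -/
def edgeCheck (m : ℕ) (q N N' : GoldenInt) : Bool :=
  match m with
  | 0 => (-q).isPos && (decide (q ^ 2 = N * N') || (q ^ 2 - N * N').isPos)
  | 2 => decide (q = 0)
  | 3 => (-q).isPos && decide (4 * q ^ 2 = N * N')
  | 5 => (-q).isPos && decide (4 * q ^ 2 = ⟨0, 1⟩ ^ 2 * (N * N'))
  | _ => false

/-- The diagonal of a Lorentzian form over `ℤ[φ]`. -/
def goldenDiag : Fin 5 → GoldenInt := ![⟨1, 0⟩, ⟨3, 0⟩, ⟨1, 0⟩, ⟨4, -1⟩, ⟨15, -12⟩]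

/-- Normal vectors of a polytope with respect to the form `goldenDiag`, with certificates: points
outside exactly one of the half-spaces, a point in the interior, and weights that bound the two
halves of the polytope cut off by a coordinate hyperplane. -/
structure PolytopeCertificate where
  normal : Fin 8 → Fin 5 → GoldenInt
  outside : Fin 8 → Fin 5 → ℤ
  inside : Fin 5 → ℤ
  facet : Bool → Fin 6 → Fin 8
  weight : Bool → Fin 7 → Fin 7 → ℕ

/-- Sum of a list over `Fin n`. -/
def finSum (n : ℕ) (f : Fin n → GoldenInt) : GoldenInt := ((List.finRange n).map f).sum

namespace PolytopeCertificate

variable (c : PolytopeCertificate)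

/-- The Gram matrix. -/
def gram (i j : Fin 8) : GoldenInt := diagForm goldenDiag (c.normal i) (c.normal j)

/-- The vectors whose half-spaces bound one half of the polytope. -/
def halfNormal (b : Bool) : Fin 7 → Fin 5 → GoldenInt :=
  Fin.cons ![0, 0, 0, bif b then -1 else 1, 0] fun i => c.normal (c.facet b i)

/-- The matrix whose positive semidefiniteness bounds one half of the polytope. -/
def boundMatrix (b : Bool) (k l : Fin 5) : GoldenInt :=
  (if k = l then -10000000 * goldenDiag k - 50000 else 0) -
    finSum 7 fun i => finSum 7 fun j => (c.weight b i j : GoldenInt) *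
      (goldenDiag k * c.halfNormal b i k * (goldenDiag l * c.halfNormal b j l))

/-- The point `z` lies in the interior of the light cone. -/
def timeLike (z : Fin 5 → ℤ) : Bool :=
  (-diagForm goldenDiag (fun k => (z k : GoldenInt)) (fun k => (z k : GoldenInt))).isPos &&
    decide (0 < z 4)

/-- The point `z` lies in the interior of the half-space. -/
def isInside (z : Fin 5 → ℤ) (i : Fin 8) : Bool :=
  (-diagForm goldenDiag (fun k => (z k : GoldenInt)) (c.normal i)).isPos

/-- The point `z` lies in the exterior of the half-space. -/
def isOutside (z : Fin 5 → ℤ) (i : Fin 8) : Bool :=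
  (diagForm goldenDiag (fun k => (z k : GoldenInt)) (c.normal i)).isPos

/-- The certificate describes a polytope with Coxeter matrix `M`. -/
def check (M : CoxeterMatrix (Fin 8)) : Bool :=
  (List.finRange 8).all (fun i => (c.gram i i).isPos && timeLike (c.outside i) &&
    c.isOutside (c.outside i) i && c.isInside c.inside i &&
    (List.finRange 8).all fun j => decide (i = j) ||
      (c.isInside (c.outside i) j && edgeCheck (M i j) (c.gram i j) (c.gram i i) (c.gram j j))) &&
  timeLike c.inside

end PolytopeCertificate

/-- The weights of the certificates for boundedness. -/
def weightMatrix : Matrix (Fin 7) (Fin 7) ℕ :=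
  ![![0, 0, 0, 39575, 388239, 87477, 9131],
    ![0, 0, 573032, 724506, 4676630, 0, 68975],
    ![0, 573032, 0, 808475, 9674106, 251762, 0],
    ![39575, 724506, 808475, 65196, 2591435, 73295, 3150],
    ![388239, 4676630, 9674106, 2591435, 1008269, 162927, 5440],
    ![87477, 0, 251762, 73295, 162927, 0, 0],
    ![9131, 68975, 0, 3150, 5440, 0, 0]]

/-- The weights for the second half of the twisted polytope. -/
def twistedWeightMatrix : Matrix (Fin 7) (Fin 7) ℕ :=
  ![![0, 0, 0, 100504, 355977, 29279, 27505],
    ![0, 0, 191797, 1961595, 4557775, 0, 207779],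
    ![0, 191797, 0, 769483, 3203276, 28089, 0],
    ![100504, 1961595, 769483, 487027, 7657258, 74766, 24195],
    ![355977, 4557775, 3203276, 7657258, 909531, 54467, 14841],
    ![29279, 0, 28089, 74766, 54467, 0, 0],
    ![27505, 207779, 0, 24195, 14841, 0, 0]]

/-- The polytope with Coxeter graph `reflectedGraph`. -/
def reflectedCertificate : PolytopeCertificate where
  normal :=
  ![![⟨1, 0⟩, ⟨0, 0⟩, ⟨0, 0⟩, ⟨0, 0⟩, ⟨0, 0⟩],
    ![⟨-1, 0⟩, ⟨1, 0⟩, ⟨0, 0⟩, ⟨0, 0⟩, ⟨0, 0⟩],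
    ![⟨0, 0⟩, ⟨0, -2⟩, ⟨-3, 0⟩, ⟨0, 0⟩, ⟨1, 0⟩],
    ![⟨0, 0⟩, ⟨0, 0⟩, ⟨1, 0⟩, ⟨0, 0⟩, ⟨0, 0⟩],
    ![⟨0, 0⟩, ⟨0, 0⟩, ⟨0, -11⟩, ⟨12, 4⟩, ⟨4, 5⟩],
    ![⟨0, 0⟩, ⟨0, 0⟩, ⟨0, -11⟩, ⟨-12, -4⟩, ⟨4, 5⟩],
    ![⟨-66, 0⟩, ⟨-22, 0⟩, ⟨0, 0⟩, ⟨15, 27⟩, ⟨16, 20⟩],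
    ![⟨-66, 0⟩, ⟨-22, 0⟩, ⟨0, 0⟩, ⟨-15, -27⟩, ⟨16, 20⟩]]
  outside :=
  ![![775, 60, -298, 34, 476],
    ![-456, 206, -456, 0, 476],
    ![-358, -358, -358, -2, 476],
    ![-263, -263, 675, 47, 476],
    ![-108, -108, -133, 578, 476],
    ![-108, -108, -133, -578, 476],
    ![-342, -157, -64, 519, 476],
    ![-342, -157, -64, -519, 476]]
  inside := ![-112, -112, -112, -181, 476]
  facet b := bif b then ![0, 1, 2, 3, 4, 6] else ![0, 1, 2, 3, 5, 7]
  weight b := bif b then weightMatrix else weightMatrix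

/-- The polytope with Coxeter graph `twistedGraph`. -/
def twistedCertificate : PolytopeCertificate where
  normal :=
  ![![⟨1, 0⟩, ⟨0, 0⟩, ⟨0, 0⟩, ⟨0, 0⟩, ⟨0, 0⟩],
    ![⟨-1, 0⟩, ⟨1, 0⟩, ⟨0, 0⟩, ⟨0, 0⟩, ⟨0, 0⟩],
    ![⟨0, 0⟩, ⟨0, -2⟩, ⟨-3, 0⟩, ⟨0, 0⟩, ⟨1, 0⟩],
    ![⟨0, 0⟩, ⟨0, 0⟩, ⟨1, 0⟩, ⟨0, 0⟩, ⟨0, 0⟩],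
    ![⟨0, 0⟩, ⟨0, 0⟩, ⟨0, -11⟩, ⟨12, 4⟩, ⟨4, 5⟩],
    ![⟨0, -33⟩, ⟨0, -11⟩, ⟨0, 0⟩, ⟨-36, -12⟩, ⟨10, 18⟩],
    ![⟨-66, 0⟩, ⟨-22, 0⟩, ⟨0, 0⟩, ⟨15, 27⟩, ⟨16, 20⟩],
    ![⟨0, 0⟩, ⟨0, 0⟩, ⟨-22, 0⟩, ⟨-5, -9⟩, ⟨2, 8⟩]]
  outside :=
  ![![775, 60, -298, -32, 476],
    ![-456, 206, -456, 6, 476],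
    ![-358, -358, -358, 4, 476],
    ![-263, -263, 678, 5, 476],
    ![-108, -108, -133, 578, 476],
    ![-133, -116, -108, -576, 476],
    ![-342, -157, -64, 519, 476],
    ![-66, -66, -353, -536, 476]]
  inside := ![-112, -112, -112, -115, 476]
  facet b := bif b then ![0, 1, 2, 3, 4, 6] else ![3, 2, 1, 0, 5, 7]
  weight b := bif b then weightMatrix else twistedWeightMatrix

theorem reflectedCertificate_check : reflectedCertificate.check reflectedGraph = true := by
  decide +kernel

theorem twistedCertificate_check : twistedCertificate.check twistedGraph = true := by
  decide +kernel

theorem reflectedCertificate_bound (b : Bool) :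
    pivotCheck 5 (reflectedCertificate.boundMatrix b) = true := by
  revert b; decide +kernel

theorem twistedCertificate_bound (b : Bool) :
    pivotCheck 5 (twistedCertificate.boundMatrix b) = true := by
  revert b; decide +kernel

end CoxeterGrowth

/-! ### Soundness of the certificates for the polytopes -/

namespace CoxeterGrowth

namespace GoldenInt

/-- The embedding `ℤ[φ] → ℝ`. -/
noncomputable def toReal : GoldenInt →+* ℝ :=
  (QuadraticAlgebra.lift (R := ℤ) (a := 1) (b := 1) (A := ℝ) ⟨Real.goldenRatio, by
    simp [← sq, Real.goldenRatio_sq, add_comm]⟩ : GoldenInt →ₐ[ℤ] ℝ).toRingHom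

theorem toReal_apply (x : GoldenInt) : toReal x = x.re + x.im * Real.goldenRatio := by
  simp [toReal, QuadraticAlgebra.lift]

/-- Doubling a + bφ gives u + b√5 with u = 2a + b. When u and b have opposite signs, comparing u²
with 5b² decides the sign of the sum. -/
theorem toReal_pos {x : GoldenInt} (hx : x.isPos = true) : 0 < toReal x := by
  obtain ⟨a, b⟩ := x
  have h5 : Real.sqrt 5 ^ 2 = 5 := Real.sq_sqrt (by norm_num)
  have h0 : 0 < Real.sqrt 5 := Real.sqrt_pos.2 (by norm_num)
  have key : toReal ⟨a, b⟩ = ((2 * a + b : ℤ) + (b : ℤ) * Real.sqrt 5) / 2 := by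
    rw [toReal_apply, Real.goldenRatio]
    push_cast
    ring
  rw [key]
  simp only [isPos, Bool.or_eq_true, Bool.and_eq_true, decide_eq_true_eq] at hx
  generalize 2 * a + b = u at hx
  have : 0 < (u : ℝ) + b * Real.sqrt 5 := by
    rcases hx with ((⟨h1, h2⟩ | ⟨h1, h2⟩) | ⟨h1, h2⟩) | ⟨h1, h2⟩
    · have h1' : (0 : ℝ) < u := by exact_mod_cast h1
      have h2' : (0 : ℝ) ≤ b := by exact_mod_cast h2
      positivity
    · have h1' : (0 : ℝ) ≤ u := by exact_mod_cast h1
      have h2' : (0 : ℝ) < b := by exact_mod_cast h2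
      positivity
    · have h1' : (0 : ℝ) < u := by exact_mod_cast h1
      have h2' : (5 * b ^ 2 : ℝ) < u ^ 2 := by exact_mod_cast h2
      have := abs_lt_of_sq_lt_sq (a := (b : ℝ) * Real.sqrt 5) (b := u)
        (by rw [mul_pow, h5]; linarith) h1'.le
      linarith [(abs_lt.1 this).1]
    · have h1' : (0 : ℝ) < b := by exact_mod_cast h1
      have h2' : (u ^ 2 : ℝ) < 5 * b ^ 2 := by exact_mod_cast h2
      have := abs_lt_of_sq_lt_sq (a := (u : ℝ)) (b := b * Real.sqrt 5)
        (by rw [mul_pow, h5]; linarith) (by positivity)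
      linarith [(abs_lt.1 this).1]
  linarith

end GoldenInt

open GoldenInt

theorem toReal_diagForm (d x y : Fin 5 → GoldenInt) :
    toReal (diagForm d x y) =
      diagForm (fun k => toReal (d k)) (fun k => toReal (x k)) (fun k => toReal (y k)) := by
  simp only [diagForm, map_add, map_mul]

theorem finSum_eq_sum (n : ℕ) (f : Fin n → GoldenInt) : finSum n f = ∑ i, f i := by
  rw [finSum, ← List.ofFn_eq_map, List.sum_ofFn]

/-- Soundness of `pivotCheck`. -/
theorem quadratic_nonneg_of_pivotCheck {n : ℕ} {M : Fin n → Fin n → GoldenInt}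
    (h : pivotCheck n M = true) (x : Fin n → ℝ) :
    0 ≤ ∑ i, ∑ j, toReal (M i j) * x i * x j := by
  induction n with
  | zero => simp
  | succ n ih =>
    simp only [pivotCheck, Bool.and_eq_true, List.all_eq_true, List.mem_finRange, forall_const,
      decide_eq_true_eq] at h
    obtain ⟨⟨h0, hs⟩, hrec⟩ := h
    have hpos := toReal_pos h0
    have hx := ih hrec fun i => x i.succ
    set m := toReal (M 0 0)
    set v := ∑ j : Fin n, toReal (M 0 j.succ) * x j.succ with hv
    -- Completing the square in the first variable. Multiplying by the positive pivot instead of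
    -- dividing keeps the remaining matrix over ℤ[φ].
    have key : m * ∑ i, ∑ j, toReal (M i j) * x i * x j = (m * x 0 + v) ^ 2 +
        ∑ i : Fin n, ∑ j : Fin n, toReal (M 0 0 * M i.succ j.succ - M 0 i.succ * M 0 j.succ) *
          x i.succ * x j.succ := by
      have e1 : ∑ i : Fin n, ∑ j : Fin n,
          toReal (M 0 0 * M i.succ j.succ - M 0 i.succ * M 0 j.succ) * x i.succ * x j.succ =
          m * (∑ i : Fin n, ∑ j : Fin n, toReal (M i.succ j.succ) * x i.succ * x j.succ) -
            v * v := by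
        rw [hv, Finset.sum_mul_sum, Finset.mul_sum, ← Finset.sum_sub_distrib]
        refine Finset.sum_congr rfl fun i _ => ?_
        rw [Finset.mul_sum, ← Finset.sum_sub_distrib]
        refine Finset.sum_congr rfl fun j _ => ?_
        rw [map_sub, map_mul, map_mul]
        ring
      have e2 : ∑ j : Fin n, toReal (M 0 j.succ) * x 0 * x j.succ = x 0 * v := by
        rw [hv, Finset.mul_sum]
        exact Finset.sum_congr rfl fun j _ => by ring
      have e3 : ∑ i : Fin n, toReal (M i.succ 0) * x i.succ * x 0 = x 0 * v := by
        rw [hv, Finset.mul_sum]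
        exact Finset.sum_congr rfl fun j _ => by rw [hs]; ring
      rw [e1]
      simp only [Fin.sum_univ_succ (n := n), Finset.sum_add_distrib]
      rw [e2, e3]
      ring
    have : 0 ≤ m * ∑ i, ∑ j, toReal (M i j) * x i * x j := by
      rw [key]
      positivity
    exact nonneg_of_mul_nonneg_right this hpos

/-! #### From coordinates over `ℤ[φ]` to the hyperboloid -/

/-- The real diagonal form. -/
noncomputable def realDiag (k : Fin 5) : ℝ := toReal (goldenDiag k)

theorem realDiag_pos (k : Fin 4) : 0 < realDiag k.castSucc := by
  refine toReal_pos ?_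
  revert k
  decide

theorem realDiag_last_neg : realDiag 4 < 0 := by
  have : 0 < toReal (-goldenDiag 4) := toReal_pos (by decide)
  rw [map_neg] at this
  exact neg_pos.1 this

theorem abs_realDiag_pos (k : Fin 5) : 0 < |realDiag k| := by
  refine abs_pos.2 ?_
  induction k using Fin.lastCases with
  | last => exact realDiag_last_neg.ne
  | cast k => exact (realDiag_pos k).ne'

/-- The linear map from the form `realDiag` to the Lorentz form. -/
noncomputable def rescale (z : Fin 5 → ℝ) (k : Fin 5) : ℝ := Real.sqrt |realDiag k| * z k

theorem rescale_surjective (x : Fin 5 → ℝ) : ∃ z, rescale z = x := by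
  refine ⟨fun k => x k / Real.sqrt |realDiag k|, funext fun k => ?_⟩
  rw [rescale, mul_div_cancel₀]
  exact (Real.sqrt_pos.2 (abs_realDiag_pos k)).ne'

theorem lorentz_rescale (z y : Fin 5 → ℝ) :
    lorentz 4 (rescale z) (rescale y) = diagForm realDiag z y := by
  have h (k : Fin 5) : rescale z k * rescale y k = |realDiag k| * z k * y k := by
    have := Real.mul_self_sqrt (abs_nonneg (realDiag k))
    rw [rescale, rescale]
    linear_combination (z k * y k) * this
  have hp (k : Fin 4) := abs_of_pos (realDiag_pos k)
  have h0 := hp 0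
  have h1 := hp 1
  have h2 := hp 2
  have h3 := hp 3
  have h4 := abs_of_neg realDiag_last_neg
  simp only [Fin.isValue, Fin.reduceCastSucc, Fin.castSucc_zero, Fin.castSucc_one] at h0 h1 h2 h3
  rw [lorentz_apply]
  simp only [h, Fin.sum_univ_four, diagForm, Fin.isValue, Fin.reduceCastSucc, Fin.castSucc_zero,
    Fin.castSucc_one, Fin.reduceLast]
  rw [h0, h1, h2, h3, h4]
  ring

namespace PolytopeCertificate

variable (c : PolytopeCertificate)

/-- The real coordinates of a normal vector with respect to the form `realDiag`. -/
noncomputable def realNormal (i : Fin 8) (k : Fin 5) : ℝ := toReal (c.normal i k)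

/-- The unit normal vectors. -/
noncomputable def unitNormal (i : Fin 8) : Fin 5 → ℝ :=
  (Real.sqrt (toReal (c.gram i i)))⁻¹ • rescale (c.realNormal i)

theorem toReal_gram (i j : Fin 8) :
    toReal (c.gram i j) = diagForm realDiag (c.realNormal i) (c.realNormal j) :=
  toReal_diagForm ..

theorem lorentz_unitNormal (i j : Fin 8) : lorentz 4 (c.unitNormal i) (c.unitNormal j) =
    toReal (c.gram i j) / (Real.sqrt (toReal (c.gram i i)) * Real.sqrt (toReal (c.gram j j))) := by
  simp only [unitNormal, map_smul, LinearMap.smul_apply, smul_eq_mul, lorentz_rescale,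
    ← toReal_gram]
  rw [div_eq_mul_inv, mul_inv]
  ring

theorem lorentz_rescale_unitNormal (z : Fin 5 → ℝ) (i : Fin 8) :
    lorentz 4 (rescale z) (c.unitNormal i) =
      (Real.sqrt (toReal (c.gram i i)))⁻¹ * diagForm realDiag z (c.realNormal i) := by
  simp only [unitNormal, map_smul, smul_eq_mul, lorentz_rescale]

end PolytopeCertificate

/-- The normals are not normalized, so each angle condition involves √(N N'). Squaring removes the
root, and the sign of q recovers the lost information; the label 5 uses cos(π/5) = φ/2. -/
theorem dihedral_of_edgeCheck {m : ℕ} {q N N' : GoldenInt} (h : edgeCheck m q N N' = true)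
    (hN : 0 < toReal N) (hN' : 0 < toReal N') :
    (m ≠ 0 → -(toReal q / (Real.sqrt (toReal N) * Real.sqrt (toReal N'))) =
      Real.cos (Real.pi / (m : ℝ))) ∧
    (m = 0 → toReal q / (Real.sqrt (toReal N) * Real.sqrt (toReal N')) ≤ -1) := by
  set s := Real.sqrt (toReal N) * Real.sqrt (toReal N') with hs
  have hspos : 0 < s := mul_pos (Real.sqrt_pos.2 hN) (Real.sqrt_pos.2 hN')
  have hsq : s ^ 2 = toReal N * toReal N' := by
    rw [hs, mul_pow, Real.sq_sqrt hN.le, Real.sq_sqrt hN'.le]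
  have hφ := Real.goldenRatio_pos
  unfold edgeCheck at h
  split at h
  · simp only [Bool.and_eq_true, Bool.or_eq_true, decide_eq_true_eq] at h
    refine ⟨fun h0 => absurd rfl h0, fun _ => ?_⟩
    have h1 := toReal_pos h.1
    rw [map_neg] at h1
    have h2 : s ^ 2 ≤ (-toReal q) ^ 2 := by
      rw [neg_sq, hsq]
      rcases h.2 with h2 | h2
      · rw [← map_mul, ← map_pow, h2]
      · have := toReal_pos h2
        rw [map_sub, map_pow, map_mul] at this
        linarith
    have h3 := (sq_le_sq₀ hspos.le h1.le).1 h2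
    rw [div_le_iff₀ hspos]
    linarith
  · simp only [decide_eq_true_eq] at h
    simp [h]
  · simp only [Bool.and_eq_true, decide_eq_true_eq] at h
    refine ⟨fun _ => ?_, fun h0 => absurd h0 (by norm_num)⟩
    have h1 := toReal_pos h.1
    rw [map_neg] at h1
    have h2 : (2 * -toReal q) ^ 2 = s ^ 2 := by
      have := congrArg toReal h.2
      rw [map_mul, map_mul, map_pow, map_ofNat] at this
      rw [hsq, ← this]
      ring
    have h3 := (sq_eq_sq₀ (by positivity) hspos.le).1 h2
    push_cast
    rw [Real.cos_pi_div_three, ← neg_div, div_eq_div_iff hspos.ne' two_ne_zero]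
    linarith
  · simp only [Bool.and_eq_true, decide_eq_true_eq] at h
    refine ⟨fun _ => ?_, fun h0 => absurd h0 (by norm_num)⟩
    have h1 := toReal_pos h.1
    rw [map_neg] at h1
    have h2 : (2 * -toReal q) ^ 2 = (Real.goldenRatio * s) ^ 2 := by
      have := congrArg toReal h.2
      rw [map_mul, map_mul, map_mul, map_pow, map_pow, map_ofNat, toReal_apply ⟨0, 1⟩] at this
      rw [mul_pow _ s, hsq]
      simp only [Int.cast_zero, Int.cast_one, zero_add, one_mul] at this
      rw [← this]
      ring
    have h3 := (sq_eq_sq₀ (by positivity) (by positivity)).1 h2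
    have h4 : Real.cos (Real.pi / 5) = Real.goldenRatio / 2 := by
      rw [Real.cos_pi_div_five, Real.goldenRatio]
      ring
    push_cast
    rw [h4, ← neg_div, div_eq_div_iff hspos.ne' two_ne_zero]
    linarith
  · exact absurd h (by simp)

namespace PolytopeCertificate

theorem toReal_diagForm_intCast (z : Fin 5 → ℤ) (y : Fin 5 → GoldenInt) :
    toReal (diagForm goldenDiag (fun k => (z k : GoldenInt)) y) =
      diagForm realDiag (fun k => (z k : ℝ)) (fun k => toReal (y k)) := by
  rw [toReal_diagForm]
  simp only [map_intCast]
  rfl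

theorem exists_smul_mem_hyperbolicSpace {z : Fin 5 → ℤ} (h : timeLike z = true) :
    ∃ a : ℝ, 0 < a ∧ a • rescale (fun k => (z k : ℝ)) ∈ hyperbolicSpace 4 := by
  simp only [timeLike, Bool.and_eq_true, decide_eq_true_eq] at h
  have hq := toReal_pos h.1
  rw [map_neg, toReal_diagForm_intCast] at hq
  simp only [map_intCast] at hq
  rw [← lorentz_rescale] at hq
  set w := rescale fun k => (z k : ℝ) with hw
  have hs := Real.sqrt_pos.2 hq
  refine ⟨(Real.sqrt (-lorentz 4 w w))⁻¹, inv_pos.2 hs, ?_, ?_⟩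
  · simp only [map_smul, LinearMap.smul_apply, smul_eq_mul]
    have := Real.mul_self_sqrt hq.le
    field_simp
    linarith
  · have h4 : (0 : ℝ) < z 4 := by exact_mod_cast h.2
    have hd := Real.sqrt_pos.2 (abs_realDiag_pos 4)
    refine mul_pos (inv_pos.2 hs) ?_
    rw [hw]
    exact mul_pos hd h4

variable {c : PolytopeCertificate} {M : CoxeterMatrix (Fin 8)}

theorem check_iff : c.check M = true ↔ (∀ i, (c.gram i i).isPos = true ∧
    timeLike (c.outside i) = true ∧ c.isOutside (c.outside i) i = true ∧
    c.isInside c.inside i = true ∧ ∀ j, i ≠ j → c.isInside (c.outside i) j = true ∧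
      edgeCheck (M i j) (c.gram i j) (c.gram i i) (c.gram j j) = true) ∧
    timeLike c.inside = true := by
  simp only [check, Bool.and_eq_true, Bool.or_eq_true, List.all_eq_true, List.mem_finRange,
    forall_const, decide_eq_true_eq, and_assoc, or_iff_not_imp_left, ne_eq]

theorem lorentz_neg_of_isInside {z : Fin 5 → ℤ} {i : Fin 8} (hi : (c.gram i i).isPos = true)
    (h : c.isInside z i = true) {a : ℝ} (ha : 0 < a) :
    lorentz 4 (a • rescale (fun k => (z k : ℝ))) (c.unitNormal i) < 0 := by
  have h1 := toReal_pos h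
  have h2 := inv_pos.2 (Real.sqrt_pos.2 (toReal_pos hi))
  rw [map_neg, toReal_diagForm_intCast, neg_pos] at h1
  rw [map_smul, LinearMap.smul_apply, lorentz_rescale_unitNormal, smul_eq_mul]
  exact mul_neg_of_pos_of_neg ha (mul_neg_of_pos_of_neg h2 h1)

theorem lorentz_pos_of_isOutside {z : Fin 5 → ℤ} {i : Fin 8} (hi : (c.gram i i).isPos = true)
    (h : c.isOutside z i = true) {a : ℝ} (ha : 0 < a) :
    0 < lorentz 4 (a • rescale (fun k => (z k : ℝ))) (c.unitNormal i) := by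
  have h1 := toReal_pos h
  have h2 := inv_pos.2 (Real.sqrt_pos.2 (toReal_pos hi))
  rw [toReal_diagForm_intCast] at h1
  rw [map_smul, LinearMap.smul_apply, lorentz_rescale_unitNormal, smul_eq_mul]
  exact mul_pos ha (mul_pos h2 h1)

/-- The polytope described by a certificate. -/
noncomputable def polytope (h : c.check M = true) : HyperbolicPolytope 4 (Fin 8) where
  normal := c.unitNormal
  unit i := by
    have hi := toReal_pos ((check_iff.1 h).1 i).1
    rw [lorentz_unitNormal, Real.mul_self_sqrt hi.le, div_self hi.ne']
  fullDim := by
    obtain ⟨h1, h2⟩ := check_iff.1 h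
    obtain ⟨a, ha, hmem⟩ := exists_smul_mem_hyperbolicSpace h2
    refine ⟨{x | ∀ i, lorentz 4 x (c.unitNormal i) < 0}, ?_, ⟨_, fun i => ?_, hmem⟩, fun x hx =>
      ⟨hx.2, fun i _ => (hx.1 i).le⟩⟩
    · rw [Set.ofPred_forall]
      exact isOpen_iInter_of_finite fun i => isOpen_lt
        (HyperbolicPolytope.continuous_lorentz.comp (by fun_prop : Continuous fun x =>
          (x, c.unitNormal i))) continuous_const
    · exact lorentz_neg_of_isInside (h1 i).1 (h1 i).2.2.2.1 ha
  irredundant J hJ := by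
    -- The certificate point lying outside only the i-th half-space belongs to every intersection
    -- that omits i, but not to the polytope.
    obtain ⟨i, hi⟩ := (Set.ne_univ_iff_exists_notMem J).1 hJ
    have h1 := (check_iff.1 h).1
    obtain ⟨a, ha, hmem⟩ := exists_smul_mem_hyperbolicSpace (h1 i).2.1
    refine ⟨fun x hx => ⟨hx.1, fun j _ => hx.2 j trivial⟩, fun hsub => ?_⟩
    have := (hsub ⟨hmem, fun j hj => ?_⟩).2 i trivial
    · exact absurd this (not_le.2 (lorentz_pos_of_isOutside (h1 i).1 (h1 i).2.2.1 ha))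
    · have hij : i ≠ j := fun hij => hi (hij ▸ hj)
      exact (lorentz_neg_of_isInside (h1 j).1 ((h1 i).2.2.2.2 j hij).1 ha).le

theorem polytope_hasCoxeterGraph (h : c.check M = true) : (polytope h).HasCoxeterGraph M := by
  intro i j hij
  have h1 := (check_iff.1 h).1
  change (_ → -lorentz 4 (c.unitNormal i) (c.unitNormal j) = _) ∧
    (_ → lorentz 4 (c.unitNormal i) (c.unitNormal j) ≤ _)
  rw [lorentz_unitNormal]
  exact dihedral_of_edgeCheck ((h1 i).2.2.2.2 j hij).2 (toReal_pos (h1 i).1) (toReal_pos (h1 j).1)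

theorem toReal_boundMatrix (b : Bool) (k l : Fin 5) : toReal (c.boundMatrix b k l) =
    (if k = l then -10000000 * realDiag k - 50000 else 0) -
      ∑ i, ∑ j, (c.weight b i j : ℝ) * (realDiag k * toReal (c.halfNormal b i k) *
        (realDiag l * toReal (c.halfNormal b j l))) := by
  simp only [boundMatrix, finSum_eq_sum, map_sub, map_sum, map_mul, map_natCast]
  congr 1
  split_ifs
  · simp only [map_sub, map_mul, map_neg, map_ofNat]
    rfl
  · exact map_zero _

theorem sum_quadratic_eq {ι κ : Type*} [Fintype ι] [Fintype κ] (w : ι → ι → ℝ) (a : ι → κ → ℝ)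
    (z : κ → ℝ) : ∑ k, ∑ l, (∑ i, ∑ j, w i j * (a i k * a j l)) * z k * z l =
      ∑ i, ∑ j, w i j * ((∑ k, a i k * z k) * ∑ l, a j l * z l) := by
  have hr (i j : ι) : (∑ k, a i k * z k) * ∑ l, a j l * z l =
      ∑ k, ∑ l, a i k * z k * (a j l * z l) := Finset.sum_mul_sum ..
  simp only [hr, Finset.mul_sum, Finset.sum_mul]
  calc _ = ∑ p : κ × κ, ∑ q : ι × ι, w q.1 q.2 * (a q.1 p.1 * a q.2 p.2) * z p.1 * z p.2 := by
        simp only [Fintype.sum_prod_type]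
    _ = ∑ q : ι × ι, ∑ p : κ × κ, w q.1 q.2 * (a q.1 p.1 * a q.2 p.2) * z p.1 * z p.2 :=
        Finset.sum_comm
    _ = _ := by
        simp only [Fintype.sum_prod_type]
        exact Finset.sum_congr rfl fun i _ => Finset.sum_congr rfl fun j _ =>
          Finset.sum_congr rfl fun k _ => Finset.sum_congr rfl fun l _ => by ring

/-- The linear forms ℓ_i of the facets are nonpositive on the half considered, so the sum of w_ij
ℓ_i ℓ_j with weights w_ij ≥ 0 is nonnegative. Semidefiniteness of the bound matrix, together with
norm -1 for z, leaves 0 ≤ 10000000 - 50000 |z|², whence the bound 200. -/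
theorem sq_le_of_pivotCheck {b : Bool} (h : pivotCheck 5 (c.boundMatrix b) = true)
    {z : Fin 5 → ℝ} (hz : diagForm realDiag z z = -1)
    (hf : ∀ i, diagForm realDiag z (fun k => toReal (c.halfNormal b i k)) ≤ 0) (k : Fin 5) :
    z k ^ 2 ≤ 200 := by
  have h0 := quadratic_nonneg_of_pivotCheck h z
  have hl (i : Fin 7) : ∑ k, realDiag k * toReal (c.halfNormal b i k) * z k ≤ 0 := by
    have := hf i
    simp only [diagForm] at this
    simp only [Fin.sum_univ_five]
    linarith
  have h1 : ∑ i, ∑ j, toReal (c.boundMatrix b i j) * z i * z j =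
      10000000 - 50000 * ∑ k, z k ^ 2 - ∑ i, ∑ j, (c.weight b i j : ℝ) *
        ((∑ k, realDiag k * toReal (c.halfNormal b i k) * z k) *
          ∑ l, realDiag l * toReal (c.halfNormal b j l) * z l) := by
    rw [← sum_quadratic_eq]
    simp only [toReal_boundMatrix, sub_mul, Finset.sum_sub_distrib]
    congr 1
    simp only [ite_mul, zero_mul, Finset.sum_ite_eq, Finset.mem_univ, if_true]
    simp only [diagForm] at hz
    simp only [Fin.sum_univ_five]
    linear_combination -10000000 * hz
  have h2 : 0 ≤ ∑ i, ∑ j, (c.weight b i j : ℝ) *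
        ((∑ k, realDiag k * toReal (c.halfNormal b i k) * z k) *
          ∑ l, realDiag l * toReal (c.halfNormal b j l) * z l) :=
    Finset.sum_nonneg fun i _ => Finset.sum_nonneg fun j _ =>
      mul_nonneg (Nat.cast_nonneg _) (mul_nonneg_of_nonpos_of_nonpos (hl i) (hl j))
  have h3 : z k ^ 2 ≤ ∑ k, z k ^ 2 :=
    Finset.single_le_sum (fun k _ => sq_nonneg (z k)) (Finset.mem_univ k)
  linarith

theorem isCompact_carrier (h : c.check M = true)
    (hb : ∀ b, pivotCheck 5 (c.boundMatrix b) = true) : IsCompact (polytope h).carrier := by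
  have hsub : (polytope h).carrier ⊆ Set.univ.pi fun k : Fin 5 =>
      Set.Icc (-Real.sqrt (|realDiag k| * 200)) (Real.sqrt (|realDiag k| * 200)) := by
    intro x hx k _
    obtain ⟨z, rfl⟩ := rescale_surjective x
    have hz : diagForm realDiag z z = -1 := by rw [← lorentz_rescale]; exact hx.1.1
    have hn (i : Fin 8) : diagForm realDiag z (c.realNormal i) ≤ 0 := by
      have h1 : lorentz 4 (rescale z) (c.unitNormal i) ≤ 0 := hx.2 i trivial
      rw [lorentz_rescale_unitNormal] at h1
      exact nonpos_of_mul_nonpos_right h1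
        (inv_pos.2 (Real.sqrt_pos.2 (toReal_pos ((check_iff.1 h).1 i).1)))
    have h3 := realDiag_pos 3
    have key : z k ^ 2 ≤ 200 := by
      -- The hyperplane of the third coordinate, counted from 0, is orthogonal to the facets 0, 1,
      -- 2, 3: it is the facet along which the two truncated simplices are glued, and each half has
      -- its own certificate.
      rcases le_total 0 (z 3) with h0 | h0
      · refine sq_le_of_pivotCheck (hb true) hz (fun i => ?_) k
        induction i using Fin.cases with
        | zero =>
          have : 0 ≤ realDiag 3 * z 3 := mul_nonneg h3.le h0
          simpa [halfNormal, diagForm] using this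
        | succ i => exact hn _
      · refine sq_le_of_pivotCheck (hb false) hz (fun i => ?_) k
        induction i using Fin.cases with
        | zero =>
          have : realDiag 3 * z 3 ≤ 0 := mul_nonpos_of_nonneg_of_nonpos h3.le h0
          simpa [halfNormal, diagForm] using this
        | succ i => exact hn _
    refine abs_le.1 (Real.abs_le_sqrt ?_)
    rw [rescale, mul_pow, Real.sq_sqrt (abs_nonneg _)]
    exact mul_le_mul_of_nonneg_left key (abs_nonneg _)
  refine (isCompact_univ_pi fun k => isCompact_Icc).of_isClosed_subset ?_ hsub
  -- The strict inequality defining the upper sheet may be weakened to obtain a closed set, because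
  -- no vector of norm -1 has last coordinate 0.
  have heq : (polytope h).carrier = {x | lorentz 4 x x = -1} ∩ {x | 0 ≤ x (Fin.last 4)} ∩
      ⋂ i, {x | lorentz 4 x (c.unitNormal i) ≤ 0} := by
    ext x
    constructor
    · exact fun hx => ⟨⟨hx.1.1, hx.1.2.le⟩, Set.mem_iInter.2 fun i => hx.2 i trivial⟩
    · rintro ⟨⟨h1, h2⟩, h3⟩
      refine ⟨⟨h1, lt_of_le_of_ne h2 fun h0 => ?_⟩, fun i _ => Set.mem_iInter.1 h3 i⟩
      have h1' : lorentz 4 x x = -1 := h1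
      rw [lorentz_apply, ← h0] at h1'
      have : 0 ≤ ∑ i : Fin 4, x i.castSucc * x i.castSucc :=
        Finset.sum_nonneg fun i _ => mul_self_nonneg _
      linarith
  rw [heq]
  refine ((isClosed_eq (HyperbolicPolytope.continuous_lorentz.comp (by fun_prop : Continuous
    fun x : Fin 5 → ℝ => (x, x))) continuous_const).inter
    (isClosed_le continuous_const (continuous_apply _))).inter (isClosed_iInter fun i => ?_)
  exact isClosed_le (HyperbolicPolytope.continuous_lorentz.comp (by fun_prop : Continuous fun x =>
    (x, c.unitNormal i))) continuous_const

end PolytopeCertificate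

theorem exists_hyperbolicPolytope {M : CoxeterMatrix (Fin 8)}
    (hM : M = reflectedGraph ∨ M = twistedGraph) :
    ∃ P : HyperbolicPolytope 4 (Fin 8), P.HasCoxeterGraph M ∧ IsCompact P.carrier := by
  rcases hM with rfl | rfl
  · exact ⟨_, PolytopeCertificate.polytope_hasCoxeterGraph reflectedCertificate_check,
      PolytopeCertificate.isCompact_carrier _ reflectedCertificate_bound⟩
  · exact ⟨_, PolytopeCertificate.polytope_hasCoxeterGraph twistedCertificate_check,
      PolytopeCertificate.isCompact_carrier _ twistedCertificate_bound⟩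

end CoxeterGrowth

/-! ### Lowest terms, the growth rate and the theorem -/

namespace CoxeterGrowth

open Polynomial

/-- Since D is reciprocal, the product of the X - ρ equals the product of the 1 - ρX. In this form
the root α itself, rather than its inverse, governs the growth of the coefficients. -/
theorem growthDenominator_coe_eq_prod :
    ((growthDenominator.map (Int.castRingHom ℂ) : ℂ[X]) : PowerSeries ℂ) =
      ((growthDenominator.map (Int.castRingHom ℂ)).roots.map
        fun ρ => 1 - PowerSeries.C ρ * PowerSeries.X).prod := by
  set F := growthDenominator.map (Int.castRingHom ℂ) with hF
  have hmonic : F.Monic := growthDenominator_monic.map _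
  have hcard : F.roots.card = 16 := by
    rw [← (IsAlgClosed.splits F).natDegree_eq_card_roots, hF,
      natDegree_map_eq_of_injective Int.cast_injective, growthDenominator_natDegree]
  have hsplit : F = (F.roots.map fun ρ => X - C ρ).prod := by
    have := (IsAlgClosed.splits F).eq_prod_roots
    rwa [hmonic.leadingCoeff, C_1, one_mul] at this
  have hpoly : F = (F.roots.map fun ρ => 1 - C ρ * X).prod := by
    refine Polynomial.funext fun z => ?_
    rw [eval_multiset_prod, Multiset.map_map]
    simp only [Function.comp_def, eval_sub, eval_one, eval_mul, eval_C, eval_X]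
    rcases eq_or_ne z 0 with rfl | hz
    · rw [hF, eval_growthDenominator_complex]
      simp
    · have h1 : F.eval z⁻¹ = (F.roots.map fun ρ => z⁻¹ - ρ).prod := by
        conv_lhs => rw [hsplit]
        rw [eval_multiset_prod, Multiset.map_map]
        simp
      have h2 : F.eval z = z ^ 16 * F.eval z⁻¹ := by
        rw [hF, eval_growthDenominator_complex, eval_growthDenominator_complex]
        field_simp
        ring
      rw [h2, h1, ← hcard, ← Multiset.prod_replicate, ← Multiset.map_const', ← Multiset.prod_map_mul]
      congr 1
      refine Multiset.map_congr rfl fun ρ _ => ?_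
      field_simp
  conv_lhs => rw [hpoly]
  rw [← coeToPowerSeries.ringHom_apply, map_multiset_prod, Multiset.map_map]
  congr 1
  refine Multiset.map_congr rfl fun ρ _ => ?_
  simp

theorem eval_growthNumerator_pos {x : ℝ} (hx : 0 < x) :
    0 < (growthNumerator.map (Int.castRingHom ℝ)).eval x := by
  simp only [growthNumerator, Polynomial.map_mul, Polynomial.map_pow, Polynomial.map_add,
    Polynomial.map_sub, Polynomial.map_one, map_X, eval_mul, eval_pow, eval_add, eval_sub,
    eval_one, eval_X]
  have h1 : 0 < x ^ 2 - x + 1 := by nlinarith [sq_nonneg (x - 1)]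
  have h2 : 0 < x ^ 4 - x ^ 3 + x ^ 2 - x + 1 := by
    nlinarith [sq_nonneg (x ^ 2 - x / 2), sq_nonneg (x - 1), sq_nonneg x]
  positivity

theorem eval_growthNumerator_ofReal_ne_zero {x : ℝ} (hx : 0 < x) :
    (growthNumerator.map (Int.castRingHom ℂ)).eval (x : ℂ) ≠ 0 := by
  have h : (growthNumerator.map (Int.castRingHom ℂ)).eval (x : ℂ) =
      ((growthNumerator.map (Int.castRingHom ℝ)).eval x : ℝ) := by
    have := eval_map_apply (f := Complex.ofRealHom) (p := growthNumerator.map (Int.castRingHom ℝ)) x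
    rw [Polynomial.map_map,
      RingHom.ext_int (Complex.ofRealHom.comp (Int.castRingHom ℝ)) (Int.castRingHom ℂ)] at this
    exact this
  rw [h, Complex.ofReal_ne_zero]
  exact (eval_growthNumerator_pos hx).ne'

/-- An irreducible D not coprime to the numerator would divide it, and the numerator would vanish at
a positive root of D, where it is positive. -/
theorem isRelPrime_growthNumerator (hirr : Irreducible growthDenominator) {x : ℝ} (hx : 0 < x)
    (hroot : (growthDenominator.map (Int.castRingHom ℂ)).IsRoot (x : ℂ)) :
    IsRelPrime growthNumerator growthDenominator := by
  rw [isRelPrime_comm]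
  refine (hirr.isRelPrime_iff_not_dvd).2 fun hdvd => eval_growthNumerator_ofReal_ne_zero hx ?_
  exact hroot.dvd (Polynomial.map_dvd _ hdvd)

theorem growthRate_eq {G : Type*} [Group G] {S : Set G} {α : ℝ} (hα : 1 < α)
    (hroots : ∀ z, (growthDenominator.map (Int.castRingHom ℂ)).IsRoot z → ‖z‖ ≤ α)
    (hroot : (growthDenominator.map (Int.castRingHom ℂ)).IsRoot (α : ℂ))
    (h : growthSeries S * (growthDenominator : PowerSeries ℤ) = growthNumerator) :
    growthRate S = α := by
  refine limsup_coeff_eq (fun k => Nat.cast_nonneg _) hα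
    (p := growthNumerator.map (Int.castRingHom ℂ)) (q := growthDenominator.map (Int.castRingHom ℂ))
    (s := (growthDenominator.map (Int.castRingHom ℂ)).roots)
    (fun ρ hρ => hroots ρ (mem_roots'.1 hρ).2) growthDenominator_coe_eq_prod ?_ (isRoot_inv hroot) ?_
  · have := congrArg (PowerSeries.map (Int.castRingHom ℂ)) h
    rw [map_mul, ← polynomial_map_coe, ← polynomial_map_coe] at this
    rw [← this]
    congr 1
  · rw [← Complex.ofReal_inv]
    exact eval_growthNumerator_ofReal_ne_zero (by positivity)

end CoxeterGrowth

open CoxeterGrowth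

theorem mainTheorem5 :
    -- The denominator `D` takes a prime value at `186`, is irreducible and a 2-Salem polynomial.
    (growthDenominator.eval 186 = 2008067839285267472384758820173242349 ∧
      Nat.Prime 2008067839285267472384758820173242349) ∧
    Irreducible growthDenominator ∧
    IsTwoSalemPolynomial growthDenominator ∧
    ∃ α β : ℝ, 1 < β ∧ β < α ∧
      |α - 3.70422| < 0.000005 ∧ |β - 1.24202| < 0.000005 ∧
      -- The roots of `D`: two reciprocal pairs of positive real roots and six pairs of distinct
      -- complex conjugate roots on the unit circle.
      (∃ Z : Finset ℂ, Z.card = 6 ∧ (∀ z ∈ Z, ‖z‖ = 1 ∧ 0 < z.im) ∧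
        (growthDenominator.map (Int.castRingHom ℂ)).roots =
          {(α : ℂ), (α : ℂ)⁻¹, (β : ℂ), (β : ℂ)⁻¹} + Z.val +
            Z.val.map (starRingEnd ℂ)) ∧
      IsTwoSalem (α : ℂ) ∧ IsTwoSalem (β : ℂ) ∧
      -- The group: it exists as a cocompact reflection group in `ℍ⁴`, its growth function has
      -- denominator `D`, and its growth rate is `α`.
      ∀ M : CoxeterMatrix (Fin 8), M = reflectedGraph ∨ M = twistedGraph →
        (∃ P : HyperbolicPolytope 4 (Fin 8), P.HasCoxeterGraph M ∧ IsCompact P.carrier) ∧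
        ∀ P : HyperbolicPolytope 4 (Fin 8), P.HasCoxeterGraph M → IsCompact P.carrier →
          IsGrowthFunction P.generators growthNumerator growthDenominator ∧
          growthRate P.generators = α ∧
          IsTwoSalem ((growthRate P.generators : ℝ) : ℂ) := by
  obtain ⟨α, β, hβ1, hβα, hα, hβ, Z, hcard, hZ, hroots⟩ := exists_roots_growthDenominator
  have hiff := fun w : ℂ => isRoot_growthDenominator_iff (w := w) hroots
  have hα1 : 1 < α := hβ1.trans hβα
  have hinv : ∀ x : ℝ, 1 < x → ‖(x : ℂ)⁻¹‖ ≤ 1 := fun x hx => by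
    rw [norm_inv, Complex.norm_real, Real.norm_of_nonneg (by linarith)]
    exact inv_le_one_of_one_le₀ hx.le
  have hnorm : ∀ x : ℝ, 1 < x → ‖(x : ℂ)‖ = x := fun x hx => by
    rw [Complex.norm_real, Real.norm_of_nonneg (by linarith)]
  have hle1 : ∀ w : ℂ, (growthDenominator.map (Int.castRingHom ℂ)).IsRoot w → w ≠ α → w ≠ β →
      ‖w‖ ≤ 1 := by
    intro w hw h1 h2
    rcases (hiff w).1 hw with rfl | rfl | rfl | rfl | h | ⟨z, hz, rfl⟩
    · exact absurd rfl h1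
    · exact hinv α hα1
    · exact absurd rfl h2
    · exact hinv β hβ1
    · exact (hZ w h).1.le
    · rw [RCLike.norm_conj]; exact (hZ z hz).1.le
  have hleα : ∀ w : ℂ, (growthDenominator.map (Int.castRingHom ℂ)).IsRoot w → ‖w‖ ≤ α := by
    intro w hw
    by_cases h1 : w = α
    · rw [h1, hnorm α hα1]
    by_cases h2 : w = β
    · rw [h2, hnorm β hβ1]; exact hβα.le
    · exact (hle1 w hw h1 h2).trans hα1.le
  -- The description of the roots, obtained without irreducibility, gives |z| ≤ α < 5 for every
  -- root, which is all that the prime value at 186 requires.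
  have hirr : Irreducible growthDenominator := irreducible_growthDenominator fun z hz =>
    (hleα z hz).trans_lt (by rw [abs_lt] at hα; norm_num at hα; linarith)
  have hrα : (growthDenominator.map (Int.castRingHom ℂ)).IsRoot (α : ℂ) := (hiff _).2 (by simp)
  have hrβ : (growthDenominator.map (Int.castRingHom ℂ)).IsRoot (β : ℂ) := (hiff _).2 (by simp)
  obtain ⟨z, hz⟩ : Z.Nonempty := Finset.card_pos.1 (by omega)
  have hrz : (growthDenominator.map (Int.castRingHom ℂ)).IsRoot z := (hiff _).2 (by simp [hz])
  have hSα : IsTwoSalem (α : ℂ) := isTwoSalem_of_isRoot growthDenominator_monic hirr hrα hrβ hrz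
    (by rwa [hnorm α hα1]) (by rwa [hnorm β hβ1]) (by simpa using hβα.ne) (hZ z hz).1 hle1
  have hSβ : IsTwoSalem (β : ℂ) := isTwoSalem_of_isRoot growthDenominator_monic hirr hrβ hrα hrz
    (by rwa [hnorm β hβ1]) (by rwa [hnorm α hα1]) (by simpa using hβα.ne') (hZ z hz).1
    fun w hw h1 h2 => hle1 w hw h2 h1
  refine ⟨⟨eval_growthDenominator_186, prime_2008067839285267472384758820173242349⟩, hirr,
    ⟨α, hSα, minpoly_int_eq growthDenominator_monic hirr hrα⟩, α, β, hβ1, hβα, hα, hβ,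
    ⟨Z, hcard, hZ, hroots⟩, hSα, hSβ, fun M hM => ⟨exists_hyperbolicPolytope hM,
      fun P hP _ => ?_⟩⟩
  have hseries := growthSeries_mul_growthDenominator hM P hP
  have hrate : growthRate P.generators = α := growthRate_eq hα1 hleα hrα hseries
  refine ⟨⟨isRelPrime_growthNumerator hirr (by linarith) hrα, by simp [growthDenominator],
    hseries⟩, hrate, ?_⟩
  rw [hrate]
  exact hSα
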